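/- Fix a dimension $d\ge1$. A cube is an axis-parallel cube in $\mathbb R^d$ with side length $\ell(Q)>0$, $\Sigma$ is the linear span of the indicators of (half-open) cubes, $\langle b\rangle_Q=\fint_Q b$, and $1/\sigma(p,q)=1/p+1/q$. Let $\omega:[0,\infty)\to[0,\infty)$ be increasing and subadditive with $\omega(0)=0$ and $\|\omega\|_{\rm Dini}=\int_0^1\omega(t)\frac{dt}{t}<\infty$. Let $K:(\mathbb R^d)^3\setminus\{x=y=z\}\to\mathbb C$ satisfy $|K(x,y,z)|\le C_K(|x-y|+|x-z|)^{-2d}$ and $$|G(x,y,z)-G(x',y,z)|\le\omega\Big(\frac{|x-x'|}{|x-y|+|x-z|}\Big)(|x-y|+|x-z|)^{-2d}\quad\text{whenever } |x-x'|\le\tfrac12\max(|x-y|,|x-z|),$$ for $G\in\{K,K^{1*},K^{2*}\}$, where $K^{1*}(x,y,z)=K(y,x,z)$ and $K^{2*}(x,y,z)=K(z,y,x)$. Let $T:\Sigma\times\Sigma\to L^1_{\rm loc}$ be a bilinear SIO with kernel $K$: it is bilinear and $$\int T(f_1,f_2)\,g=\iiint K(x,y,z)f_1(y)f_2(z)g(x)\,dy\,dz\,dx$$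 for all $f_1,f_2,g\in\Sigma$ with $\operatorname{supp} f_1\cap\operatorname{supp} f_2\cap\operatorname{supp} g=\emptyset$. Let $T_\varepsilon(f,g)(x)=\iint_{\max(|x-y|,|x-z|)>\varepsilon}K(x,y,z)f(y)g(z)\,dy\,dz$ and suppose that, for one pair $1<p_0,q_0<\infty$ with $\sigma(p_0,q_0)\ge1$, $$\sup_{\varepsilon>0}\|T_\varepsilon\|_{L^{p_0}\times L^{q_0}\to L^{\sigma(p_0,q_0)}}\le B<\infty,$$ the norms being tested on $f,g\in\Sigma$. **Theorem.** Let $b\in L^1_{\rm loc}(\mathbb R^d;\mathbb C)$, $1<p,q<\infty$, $\frac12<r<\infty$, $\frac1r<\frac1p+\frac1q$ and $\alpha=d\big(\frac1p+\frac1q-\frac1r\big)$. Then the commutator $[b,T]_1(f,g)=bT(f,g)-T(bf,g)$ satisfies $$\|[b,T]_1\|_{L^p\times L^q\to L^r}\le C\,\sup_Q\ell(Q)^{-\alpha}\fint_Q|b-\langle b\rangle_Q|,$$ where the supremum is over all cubes and $C$ depends only on $d,p,q,r,p_0,q_0,B$ and upper bounds for $C_K$ and $\|\omega\|_{\rm Dini}$.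 Here, if the right-hand side is finite, the assertion includes that the commutator is well defined: for $f,g\in L^\infty_c$ (bounded functions of bounded support) also $bf\in L^\infty_c$; $T(h,k)$, for $h,k\in L^\infty_c$ equal to $f,g$ and to $bf,g$, exists as the limit in $L^1_{\rm loc}$ of $T(h_n,k_n)$, the same for all $h_n,k_n\in\Sigma$ that are uniformly bounded, supported in a common ball, and converge a.e. to $h,k$; and $[b,T]_1$ extends from $L^\infty_c\times L^\infty_c$ to a bilinear operator $L^p\times L^q\to L^r$ with this bound. -/

import Mathlib

open MeasureTheory Filter Topology
open scoped ENNReal NNReal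

noncomputable section

namespace BilinearSIO

/-- The Euclidean space `ℝ^d`, with the Euclidean norm and Lebesgue measure. -/
abbrev Rd (d : ℕ) := EuclideanSpace ℝ (Fin d)

/-- The (half-open, axis-parallel) cube with lower corner `a` and side length `l`. -/
def cube {d : ℕ} (a : Rd d) (l : ℝ) : Set (Rd d) :=
  {x | ∀ i, a i ≤ x i ∧ x i < a i + l}

/-- The class `Σ`: the linear span of the indicator functions of cubes. Since the cubes are
half-open, two elements that agree almost everywhere are equal. -/
def cubeSpan (d : ℕ) : Submodule ℂ (Rd d → ℂ) :=
  Submodule.span ℂ {f | ∃ (a : Rd d) (l : ℝ), 0 < l ∧ f = (cube a l).indicator (fun _ => 1)}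

/-- A bilinear operator defined on `Σ × Σ`, with values in (classes of) measurable functions. -/
abbrev BilinOp (d : ℕ) :=
  cubeSpan d →ₗ[ℂ] cubeSpan d →ₗ[ℂ] (Rd d →ₘ[(volume : Measure (Rd d))] ℂ)

/-! ### Calderón–Zygmund kernels -/

/-- The Dini norm `∫_0^1 ω(t) dt/t`. -/
def diniNorm (ω : ℝ → ℝ) : ℝ≥0∞ :=
  ∫⁻ t in Set.Ioc (0 : ℝ) 1, ENNReal.ofReal (ω t / t)

/-- `ω : [0,∞) → [0,∞)` is increasing, subadditive, vanishes at `0`, and has finite Dini norm. -/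
structure IsDiniModulus (ω : ℝ → ℝ) : Prop where
  mono : MonotoneOn ω (Set.Ici 0)
  zero : ω 0 = 0
  subadd : ∀ s t, 0 ≤ s → 0 ≤ t → ω (s + t) ≤ ω s + ω t
  dini : diniNorm ω < ⊤

/-- The kernel `K^{1*}(x,y,z) = K(y,x,z)` of the first adjoint. -/
def adjOne {d : ℕ} (K : Rd d → Rd d → Rd d → ℂ) : Rd d → Rd d → Rd d → ℂ :=
  fun x y z => K y x z

/-- The kernel `K^{2*}(x,y,z) = K(z,y,x)` of the second adjoint. -/
def adjTwo {d : ℕ} (K : Rd d → Rd d → Rd d → ℂ) : Rd d → Rd d → Rd d → ℂ :=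
  fun x y z => K z y x

/-- The regularity estimate in the first variable. A point `(x,y,z)` off the diagonal and a point
`x'` with `|x-x'| ≤ max(|x-y|,|x-z|)/2` give a point `(x',y,z)` off the diagonal. -/
def RegularFirst {d : ℕ} (G : Rd d → Rd d → Rd d → ℂ) (ω : ℝ → ℝ) : Prop :=
  ∀ x x' y z : Rd d, ¬ (x = y ∧ y = z) → ‖x - x'‖ ≤ (1 / 2) * max ‖x - y‖ ‖x - z‖ →
    ‖G x y z - G x' y z‖ ≤
      ω (‖x - x'‖ / (‖x - y‖ + ‖x - z‖)) / (‖x - y‖ + ‖x - z‖) ^ (2 * d)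

/-- `K` is a bilinear Calderón–Zygmund kernel with size constant (at most) `cK` and modulus of
continuity `ω`. The values of `K` on the diagonal `x = y = z` are irrelevant. -/
structure IsCZKernel {d : ℕ} (K : Rd d → Rd d → Rd d → ℂ) (cK : ℝ≥0) (ω : ℝ → ℝ) : Prop where
  size : ∀ x y z : Rd d, ¬ (x = y ∧ y = z) →
    ‖K x y z‖ ≤ cK / (‖x - y‖ + ‖x - z‖) ^ (2 * d)
  modulus : IsDiniModulus ω
  regular : RegularFirst K ω
  regular_adjOne : RegularFirst (adjOne K) ω
  regular_adjTwo : RegularFirst (adjTwo K) ω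

/-! ### Singular integral operators and their truncations -/

/-- `T` maps `Σ × Σ` into `L^1_loc` and is represented by `K` off the supports: for
`f₁, f₂, g ∈ Σ` whose (closed) supports have no common point,
`⟨T(f₁,f₂), g⟩ = ∫∫∫ K(x,y,z) f₁(y) f₂(z) g(x) dy dz dx`.
Together with `IsCZKernel K cK ω` this says that `T` is a bilinear SIO with kernel `K`. -/
structure HasKernel {d : ℕ} (T : BilinOp d) (K : Rd d → Rd d → Rd d → ℂ) : Prop where
  locallyIntegrable : ∀ f₁ f₂ : cubeSpan d, LocallyIntegrable (T f₁ f₂ : Rd d → ℂ) volume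
  repr : ∀ f₁ f₂ g : cubeSpan d,
    tsupport (f₁ : Rd d → ℂ) ∩ tsupport (f₂ : Rd d → ℂ) ∩ tsupport (g : Rd d → ℂ) = ∅ →
    ∫ x, (T f₁ f₂ : Rd d → ℂ) x * (g : Rd d → ℂ) x =
      ∫ x, (∫ w : Rd d × Rd d,
        K x w.1 w.2 * (f₁ : Rd d → ℂ) w.1 * (f₂ : Rd d → ℂ) w.2) * (g : Rd d → ℂ) x

/-- The truncated operator
`T_ε(f,g)(x) = ∬_{max(|x-y|,|x-z|) > ε} K(x,y,z) f(y) g(z) dy dz`. -/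
def truncation {d : ℕ} (K : Rd d → Rd d → Rd d → ℂ) (ε : ℝ) (f g : Rd d → ℂ) (x : Rd d) : ℂ :=
  ∫ w in {w : Rd d × Rd d | ε < max ‖x - w.1‖ ‖x - w.2‖}, K x w.1 w.2 * f w.1 * g w.2

/-- The Hölder exponent `σ(p,q)`, given by `1/σ(p,q) = 1/p + 1/q`. -/
def sigma (p q : ℝ) : ℝ := (1 / p + 1 / q)⁻¹

/-- `sup_{ε>0} ‖T_ε‖_{L^p × L^q → L^{σ(p,q)}} ≤ B`, tested on the dense class `Σ`, where the
truncations are defined. -/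
def TruncationsBoundedBy {d : ℕ} (K : Rd d → Rd d → Rd d → ℂ) (p q : ℝ) (B : ℝ≥0) : Prop :=
  ∀ ε : ℝ, 0 < ε → ∀ f g : cubeSpan d,
    eLpNorm (truncation K ε (f : Rd d → ℂ) (g : Rd d → ℂ))
        (ENNReal.ofReal (sigma p q)) volume ≤
      B * eLpNorm (f : Rd d → ℂ) (ENNReal.ofReal p) volume *
        eLpNorm (g : Rd d → ℂ) (ENNReal.ofReal q) volume

/-! ### The commutator -/

/-- The class `L^∞_c` of (essentially) bounded functions of bounded support. -/
def MemBddCpt {d : ℕ} (h : Rd d → ℂ) : Prop :=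
  AEStronglyMeasurable h volume ∧
    ∃ M R : ℝ, ∀ᵐ x ∂(volume : Measure (Rd d)), ‖h x‖ ≤ M ∧ (R < ‖x‖ → h x = 0)

/-- Bounded convergence `h_n → h` of functions in `Σ`: a uniform bound, supports in a common ball,
and convergence almost everywhere. Every `h ∈ L^∞_c` is such a limit. -/
def BddConv {d : ℕ} (hn : ℕ → cubeSpan d) (h : Rd d → ℂ) : Prop :=
  (∃ M R : ℝ, ∀ (n : ℕ) (x : Rd d),
    ‖(hn n : Rd d → ℂ) x‖ ≤ M ∧ (R < ‖x‖ → (hn n : Rd d → ℂ) x = 0)) ∧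
  ∀ᵐ x ∂(volume : Measure (Rd d)), Tendsto (fun n => (hn n : Rd d → ℂ) x) atTop (𝓝 (h x))

/-- `u = T(h,k)` for `h, k ∈ L^∞_c`, where `T`, given on `Σ × Σ`, is extended by continuity:
`T(h_n,k_n) → u` in `L^1_loc` for all `h_n, k_n ∈ Σ` converging boundedly to `h` and `k`. -/
def IsExtValue {d : ℕ} (T : BilinOp d) (h k u : Rd d → ℂ) : Prop :=
  MemBddCpt h ∧ MemBddCpt k ∧ LocallyIntegrable u volume ∧
  ∀ hn kn : ℕ → cubeSpan d, BddConv hn h → BddConv kn k → ∀ R : ℝ,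
    Tendsto (fun n => ∫⁻ x in Metric.ball (0 : Rd d) R, ‖(T (hn n) (kn n) : Rd d → ℂ) x - u x‖ₑ)
      atTop (𝓝 0)

/-- The commutator `[b,T]_1(f,g) = b T(f,g) - T(bf,g)` is well defined for `f, g ∈ L^∞_c` and
extends to a bilinear operator `L^p × L^q → L^r` of norm at most `A`. -/
def CommutatorBoundedBy {d : ℕ} (b : Rd d → ℂ) (T : BilinOp d) (p q r : ℝ) (A : ℝ≥0) : Prop :=
  ∃ S : Lp ℂ (ENNReal.ofReal p) (volume : Measure (Rd d)) →ₗ[ℂ]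
      Lp ℂ (ENNReal.ofReal q) (volume : Measure (Rd d)) →ₗ[ℂ]
        Lp ℂ (ENNReal.ofReal r) (volume : Measure (Rd d)),
    (∀ f g, ‖S f g‖ ≤ A * ‖f‖ * ‖g‖) ∧
    ∀ (f g : Rd d → ℂ) (hf : MemLp f (ENNReal.ofReal p) volume)
      (hg : MemLp g (ENNReal.ofReal q) volume), MemBddCpt f → MemBddCpt g →
      ∃ u v : Rd d → ℂ, IsExtValue T f g u ∧ IsExtValue T (fun x => b x * f x) g v ∧
        ∀ᵐ x ∂(volume : Measure (Rd d)),
          (S (hf.toLp f) (hg.toLp g) : Rd d → ℂ) x = b x * u x - v x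

/-- The norm `‖[b,T]_1‖_{L^p × L^q → L^r}`, equal to `∞` if there is no bounded commutator. -/
def commutatorNorm {d : ℕ} (b : Rd d → ℂ) (T : BilinOp d) (p q r : ℝ) : ℝ≥0∞ :=
  ⨅ (A : ℝ≥0) (_ : CommutatorBoundedBy b T p q r A), (A : ℝ≥0∞)

/-- The quantity `sup_Q ℓ(Q)^{-α} ⨍_Q |b - ⟨b⟩_Q|`, the supremum being over all cubes. -/
def oscNorm {d : ℕ} (b : Rd d → ℂ) (α : ℝ) : ℝ≥0∞ :=
  ⨆ (a : Rd d) (l : ℝ) (_ : 0 < l),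
    ENNReal.ofReal (l ^ (-α)) *
      ((∫⁻ x in cube a l, ‖b x - ⨍ y in cube a l, b y‖ₑ) / volume (cube a l))

end BilinearSIO

end

open BilinearSIO

/-! A finite right-hand side makes `b` Hölder continuous of order `α` off a null set (Campanato):
averages of `b` over successively halved cubes around a Lebesgue point differ by the terms of a
geometric series of ratio `2^(-α)` (`norm_sub_average_le`, `exists_holder_of_oscNorm_le`). The
factor `b(x) - b(y)` then tames the singularity of the kernel, so that no cancellation is left to
exploit: for almost every `x` the commutator is the absolutely convergent integral `∬ (b(x) - b(y))
K(x,y,z) f(y) g(z) dy dz`.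

The bound. If `α = a₁ + a₂` with `0 < a₂ < d`, the size condition and `|x-y|^α (|x-y|+|x-z|)^(-2d) ≤
|x-y|^(a₁-d) |x-z|^(a₂-d)` dominate this integral by the product of the fractional integrals of
`|f|` and `|g|` of orders `a₁` and `a₂`. Splitting `α` in proportion to `1/p` and `1/q` puts both
factors in the range of the Hardy–Littlewood–Sobolev inequality, and Hölder's inequality, valid also
for `r < 1`, finishes (`exists_fracInt_mul_fracInt_le`). Sobolev's inequality is derived from the
maximal theorem by Hedberg's argument. This part uses only the size of `K`.

The identification. The kernel determines `T(f,g)` only off the common support of `f` and `g`; on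
it, `T` may differ from a limit of truncations by a multiplication operator. Almost everywhere `f`
and `g` are constant near `x`. Subtracting these constants times the indicator of a small dyadic
cube gives `T(f,g) - f g T(u,u) = T_ε(f,g) - f g T_ε(u,u)` at `x` for small `ε`, whenever `u(x) = 1`
(`HasKernel.ae_sub_eq_truncation_sub`). The unknown multiplier cancels in `b T(f,g) - T(bf,g)`,
leaving the limit of `b T_ε(f,g) - T_ε(bf,g)`, which is the integral above
(`HasKernel.commutator_ae_eq`).

The extension. As `bf` is not in `Σ`, `T` must first be extended to bounded functions of bounded
support. This rests on `T(f_n,g_n) → 0` in `L^1_loc` when both factors are uniformly bounded with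
supports in a common ball and one of them tends to zero almost everywhere
(`HasKernel.tendsto_lintegral_zero`). By the identity above and the uniform bound for the
truncations, it remains to see that `f_n g_n T_ε(u,u) → 0` in `L^1_loc` uniformly in `ε`. When
`σ(p₀,q₀) = 1` a bound in `L^1` does not suffice; uniform integrability of `T_ε(u,u)` is needed. It
holds because the truncations map bounded functions to dyadic `BMO` uniformly in `ε`, by the Dini
regularity, and because the John–Nirenberg inequality (`lintegral_dyad_tsub_le`) upgrades this to a
uniform tail estimate (`TruncationsBoundedBy.exists_tsub_le`). -/

namespace BilinearSIO

variable {d : ℕ}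

/-! ### Cubes -/

lemma cube_eq_preimage (a : Rd d) (l : ℝ) :
    cube a l = WithLp.ofLp ⁻¹' (Set.univ.pi fun i => Set.Ico (a i) (a i + l)) := by
  ext x; simp [cube]

lemma measurableSet_cube (a : Rd d) (l : ℝ) : MeasurableSet (cube a l) := by
  rw [cube_eq_preimage]
  exact (PiLp.volume_preserving_ofLp (Fin d)).measurable
    (MeasurableSet.univ_pi fun i => measurableSet_Ico)

lemma volume_cube (a : Rd d) (l : ℝ) : volume (cube a l) = ENNReal.ofReal l ^ d := by
  rw [cube_eq_preimage, (PiLp.volume_preserving_ofLp (Fin d)).measure_preimage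
    (MeasurableSet.univ_pi fun i => measurableSet_Ico).nullMeasurableSet, Real.volume_pi_Ico]
  simp

lemma volume_cube_pos (a : Rd d) {l : ℝ} (hl : 0 < l) : 0 < volume (cube a l) := by
  rw [volume_cube]; exact ENNReal.pow_pos (by simpa using hl) _

lemma volume_cube_ne_zero (a : Rd d) {l : ℝ} (hl : 0 < l) : volume (cube a l) ≠ 0 :=
  (volume_cube_pos a hl).ne'

lemma volume_cube_lt_top (a : Rd d) (l : ℝ) : volume (cube a l) < ⊤ := by
  rw [volume_cube]; exact ENNReal.pow_lt_top ENNReal.ofReal_lt_top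

lemma volume_cube_ne_top (a : Rd d) (l : ℝ) : volume (cube a l) ≠ ⊤ := (volume_cube_lt_top a l).ne

lemma norm_le_card_mul {x : Rd d} {l : ℝ} (h : ∀ i, |x i| ≤ l) : ‖x‖ ≤ d * l := by
  have h1 : ‖x‖ ≤ ∑ i, |x i| := by
    rw [EuclideanSpace.norm_eq]
    refine Real.sqrt_le_iff.2 ⟨Finset.sum_nonneg fun i _ => abs_nonneg _, ?_⟩
    simpa using Finset.sum_sq_le_sq_sum_of_nonneg (s := Finset.univ) (f := fun i => |x i|)
      (fun i _ => abs_nonneg _)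
  refine h1.trans ?_
  simpa using Finset.sum_le_card_nsmul Finset.univ (fun i => |x i|) l (fun i _ => h i)

lemma norm_sub_le_of_mem_cube {a : Rd d} {l : ℝ} {x y : Rd d} (hx : x ∈ cube a l)
    (hy : y ∈ cube a l) : ‖x - y‖ ≤ d * l := by
  refine norm_le_card_mul fun i => ?_
  have h1 := hx i
  have h2 := hy i
  rw [PiLp.sub_apply, abs_le]
  constructor <;> linarith

lemma abs_coord_le_norm (x : Rd d) (i : Fin d) : |x i| ≤ ‖x‖ := by
  simpa using PiLp.norm_apply_le x i

lemma isBounded_cube (a : Rd d) (l : ℝ) : Bornology.IsBounded (cube a l) :=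
  Metric.isBounded_iff.2 ⟨d * l, fun _ hx _ hy => by
    rw [dist_eq_norm]; exact norm_sub_le_of_mem_cube hx hy⟩

lemma convex_cube (a : Rd d) (l : ℝ) : Convex ℝ (cube a l) := by
  intro x hx y hy s t hs ht hst i
  have := (convex_Ico (a i) (a i + l)) (x := x i) (y := y i) ⟨(hx i).1, (hx i).2⟩
    ⟨(hy i).1, (hy i).2⟩ hs ht hst
  simpa using this

lemma volume_frontier_cube (a : Rd d) (l : ℝ) : volume (frontier (cube a l)) = 0 :=
  (convex_cube a l).addHaar_frontier _

lemma cube_mem_nhds {a : Rd d} {l : ℝ} {x : Rd d} (hx : x ∈ cube a l)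
    (h : x ∉ frontier (cube a l)) : cube a l ∈ 𝓝 x := by
  rw [← mem_interior_iff_mem_nhds]
  by_contra hn
  exact h ⟨subset_closure hx, hn⟩

/-- The cube `[-l, l)^d`. -/
noncomputable def centeredCube (d : ℕ) (l : ℝ) : Set (Rd d) := cube (WithLp.toLp 2 fun _ => -l) (2 * l)

lemma mem_centeredCube {l : ℝ} {x : Rd d} (hx : ‖x‖ < l) : x ∈ centeredCube d l := by
  intro i
  have := abs_lt.1 ((abs_coord_le_norm x i).trans_lt hx)
  simp only
  constructor <;> linarith

/-! ### The dyadic grid -/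

/-- The dyadic cube of side length `2⁻ⁿ` with index `k`. -/
noncomputable def dyad (n : ℕ) (k : Fin d → ℤ) : Set (Rd d) :=
  cube (WithLp.toLp 2 fun i => (k i : ℝ) * (1 / 2) ^ n) ((1 / 2) ^ n)

/-- The index of the dyadic cube of side length `2⁻ⁿ` containing `x`. -/
noncomputable def dyadIdx (n : ℕ) (x : Rd d) : Fin d → ℤ := fun i => ⌊x i * 2 ^ n⌋

/-- With membership expressed as an equality of floors, disjointness and nesting of dyadic cubes
become identities between indices. -/
lemma mem_dyad_iff {n : ℕ} {k : Fin d → ℤ} {x : Rd d} : x ∈ dyad n k ↔ dyadIdx n x = k := by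
  have key : ∀ (t : ℝ) (m : ℤ), (m * (1 / 2 : ℝ) ^ n ≤ t ∧ t < m * (1 / 2) ^ n + (1 / 2) ^ n) ↔
      ⌊t * 2 ^ n⌋ = m := by
    intro t m
    have h2 : (0 : ℝ) < 2 ^ n := by positivity
    rw [Int.floor_eq_iff, one_div, inv_pow, ← div_eq_mul_inv, div_le_iff₀ h2,
      ← one_div, ← add_div, lt_div_iff₀ h2]
  constructor
  · intro h; funext i; exact (key _ _).1 (h i)
  · intro h i; exact (key _ _).2 (congrFun h i)

lemma mem_dyad_dyadIdx (n : ℕ) (x : Rd d) : x ∈ dyad n (dyadIdx n x) := mem_dyad_iff.2 rfl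

lemma dyadIdx_mono {m n : ℕ} (h : m ≤ n) {x y : Rd d} (hxy : dyadIdx n x = dyadIdx n y) :
    dyadIdx m x = dyadIdx m y := by
  obtain ⟨j, rfl⟩ := Nat.exists_eq_add_of_le h
  have key : ∀ t : ℝ, ⌊t * 2 ^ m⌋ = ⌊t * 2 ^ (m + j)⌋ / ((2 ^ j : ℕ) : ℤ) := by
    intro t
    rw [← Int.floor_div_natCast]
    congr 1
    push_cast
    rw [pow_add]
    field_simp
  funext i
  have := congrFun hxy i
  simp only [dyadIdx] at this ⊢
  rw [key, key, this]

lemma dyad_subset_dyad {m n : ℕ} (h : m ≤ n) (x : Rd d) :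
    dyad n (dyadIdx n x) ⊆ dyad m (dyadIdx m x) := fun _ hy =>
  mem_dyad_iff.2 (dyadIdx_mono h (mem_dyad_iff.1 hy))

lemma measurableSet_dyad (n : ℕ) (k : Fin d → ℤ) : MeasurableSet (dyad n k) :=
  measurableSet_cube _ _

lemma volume_dyad (n : ℕ) (k : Fin d → ℤ) :
    volume (dyad n k : Set (Rd d)) = ENNReal.ofReal ((1 / 2) ^ n) ^ d := volume_cube _ _

lemma volume_dyad_ne_zero (n : ℕ) (k : Fin d → ℤ) : volume (dyad n k : Set (Rd d)) ≠ 0 :=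
  volume_cube_ne_zero _ (by positivity)

lemma volume_dyad_ne_top (n : ℕ) (k : Fin d → ℤ) : volume (dyad n k : Set (Rd d)) ≠ ⊤ :=
  volume_cube_ne_top _ _

lemma norm_sub_le_of_mem_dyad {n : ℕ} {k : Fin d → ℤ} {x y : Rd d} (hx : x ∈ dyad n k)
    (hy : y ∈ dyad n k) : ‖x - y‖ ≤ d * (1 / 2) ^ n := norm_sub_le_of_mem_cube hx hy

/-- Almost every point lies in the interior of its dyadic cubes. -/
lemma ae_dyad_mem_nhds : ∀ᵐ x ∂(volume : Measure (Rd d)), ∀ n : ℕ,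
    dyad n (dyadIdx n x) ∈ 𝓝 x := by
  have h : ∀ᵐ x ∂(volume : Measure (Rd d)), ∀ n : ℕ, ∀ k : Fin d → ℤ, x ∉ frontier (dyad n k) :=
    ae_all_iff.2 fun n => ae_all_iff.2 fun k =>
      measure_eq_zero_iff_ae_notMem.1 (volume_frontier_cube _ _)
  filter_upwards [h] with x hx n
  exact cube_mem_nhds (mem_dyad_dyadIdx n x) (hx n _)

lemma eventually_dyad_subset {x : Rd d} {s : Set (Rd d)} (hs : s ∈ 𝓝 x) :
    ∀ᶠ n : ℕ in atTop, dyad n (dyadIdx n x) ⊆ s := by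
  obtain ⟨ε, hε, hsub⟩ := Metric.mem_nhds_iff.1 hs
  have h : Tendsto (fun n : ℕ => (d : ℝ) * (1 / 2) ^ n) atTop (𝓝 (d * 0)) :=
    (tendsto_pow_atTop_nhds_zero_of_lt_one (by norm_num) (by norm_num)).const_mul _
  rw [mul_zero] at h
  filter_upwards [h.eventually (gt_mem_nhds hε)] with n hn y hy
  refine hsub ?_
  rw [Metric.mem_ball, dist_eq_norm]
  exact (norm_sub_le_of_mem_dyad hy (mem_dyad_dyadIdx n x)).trans_lt hn

/-! ### Lebesgue differentiation along cubes -/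

/-- Up to a null set a half-open cube is a closed ball of the sup norm, so the differentiation
theorem for doubling measures applies on `Fin d → ℝ`. The cubes need only contain `x`, and the
exceptional null set does not depend on them; both matter for the nested cubes of Campanato's
argument. -/
theorem ae_tendsto_average_cube {F : Rd d → ℂ} (hF : LocallyIntegrable F volume) :
    ∀ᵐ x ∂(volume : Measure (Rd d)), ∀ (a : ℕ → Rd d) (l : ℕ → ℝ), (∀ n, 0 < l n) →
      Tendsto l atTop (𝓝 0) → (∀ n, x ∈ cube (a n) (l n)) →
      Tendsto (fun n => ⨍ y in cube (a n) (l n), F y) atTop (𝓝 (F x)) := by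
  have hmp := PiLp.volume_preserving_toLp (Fin d)
  have hmp' := PiLp.volume_preserving_ofLp (Fin d)
  have hemb : MeasurableEmbedding (WithLp.toLp 2 : (Fin d → ℝ) → Rd d) :=
    (MeasurableEquiv.toLp 2 (Fin d → ℝ)).measurableEmbedding
  have hG : LocallyIntegrable (fun z : Fin d → ℝ => F (WithLp.toLp 2 z)) volume := by
    rw [locallyIntegrable_iff]
    intro k hk
    have hk' : IsCompact (WithLp.toLp 2 '' k : Set (Rd d)) :=
      hk.image (PiLp.continuous_toLp 2 _)
    have h1 := hF.integrableOn_isCompact hk'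
    have h2 := (hmp.integrableOn_comp_preimage hemb (s := WithLp.toLp 2 '' k)).2 h1
    rwa [Set.preimage_image_eq _ (WithLp.toLp_injective 2)] at h2
  have h1 := IsUnifLocDoublingMeasure.ae_tendsto_average (volume : Measure (Fin d → ℝ)) hG 1
  have h2 := hmp'.quasiMeasurePreserving.ae h1
  filter_upwards [h2] with x hx a l hl hl0 hxm
  have h3 := hx (l := atTop) (fun n : ℕ => (fun i => a n i + l n / 2 : Fin d → ℝ))
    (fun n => l n / 2) (tendsto_nhdsWithin_iff.2 ⟨by simpa using hl0.div_const 2,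
      Eventually.of_forall fun n => by simpa using hl n⟩)
    (Eventually.of_forall fun n => by
      have := hl n
      rw [one_mul, Metric.mem_closedBall, dist_pi_le_iff (by linarith)]
      intro i
      have := hxm n i
      rw [Real.dist_eq, abs_le]
      constructor <;> linarith)
  refine h3.congr fun n => ?_
  have hae : (Metric.closedBall (fun i => a n i + l n / 2 : Fin d → ℝ) (l n / 2)) =ᵐ[volume]
      (WithLp.toLp 2 ⁻¹' cube (a n) (l n) : Set (Fin d → ℝ)) := by
    have hl2 : (0 : ℝ) ≤ l n / 2 := by have := hl n; linarith
    rw [closedBall_pi _ hl2]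
    have e1 : (WithLp.toLp 2 ⁻¹' cube (a n) (l n) : Set (Fin d → ℝ)) =
        Set.univ.pi fun i => Set.Ico (a n i) (a n i + l n) := by
      ext z; simp [cube]
    have e2 : (Set.univ.pi fun i => Metric.closedBall (a n i + l n / 2) (l n / 2)) =
        Set.Icc (fun i => a n i) (fun i => a n i + l n) := by
      rw [← Set.pi_univ_Icc]
      congr 1; funext i
      rw [Real.closedBall_eq_Icc]
      congr 1 <;> ring
    rw [e1, e2]
    exact Measure.univ_pi_Ico_ae_eq_Icc.symm
  rw [setAverage_congr hae, setAverage_eq, setAverage_eq,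
    hmp.setIntegral_preimage_emb hemb (fun y => F y) (cube (a n) (l n)), measureReal_def,
    measureReal_def, hmp.measure_preimage_emb hemb]

lemma ae_tendsto_average_dyad {F : Rd d → ℂ} (hF : LocallyIntegrable F volume) :
    ∀ᵐ x ∂(volume : Measure (Rd d)),
      Tendsto (fun n => ⨍ y in dyad n (dyadIdx n x), F y) atTop (𝓝 (F x)) := by
  filter_upwards [ae_tendsto_average_cube hF] with x hx
  exact hx _ _ (fun n => by positivity)
    (tendsto_pow_atTop_nhds_zero_of_lt_one (by norm_num) (by norm_num))
    (fun n => mem_dyad_dyadIdx n x)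

/-! ### The class `Σ` -/

/-- The indicator of a cube, as an element of `Σ`. -/
noncomputable def cubeInd (a : Rd d) (l : ℝ) (hl : 0 < l) : cubeSpan d :=
  ⟨(cube a l).indicator fun _ => 1, Submodule.subset_span ⟨a, l, hl, rfl⟩⟩

/-- The indicator of a dyadic cube, as an element of `Σ`. -/
noncomputable def dyadInd (n : ℕ) (k : Fin d → ℤ) : cubeSpan d :=
  cubeInd (WithLp.toLp 2 fun i => (k i : ℝ) * (1 / 2) ^ n) ((1 / 2) ^ n) (by positivity)

lemma coe_cubeInd (a : Rd d) (l : ℝ) (hl : 0 < l) :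
    (cubeInd a l hl : Rd d → ℂ) = (cube a l).indicator fun _ => 1 := rfl

lemma coe_dyadInd (n : ℕ) (k : Fin d → ℤ) :
    (dyadInd n k : Rd d → ℂ) = (dyad n k).indicator fun _ => 1 := rfl

lemma cubeSpan_induction {P : (Rd d → ℂ) → Prop}
    (hcube : ∀ (a : Rd d) (l : ℝ), 0 < l → P ((cube a l).indicator fun _ => 1))
    (hadd : ∀ f g, P f → P g → P (f + g)) (hsmul : ∀ (c : ℂ) f, P f → P (c • f)) (h0 : P 0)
    (f : cubeSpan d) : P f := by
  obtain ⟨f, hf⟩ := f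
  induction hf using Submodule.span_induction with
  | mem f hf => obtain ⟨a, l, hl, rfl⟩ := hf; exact hcube a l hl
  | zero => exact h0
  | add f g _ _ h1 h2 => exact hadd f g h1 h2
  | smul c f _ h => exact hsmul c f h

lemma measurable_cubeSpan (f : cubeSpan d) : Measurable (f : Rd d → ℂ) :=
  cubeSpan_induction (P := fun f => Measurable f)
    (fun a l _ => measurable_const.indicator (measurableSet_cube a l))
    (fun _ _ hf hg => hf.add hg) (fun c _ hf => hf.const_smul c) measurable_const f

lemma exists_bound_cubeSpan (f : cubeSpan d) :
    ∃ M R : ℝ, ∀ x, ‖(f : Rd d → ℂ) x‖ ≤ M ∧ (R < ‖x‖ → (f : Rd d → ℂ) x = 0) := by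
  refine cubeSpan_induction
    (P := fun f => ∃ M R : ℝ, ∀ x, ‖f x‖ ≤ M ∧ (R < ‖x‖ → f x = 0)) ?_ ?_ ?_ ?_ f
  · intro a l _
    obtain ⟨R, hR⟩ := (isBounded_cube a l).exists_norm_le
    refine ⟨1, R, fun x => ⟨?_, fun hx => ?_⟩⟩
    · by_cases h : x ∈ cube a l <;> simp [h]
    · exact Set.indicator_of_notMem (fun h => absurd (hR x h) (not_le.2 hx)) _
  · rintro f g ⟨M, R, h⟩ ⟨M', R', h'⟩
    refine ⟨M + M', max R R', fun x => ⟨(norm_add_le _ _).trans (add_le_add (h x).1 (h' x).1),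
      fun hx => ?_⟩⟩
    simp [(h x).2 ((le_max_left _ _).trans_lt hx), (h' x).2 ((le_max_right _ _).trans_lt hx)]
  · rintro c f ⟨M, R, h⟩
    refine ⟨‖c‖ * M, R, fun x => ⟨?_, fun hx => ?_⟩⟩
    · rw [Pi.smul_apply, norm_smul]; exact mul_le_mul_of_nonneg_left (h x).1 (norm_nonneg _)
    · simp [(h x).2 hx]
  · exact ⟨0, 0, fun x => by simp⟩

/-- Boundaries of cubes are null, and off those of finitely many cubes a step function is locally
constant. This is what allows an element of `Σ` to be replaced near `x` by a multiple of the
indicator of a dyadic cube. -/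
lemma ae_eventually_eq_cubeSpan (f : cubeSpan d) :
    ∀ᵐ x ∂(volume : Measure (Rd d)), ∀ᶠ y in 𝓝 x, (f : Rd d → ℂ) y = (f : Rd d → ℂ) x := by
  refine cubeSpan_induction
    (P := fun f => ∀ᵐ x ∂(volume : Measure (Rd d)), ∀ᶠ y in 𝓝 x, f y = f x) ?_ ?_ ?_ ?_ f
  · intro a l _
    filter_upwards [measure_eq_zero_iff_ae_notMem.1 (volume_frontier_cube a l)] with x hx
    by_cases h : x ∈ cube a l
    · filter_upwards [cube_mem_nhds h hx] with y hy
      simp [h, hy]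
    · have hc : (cube a l)ᶜ ∈ 𝓝 x := by
        rw [← mem_interior_iff_mem_nhds, interior_compl]
        intro hcl
        exact hx ⟨hcl, fun hi => h (interior_subset hi)⟩
      filter_upwards [hc] with y hy
      rw [Set.indicator_of_notMem hy, Set.indicator_of_notMem h]
  · intro f g hf hg
    filter_upwards [hf, hg] with x h1 h2
    filter_upwards [h1, h2] with y h3 h4
    simp [h3, h4]
  · intro c f hf
    filter_upwards [hf] with x h1
    filter_upwards [h1] with y h3
    simp [h3]
  · exact Eventually.of_forall fun x => Eventually.of_forall fun y => rfl

lemma memBddCpt_cubeSpan (f : cubeSpan d) : MemBddCpt (f : Rd d → ℂ) := by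
  obtain ⟨M, R, h⟩ := exists_bound_cubeSpan f
  exact ⟨(measurable_cubeSpan f).aestronglyMeasurable, M, R, Eventually.of_forall h⟩

/-! ### Bounded functions of bounded support -/

/-- A version of `MemBddCpt` with a positive common constant. -/
lemma MemBddCpt.exists_bound {h : Rd d → ℂ} (hh : MemBddCpt h) :
    ∃ M : ℝ, 0 < M ∧ ∀ᵐ x ∂(volume : Measure (Rd d)), ‖h x‖ ≤ M ∧ (M < ‖x‖ → h x = 0) := by
  obtain ⟨-, M, R, h⟩ := hh
  refine ⟨max 1 (max M R), lt_of_lt_of_le one_pos (le_max_left _ _), ?_⟩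
  filter_upwards [h] with x hx
  exact ⟨hx.1.trans ((le_max_left _ _).trans (le_max_right _ _)), fun h' => hx.2
    (((le_max_right _ _).trans (le_max_right _ _)).trans_lt h')⟩

lemma enorm_le_indicator {M : ℝ} {h : Rd d → ℂ} {x : Rd d}
    (hx : ‖h x‖ ≤ M ∧ (M < ‖x‖ → h x = 0)) :
    ‖h x‖ₑ ≤ (Metric.closedBall (0 : Rd d) M).indicator (fun _ => ENNReal.ofReal M) x := by
  by_cases hb : x ∈ Metric.closedBall (0 : Rd d) M
  · rw [Set.indicator_of_mem hb, ← ofReal_norm]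
    exact ENNReal.ofReal_le_ofReal hx.1
  · rw [hx.2 (by simpa using hb)]; simp

lemma MemBddCpt.memLp {h : Rd d → ℂ} (hh : MemBddCpt h) (p : ℝ≥0∞) : MemLp h p volume := by
  obtain ⟨M, hM, hb⟩ := hh.exists_bound
  have h1 : MemLp ((Metric.closedBall (0 : Rd d) M).indicator fun _ => (M : ℝ)) p
      (volume : Measure (Rd d)) :=
    memLp_indicator_const p measurableSet_closedBall _ (Or.inr measure_closedBall_lt_top.ne)
  refine h1.of_le hh.1 ?_
  filter_upwards [hb] with x hx
  by_cases hb : x ∈ Metric.closedBall (0 : Rd d) M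
  · rw [Set.indicator_of_mem hb, Real.norm_of_nonneg hM.le]; exact hx.1
  · rw [hx.2 (by simpa using hb)]; simp

lemma MemBddCpt.integrable {h : Rd d → ℂ} (hh : MemBddCpt h) : Integrable h volume :=
  memLp_one_iff_integrable.1 (hh.memLp 1)

lemma MemBddCpt.sub {f g : Rd d → ℂ} (hf : MemBddCpt f) (hg : MemBddCpt g) :
    MemBddCpt (fun x => f x - g x) := by
  obtain ⟨M, R, h⟩ := hf.2
  obtain ⟨M', R', h'⟩ := hg.2
  refine ⟨hf.1.sub hg.1, M + M', max R R', ?_⟩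
  filter_upwards [h, h'] with x h h'
  refine ⟨(norm_sub_le _ _).trans (add_le_add h.1 h'.1), fun hx => ?_⟩
  rw [h.2 ((le_max_left _ _).trans_lt hx), h'.2 ((le_max_right _ _).trans_lt hx), sub_zero]

lemma MemBddCpt.indicator {f : Rd d → ℂ} (hf : MemBddCpt f) {s : Set (Rd d)}
    (hs : MeasurableSet s) : MemBddCpt (s.indicator f) := by
  obtain ⟨M, R, h⟩ := hf.2
  refine ⟨hf.1.indicator hs, M, R, ?_⟩
  filter_upwards [h] with x hx
  refine ⟨(norm_indicator_le_norm_self _ _).trans hx.1, fun h' => ?_⟩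
  rw [Set.indicator_apply_eq_zero]
  exact fun _ => hx.2 h'

/-- A common positive constant for the bounds and the supports of a boundedly convergent
sequence. -/
lemma BddConv.exists_bound {hn : ℕ → cubeSpan d} {h : Rd d → ℂ} (H : BddConv hn h) :
    ∃ M : ℝ, 0 < M ∧ ∀ n x, ‖(hn n : Rd d → ℂ) x‖ ≤ M ∧ (M < ‖x‖ → (hn n : Rd d → ℂ) x = 0) := by
  obtain ⟨⟨M, R, h⟩, -⟩ := H
  refine ⟨max 1 (max M R), lt_of_lt_of_le one_pos (le_max_left _ _), fun n x => ?_⟩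
  exact ⟨(h n x).1.trans ((le_max_left _ _).trans (le_max_right _ _)), fun h' => (h n x).2
    (((le_max_right _ _).trans (le_max_right _ _)).trans_lt h')⟩

/-- The approximants are the dyadic averages of `h`: they inherit its bound and converge almost
everywhere by Lebesgue differentiation. Bounded support makes all but finitely many of the averages
vanish at each scale. -/
theorem exists_bddConv {h : Rd d → ℂ} (hh : MemBddCpt h) : ∃ hn, BddConv hn h := by
  obtain ⟨M, hM, hb⟩ := hh.exists_bound
  have hbox : ∀ n : ℕ, ∃ N : ℤ, ∀ x : Rd d, ‖x‖ ≤ M → ∀ i, dyadIdx n x i ∈ Finset.Icc (-N) N := by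
    intro n
    obtain ⟨N, hN⟩ := exists_int_gt (M * 2 ^ n + 1)
    refine ⟨N, fun x hx i => ?_⟩
    have h2 : (0 : ℝ) < 2 ^ n := by positivity
    have h1 := abs_le.1 ((abs_coord_le_norm x i).trans hx)
    have h3 : -(M * 2 ^ n) ≤ x i * 2 ^ n := by nlinarith
    have h4 : x i * 2 ^ n ≤ M * 2 ^ n := by nlinarith
    rw [Finset.mem_Icc, dyadIdx]
    constructor
    · rw [Int.le_floor]; push_cast; linarith
    · have : (⌊x i * 2 ^ n⌋ : ℝ) ≤ N := (Int.floor_le _).trans (by linarith)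
      exact_mod_cast this
  choose N hN using hbox
  let hn : ℕ → cubeSpan d := fun n =>
    ∑ k ∈ Fintype.piFinset (fun _ : Fin d => Finset.Icc (-N n) (N n)),
      (⨍ y in dyad n k, h y) • dyadInd n k
  have hzero : ∀ (n : ℕ) (k : Fin d → ℤ), (∀ x ∈ dyad n k, M < ‖x‖) →
      (⨍ y in dyad n k, h y) = 0 := by
    intro n k hk
    rw [setAverage_eq, setIntegral_eq_zero_of_ae_eq_zero, smul_zero]
    filter_upwards [hb] with x hx hxk
    exact hx.2 (hk x hxk)
  have hval : ∀ n x, (hn n : Rd d → ℂ) x = ⨍ y in dyad n (dyadIdx n x), h y := by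
    intro n x
    have e : (hn n : Rd d → ℂ) x = ∑ k ∈ Fintype.piFinset (fun _ : Fin d => Finset.Icc (-N n) (N n)),
        if k = dyadIdx n x then (⨍ y in dyad n k, h y) else 0 := by
      simp only [hn, AddSubmonoidClass.coe_finsetSum, SetLike.val_smul, Finset.sum_apply,
        Pi.smul_apply, coe_dyadInd]
      refine Finset.sum_congr rfl fun k _ => ?_
      by_cases hk : k = dyadIdx n x
      · rw [if_pos hk, Set.indicator_of_mem (mem_dyad_iff.2 hk.symm), smul_eq_mul, mul_one]
      · rw [if_neg hk, Set.indicator_of_notMem (fun h' => hk (mem_dyad_iff.1 h').symm), smul_zero]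
    rw [e, Finset.sum_ite_eq']
    split_ifs with hmem
    · rfl
    · refine (hzero n _ fun y hy => ?_).symm
      by_contra! hyM
      refine hmem (Fintype.mem_piFinset.2 fun i => ?_)
      rw [← mem_dyad_iff.1 hy]
      exact hN n y hyM i
  -- Dyadic cubes of side at most `1` have diameter at most `d`, which is how far averaging can
  -- enlarge the support.
  refine ⟨hn, ⟨M, M + d, fun n x => ⟨?_, fun hx => ?_⟩⟩, ?_⟩
  · rw [hval, setAverage_eq, norm_smul, norm_inv, Real.norm_of_nonneg measureReal_nonneg]
    have hpos : 0 < volume.real (dyad n (dyadIdx n x)) :=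
      ENNReal.toReal_pos (volume_dyad_ne_zero _ _) (volume_dyad_ne_top _ _)
    rw [inv_mul_le_iff₀ hpos, mul_comm]
    exact norm_setIntegral_le_of_norm_le_const_ae' (volume_dyad_ne_top _ _).lt_top
      (by filter_upwards [hb] with y hy _ using hy.1)
  · rw [hval]
    refine hzero n _ fun y hy => ?_
    have h1 := norm_sub_le_of_mem_dyad (mem_dyad_dyadIdx n x) hy
    have h2 : (d : ℝ) * (1 / 2) ^ n ≤ d * 1 :=
      mul_le_mul_of_nonneg_left (pow_le_one₀ (by norm_num) (by norm_num)) (by positivity)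
    have h3 := norm_le_norm_add_norm_sub' x y
    linarith
  · filter_upwards [ae_tendsto_average_dyad hh.integrable.locallyIntegrable] with x hx
    simpa only [hval] using hx

/-! ### Dini moduli -/

lemma IsDiniModulus.nonneg {ω : ℝ → ℝ} (h : IsDiniModulus ω) {t : ℝ} (ht : 0 ≤ t) : 0 ≤ ω t := by
  rw [← h.zero]; exact h.mono Set.self_mem_Ici ht ht

/-- On `(2^(-k-1), 2^(-k)]` monotonicity gives `ω(t)/t ≥ ω(2^(-k-1)) / 2^(-k)`. The interval has
length `2^(-k-1)`, whence the factor `2`. -/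
lemma IsDiniModulus.tsum_le {ω : ℝ → ℝ} (h : IsDiniModulus ω) :
    ∑' k : ℕ, ENNReal.ofReal (ω ((1 / 2) ^ (k + 1))) ≤ 2 * diniNorm ω := by
  let s : ℕ → Set ℝ := fun k => Set.Ioc ((1 / 2) ^ (k + 1)) ((1 / 2) ^ k)
  have hdisj : Pairwise (Function.onFun Disjoint s) := by
    have := (pow_right_strictAnti₀ (by norm_num : (0 : ℝ) < 1 / 2)
      (by norm_num)).antitone.pairwise_disjoint_on_Ioc_succ
    exact this
  have hsub : (⋃ k, s k) ⊆ Set.Ioc 0 1 := by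
    refine Set.iUnion_subset fun k t ht => ⟨lt_trans (by positivity) ht.1, ht.2.trans ?_⟩
    exact pow_le_one₀ (by norm_num) (by norm_num)
  have h1 : ∀ k, ENNReal.ofReal (ω ((1 / 2) ^ (k + 1))) ≤
      2 * ∫⁻ t in s k, ENNReal.ofReal (ω t / t) := by
    intro k
    have hpos : (0 : ℝ) < (1 / 2) ^ k := by positivity
    have h2 : ∫⁻ t in s k, ENNReal.ofReal (ω ((1 / 2) ^ (k + 1)) / (1 / 2) ^ k) ≤
        ∫⁻ t in s k, ENNReal.ofReal (ω t / t) := by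
      refine setLIntegral_mono' measurableSet_Ioc fun t ht => ENNReal.ofReal_le_ofReal ?_
      have ht0 : 0 < t := lt_trans (by positivity) ht.1
      have := h.mono (a := (1 / 2) ^ (k + 1)) (b := t) (Set.mem_Ici.2 (by positivity))
        (Set.mem_Ici.2 ht0.le) ht.1.le
      exact div_le_div₀ (h.nonneg ht0.le) this ht0 ht.2
    rw [setLIntegral_const, Real.volume_Ioc, ← ENNReal.ofReal_mul
      (div_nonneg (h.nonneg (by positivity)) hpos.le)] at h2
    have e : ω ((1 / 2) ^ (k + 1)) / (1 / 2) ^ k * ((1 / 2) ^ k - (1 / 2) ^ (k + 1)) =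
        ω ((1 / 2) ^ (k + 1)) / 2 := by
      rw [pow_succ]; field_simp; ring
    rw [e] at h2
    calc ENNReal.ofReal (ω ((1 / 2) ^ (k + 1)))
        = 2 * ENNReal.ofReal (ω ((1 / 2) ^ (k + 1)) / 2) := by
          rw [show (2 : ℝ≥0∞) = ENNReal.ofReal 2 by simp, ← ENNReal.ofReal_mul (by norm_num)]
          congr 1; ring
      _ ≤ _ := by gcongr
  calc ∑' k : ℕ, ENNReal.ofReal (ω ((1 / 2) ^ (k + 1)))
      ≤ ∑' k, 2 * ∫⁻ t in s k, ENNReal.ofReal (ω t / t) := ENNReal.tsum_le_tsum h1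
    _ = 2 * ∫⁻ t in ⋃ k, s k, ENNReal.ofReal (ω t / t) := by
        rw [ENNReal.tsum_mul_left, lintegral_iUnion (fun k => measurableSet_Ioc) hdisj]
    _ ≤ 2 * diniNorm ω := by
        gcongr
        exact lintegral_mono_set hsub

lemma IsDiniModulus.exists_le {ω : ℝ → ℝ} (h : IsDiniModulus ω) {η : ℝ} (hη : 0 < η) :
    ∃ δ > 0, ∀ t, 0 ≤ t → t ≤ δ → ω t ≤ η := by
  have hne : ∑' k : ℕ, ENNReal.ofReal (ω ((1 / 2) ^ (k + 1))) ≠ ⊤ :=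
    (h.tsum_le.trans_lt (ENNReal.mul_lt_top (by simp) h.dini)).ne
  have ht := ENNReal.tendsto_atTop_zero_of_tsum_ne_top hne
  obtain ⟨k, hk⟩ := (ht.eventually (gt_mem_nhds (by simpa using hη :
    (0 : ℝ≥0∞) < ENNReal.ofReal η))).exists
  refine ⟨(1 / 2) ^ (k + 1), by positivity, fun t ht0 ht1 => ?_⟩
  exact (h.mono ht0 (ht0.trans ht1 : (0 : ℝ) ≤ _) ht1).trans
    ((ENNReal.ofReal_lt_ofReal_iff hη).1 hk).le

/-! ### Continuity and measurability of the kernel -/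

/-- The complement of the diagonal `x = y = z`. -/
def offDiag (d : ℕ) : Set (Rd d × Rd d × Rd d) := {z | ¬ (z.1 = z.2.1 ∧ z.2.1 = z.2.2)}

lemma isOpen_offDiag : IsOpen (offDiag d) := by
  have h : IsClosed {z : Rd d × Rd d × Rd d | z.1 = z.2.1 ∧ z.2.1 = z.2.2} :=
    (isClosed_eq continuous_fst (continuous_fst.comp continuous_snd)).inter
      (isClosed_eq (continuous_fst.comp continuous_snd) (continuous_snd.comp continuous_snd))
  exact h.isOpen_compl

lemma max_norm_pos {x y z : Rd d} (h : ¬ (x = y ∧ y = z)) : 0 < max ‖x - y‖ ‖x - z‖ := by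
  by_contra! hle
  have h1 := norm_le_zero_iff.1 ((le_max_left _ _).trans hle)
  have h2 := norm_le_zero_iff.1 ((le_max_right _ _).trans hle)
  rw [sub_eq_zero] at h1 h2
  exact h ⟨h1, h1.symm.trans h2⟩

/-- The regularity estimate is uniform while `y` and `z` move near a point off the diagonal, because
`|x-y| + |x-z|` stays bounded below there and `ω` tends to `0` at `0`. This uniformity makes
separate continuity in the three variables into joint continuity. -/
lemma RegularFirst.tendsto {G : Rd d → Rd d → Rd d → ℂ} {ω : ℝ → ℝ} (hG : RegularFirst G ω)
    (hω : IsDiniModulus ω) {α : Type*} {l : Filter α} {x : Rd d} {x' y z : α → Rd d} {y₀ z₀ : Rd d}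
    (hx' : Tendsto x' l (𝓝 x)) (hy : Tendsto y l (𝓝 y₀)) (hz : Tendsto z l (𝓝 z₀))
    (h0 : ¬ (x = y₀ ∧ y₀ = z₀)) :
    Tendsto (fun i => G (x' i) (y i) (z i) - G x (y i) (z i)) l (𝓝 0) := by
  have hm := max_norm_pos h0
  set m := max ‖x - y₀‖ ‖x - z₀‖
  have hlim : Tendsto (fun i => max ‖x - y i‖ ‖x - z i‖) l (𝓝 m) :=
    ((tendsto_const_nhds.sub hy).norm).max ((tendsto_const_nhds.sub hz).norm)
  rw [Metric.tendsto_nhds]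
  intro η hη
  have hc : 0 < (m / 2) ^ (2 * d) := by positivity
  obtain ⟨δ, hδ, hωδ⟩ := hω.exists_le (η := η / 2 * (m / 2) ^ (2 * d)) (by positivity)
  have hdist : Tendsto (fun i => ‖x - x' i‖) l (𝓝 0) := by
    simpa using (tendsto_const_nhds.sub hx' : Tendsto (fun i => x - x' i) l (𝓝 (x - x))).norm
  filter_upwards [hlim.eventually (lt_mem_nhds (half_lt_self hm)),
    hdist.eventually (gt_mem_nhds (show 0 < m / 4 by linarith)),
    hdist.eventually (gt_mem_nhds (show 0 < δ * (m / 2) by positivity))] with i h1 h2 h3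
  have hoff : ¬ (x = y i ∧ y i = z i) := by
    rintro ⟨e1, e2⟩
    rw [← e2, ← e1] at h1
    simp at h1
    linarith
  have hs : m / 2 ≤ ‖x - y i‖ + ‖x - z i‖ := by
    refine h1.le.trans (max_le ?_ ?_)
    · linarith [norm_nonneg (x - z i)]
    · linarith [norm_nonneg (x - y i)]
  have hreg := hG x (x' i) (y i) (z i) hoff (by linarith)
  rw [dist_zero_right, norm_sub_rev]
  refine lt_of_le_of_lt (hreg.trans (div_le_div₀ (by positivity) (hωδ _ (by positivity) ?_) hc
    (pow_le_pow_left₀ (by positivity) hs _))) ?_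
  · rw [div_le_iff₀ (lt_of_lt_of_le (by positivity) hs)]
    exact h3.le.trans (mul_le_mul_of_nonneg_left hs hδ.le)
  · rw [mul_div_assoc, div_self hc.ne']; linarith

/-- The increment of `K` telescopes into changes of one variable at a time, controlled by the
regularity of `K`, `K^{1*}` and `K^{2*}` in turn. Continuity is needed for the measurability of `K`,
which is not assumed. -/
lemma IsCZKernel.continuousOn {K : Rd d → Rd d → Rd d → ℂ} {cK : ℝ≥0} {ω : ℝ → ℝ}
    (hK : IsCZKernel K cK ω) :
    ContinuousOn (fun z : Rd d × Rd d × Rd d => K z.1 z.2.1 z.2.2) (offDiag d) := by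
  rintro ⟨x, y, z⟩ h0
  refine ContinuousAt.continuousWithinAt ?_
  have h0' : ¬ (x = y ∧ y = z) := h0
  have t1 : Tendsto (fun v : Rd d × Rd d × Rd d => v.1) (𝓝 (x, y, z)) (𝓝 x) := continuousAt_fst
  have t2 : Tendsto (fun v : Rd d × Rd d × Rd d => v.2.1) (𝓝 (x, y, z)) (𝓝 y) :=
    (continuous_fst.comp continuous_snd).continuousAt
  have t3 : Tendsto (fun v : Rd d × Rd d × Rd d => v.2.2) (𝓝 (x, y, z)) (𝓝 z) :=
    (continuous_snd.comp continuous_snd).continuousAt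
  have a1 := hK.regular.tendsto hK.modulus t1 t2 t3 h0'
  have a2 := hK.regular_adjOne.tendsto hK.modulus t2
    (tendsto_const_nhds : Tendsto (fun _ => x) (𝓝 (x, y, z)) (𝓝 x)) t3
    (fun h => h0' ⟨h.1.symm, h.1.trans h.2⟩)
  have a3 := hK.regular_adjTwo.tendsto hK.modulus t3
    (tendsto_const_nhds : Tendsto (fun _ => y) (𝓝 (x, y, z)) (𝓝 y))
    (tendsto_const_nhds : Tendsto (fun _ => x) (𝓝 (x, y, z)) (𝓝 x))
    (fun h => h0' ⟨h.2.symm, h.1.symm⟩)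
  have a := ((a1.add a2).add a3).add (tendsto_const_nhds (x := K x y z))
  simp only [add_zero, zero_add] at a
  refine a.congr fun v => ?_
  simp only [adjOne, adjTwo]
  ring

/-- The kernel restricted to `max(|x-y|,|x-z|) > ε`. -/
noncomputable def truncKer (K : Rd d → Rd d → Rd d → ℂ) (ε : ℝ) (x : Rd d) (w : Rd d × Rd d) : ℂ :=
  {w : Rd d × Rd d | ε < max ‖x - w.1‖ ‖x - w.2‖}.indicator (fun w => K x w.1 w.2) w

lemma measurableSet_far (ε : ℝ) (x : Rd d) :
    MeasurableSet {w : Rd d × Rd d | ε < max ‖x - w.1‖ ‖x - w.2‖} :=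
  (isOpen_lt continuous_const (by fun_prop)).measurableSet

lemma truncation_eq (K : Rd d → Rd d → Rd d → ℂ) (ε : ℝ) (f g : Rd d → ℂ) (x : Rd d) :
    truncation K ε f g x = ∫ w, truncKer K ε x w * (f w.1 * g w.2) := by
  rw [truncation, ← integral_indicator (measurableSet_far ε x)]
  congr 1
  funext w
  by_cases h : w ∈ {w : Rd d × Rd d | ε < max ‖x - w.1‖ ‖x - w.2‖} <;>
    simp [truncKer, Set.indicator_apply, mul_assoc]

lemma norm_truncKer_le {K : Rd d → Rd d → Rd d → ℂ} {cK : ℝ≥0} {ω : ℝ → ℝ}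
    (hK : IsCZKernel K cK ω) {ε : ℝ} (hε : 0 < ε) (x : Rd d) (w : Rd d × Rd d) :
    ‖truncKer K ε x w‖ ≤ cK / ε ^ (2 * d) := by
  by_cases h : w ∈ {w : Rd d × Rd d | ε < max ‖x - w.1‖ ‖x - w.2‖}
  · rw [truncKer, Set.indicator_of_mem h]
    have h' : ε < max ‖x - w.1‖ ‖x - w.2‖ := h
    have hs : ε ≤ ‖x - w.1‖ + ‖x - w.2‖ :=
      h'.le.trans (max_le (by linarith [norm_nonneg (x - w.2)])
        (by linarith [norm_nonneg (x - w.1)]))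
    refine (hK.size x w.1 w.2 ?_).trans
      (div_le_div_of_nonneg_left cK.2 (by positivity) (pow_le_pow_left₀ hε.le hs _))
    rintro ⟨e1, e2⟩
    rw [← e2, ← e1] at h'
    simp at h'
    linarith
  · rw [truncKer, Set.indicator_of_notMem h, norm_zero]
    positivity

lemma measurable_kernel_indicator {K : Rd d → Rd d → Rd d → ℂ} {cK : ℝ≥0} {ω : ℝ → ℝ}
    (hK : IsCZKernel K cK ω) :
    Measurable ((offDiag d).indicator fun z : Rd d × Rd d × Rd d => K z.1 z.2.1 z.2.2) := by
  classical
  rw [← Set.piecewise_eq_indicator]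
  exact ContinuousOn.measurable_piecewise hK.continuousOn continuousOn_const
    isOpen_offDiag.measurableSet

lemma measurable_truncKer {K : Rd d → Rd d → Rd d → ℂ} {cK : ℝ≥0} {ω : ℝ → ℝ}
    (hK : IsCZKernel K cK ω) {ε : ℝ} (hε : 0 < ε) :
    Measurable fun z : Rd d × Rd d × Rd d => truncKer K ε z.1 z.2 := by
  have hs : MeasurableSet {z : Rd d × Rd d × Rd d | ε < max ‖z.1 - z.2.1‖ ‖z.1 - z.2.2‖} :=
    (isOpen_lt continuous_const (by fun_prop)).measurableSet
  have h := (measurable_kernel_indicator hK).indicator hs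
  convert h using 1
  funext z
  by_cases hz : ε < max ‖z.1 - z.2.1‖ ‖z.1 - z.2.2‖
  · have hoff : z ∈ offDiag d := by
      rintro ⟨e1, e2⟩
      rw [← e2, ← e1] at hz
      simp at hz
      linarith
    rw [Set.indicator_of_mem (show z ∈ {z : Rd d × Rd d × Rd d |
        ε < max ‖z.1 - z.2.1‖ ‖z.1 - z.2.2‖} from hz),
      Set.indicator_of_mem hoff, truncKer, Set.indicator_of_mem (by exact hz)]
  · rw [Set.indicator_of_notMem (show z ∉ {z : Rd d × Rd d × Rd d |
        ε < max ‖z.1 - z.2.1‖ ‖z.1 - z.2.2‖} from hz), truncKer,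
      Set.indicator_of_notMem (by exact hz)]

/-! ### Bounded convergence and integrals -/

/-- General countably generated filters are allowed because the Cauchy property will be phrased
along `atTop` on `ℕ × ℕ`. -/
lemma tendsto_lintegral_of_dominated {α : Type*} [MeasurableSpace α] {μ : Measure α} {ι : Type*}
    {l : Filter ι} [l.IsCountablyGenerated] {F : ι → α → ℝ≥0∞} {f : α → ℝ≥0∞} (bound : α → ℝ≥0∞)
    (hF : ∀ i, AEMeasurable (F i) μ) (hb : ∀ i, ∀ᵐ a ∂μ, F i a ≤ bound a)
    (hfin : ∫⁻ a, bound a ∂μ ≠ ⊤) (hlim : ∀ᵐ a ∂μ, Tendsto (fun i => F i a) l (𝓝 (f a))) :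
    Tendsto (fun i => ∫⁻ a, F i a ∂μ) l (𝓝 (∫⁻ a, f a ∂μ)) := by
  refine tendsto_of_seq_tendsto fun u hu => ?_
  exact tendsto_lintegral_of_dominated_convergence' bound (fun n => hF (u n)) (fun n => hb (u n))
    hfin (by filter_upwards [hlim] with a ha using ha.comp hu)

/-- A family of functions bounded by `M`, with supports in the ball of radius `M`. -/
def UnifBdd {ι : Type*} (M : ℝ) (w : ι → Rd d → ℂ) : Prop :=
  ∀ i, AEStronglyMeasurable (w i) volume ∧
    ∀ᵐ x ∂(volume : Measure (Rd d)), ‖w i x‖ ≤ M ∧ (M < ‖x‖ → w i x = 0)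

lemma UnifBdd.sub {ι : Type*} {M M' : ℝ} (hM : 0 ≤ M) (hM' : 0 ≤ M') {w w' : ι → Rd d → ℂ}
    (h : UnifBdd M w) (h' : UnifBdd M' w') : UnifBdd (M + M') (fun i x => w i x - w' i x) := by
  intro i
  refine ⟨(h i).1.sub (h' i).1, ?_⟩
  filter_upwards [(h i).2, (h' i).2] with x h h'
  refine ⟨(norm_sub_le _ _).trans (add_le_add h.1 h'.1), fun hx => ?_⟩
  rw [h.2 (by linarith), h'.2 (by linarith), sub_zero]

lemma UnifBdd.const {f : Rd d → ℂ} (hf : MemBddCpt f) {ι : Type*} :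
    ∃ M : ℝ, 0 < M ∧ UnifBdd M (fun _ : ι => f) := by
  obtain ⟨M, hM, h⟩ := hf.exists_bound
  exact ⟨M, hM, fun _ => ⟨hf.1, h⟩⟩

lemma BddConv.unifBdd {hn : ℕ → cubeSpan d} {h : Rd d → ℂ} (H : BddConv hn h) :
    ∃ M : ℝ, 0 < M ∧ UnifBdd M (fun n => (hn n : Rd d → ℂ)) := by
  obtain ⟨M, hM, hb⟩ := H.exists_bound
  exact ⟨M, hM, fun n => ⟨(measurable_cubeSpan _).aestronglyMeasurable,
    Eventually.of_forall (hb n)⟩⟩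

lemma UnifBdd.tendsto_eLpNorm {ι : Type*} {l : Filter ι} [l.IsCountablyGenerated] {M : ℝ}
    {w : ι → Rd d → ℂ} (hw : UnifBdd M w)
    (hlim : ∀ᵐ x ∂(volume : Measure (Rd d)), Tendsto (fun i => w i x) l (𝓝 0)) {p : ℝ}
    (hp : 0 < p) :
    Tendsto (fun i => eLpNorm (w i) (ENNReal.ofReal p) volume) l (𝓝 0) := by
  have h1 : ∀ i, eLpNorm (w i) (ENNReal.ofReal p) volume = (∫⁻ x, ‖w i x‖ₑ ^ p) ^ (1 / p) := by
    intro i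
    rw [eLpNorm_eq_lintegral_rpow_enorm_toReal (by simpa using hp) ENNReal.ofReal_ne_top,
      ENNReal.toReal_ofReal hp.le]
  simp only [h1]
  have h2 : Tendsto (fun i => ∫⁻ x, ‖w i x‖ₑ ^ p) l (𝓝 (∫⁻ _ : Rd d, 0)) := by
    refine tendsto_lintegral_of_dominated
      ((Metric.closedBall (0 : Rd d) M).indicator fun _ => ENNReal.ofReal M ^ p)
      (fun i => (hw i).1.enorm.pow_const p) (fun i => ?_) ?_ ?_
    · filter_upwards [(hw i).2] with x hx
      have := enorm_le_indicator hx
      by_cases hb : x ∈ Metric.closedBall (0 : Rd d) M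
      · rw [Set.indicator_of_mem hb] at this ⊢
        exact ENNReal.rpow_le_rpow this hp.le
      · rw [Set.indicator_of_notMem hb] at this ⊢
        rw [le_zero_iff.1 this, ENNReal.zero_rpow_of_pos hp]
    · rw [lintegral_indicator measurableSet_closedBall, setLIntegral_const]
      exact ENNReal.mul_ne_top (ENNReal.rpow_ne_top_of_nonneg hp.le ENNReal.ofReal_ne_top)
        measure_closedBall_lt_top.ne
    · filter_upwards [hlim] with x hx
      have := (ENNReal.continuous_rpow_const (y := p)).tendsto 0 |>.comp
        ((continuous_enorm.tendsto (0 : ℂ)).comp hx |>.trans (by simp))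
      simpa [ENNReal.zero_rpow_of_pos hp, Function.comp_def] using this
  have h3 := ((ENNReal.continuous_rpow_const (y := 1 / p)).tendsto _).comp h2
  simpa [ENNReal.zero_rpow_of_pos (inv_pos.2 hp), Function.comp_def] using h3

lemma setLIntegral_enorm_le_eLpNorm {F : Rd d → ℂ} (hF : AEStronglyMeasurable F volume) {σ : ℝ}
    (hσ : 1 ≤ σ) (s : Set (Rd d)) :
    ∫⁻ x in s, ‖F x‖ₑ ≤ eLpNorm F (ENNReal.ofReal σ) volume * volume s ^ (1 - 1 / σ) := by
  have h := eLpNorm_le_eLpNorm_mul_rpow_measure_univ (μ := volume.restrict s) (f := F) (p := 1)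
    (q := ENNReal.ofReal σ) (by simpa using ENNReal.ofReal_le_ofReal hσ) hF.restrict
  rw [eLpNorm_one_eq_lintegral_enorm, ENNReal.toReal_ofReal (by linarith), Measure.restrict_apply
    MeasurableSet.univ, Set.univ_inter] at h
  refine h.trans ?_
  simp only [ENNReal.toReal_one, div_one]
  gcongr
  exact Measure.restrict_le_self

/-! ### The truncated operators on bounded functions of bounded support -/

section truncation

variable {K : Rd d → Rd d → Rd d → ℂ} {cK : ℝ≥0} {ω : ℝ → ℝ} {ε : ℝ}

lemma measurable_truncKer_right (hK : IsCZKernel K cK ω) (hε : 0 < ε) (x : Rd d) :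
    Measurable (truncKer K ε x) := by
  have h : Measurable (Function.uncurry (truncKer K ε)) := measurable_truncKer hK hε
  exact h.of_uncurry_left

lemma integrable_truncKer_mul (hK : IsCZKernel K cK ω) (hε : 0 < ε) {f g : Rd d → ℂ}
    (hf : MemBddCpt f) (hg : MemBddCpt g) (x : Rd d) :
    Integrable (fun w : Rd d × Rd d => truncKer K ε x w * (f w.1 * g w.2)) volume :=
  (hf.integrable.mul_prod hg.integrable).bdd_mul
    (measurable_truncKer_right hK hε x).aestronglyMeasurable
    (Eventually.of_forall (norm_truncKer_le hK hε x))

lemma aestronglyMeasurable_truncation (hK : IsCZKernel K cK ω) (hε : 0 < ε) {f g : Rd d → ℂ}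
    (hf : AEStronglyMeasurable f volume) (hg : AEStronglyMeasurable g volume) :
    AEStronglyMeasurable (truncation K ε f g) volume := by
  have h : AEStronglyMeasurable
      (fun z : Rd d × Rd d × Rd d => truncKer K ε z.1 z.2 * (f z.2.1 * g z.2.2))
      ((volume : Measure (Rd d)).prod (volume : Measure (Rd d × Rd d))) := by
    refine (measurable_truncKer hK hε).aestronglyMeasurable.mul ?_
    exact (AEStronglyMeasurable.mul (hf.comp_fst (ν := volume)) (hg.comp_snd (μ := volume))).comp_snd
  simpa only [funext (truncation_eq K ε f g)] using h.integral_prod_right'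

lemma truncation_sub_left (hK : IsCZKernel K cK ω) (hε : 0 < ε) {f f' g : Rd d → ℂ}
    (hf : MemBddCpt f) (hf' : MemBddCpt f') (hg : MemBddCpt g) (x : Rd d) :
    truncation K ε (fun y => f y - f' y) g x = truncation K ε f g x - truncation K ε f' g x := by
  rw [truncation_eq, truncation_eq, truncation_eq, ← integral_sub
    (integrable_truncKer_mul hK hε hf hg x) (integrable_truncKer_mul hK hε hf' hg x)]
  congr 1; funext w; ring

lemma truncation_sub_right (hK : IsCZKernel K cK ω) (hε : 0 < ε) {f g g' : Rd d → ℂ}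
    (hf : MemBddCpt f) (hg : MemBddCpt g) (hg' : MemBddCpt g') (x : Rd d) :
    truncation K ε f (fun y => g y - g' y) x = truncation K ε f g x - truncation K ε f g' x := by
  rw [truncation_eq, truncation_eq, truncation_eq, ← integral_sub
    (integrable_truncKer_mul hK hε hf hg x) (integrable_truncKer_mul hK hε hf hg' x)]
  congr 1; funext w; ring

lemma truncation_smul_left (c : ℂ) (f g : Rd d → ℂ) (x : Rd d) :
    truncation K ε (c • f) g x = c * truncation K ε f g x := by
  rw [truncation_eq, truncation_eq, ← integral_const_mul]
  congr 1; funext w; simp; ring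

lemma truncation_smul_right (c : ℂ) (f g : Rd d → ℂ) (x : Rd d) :
    truncation K ε f (c • g) x = c * truncation K ε f g x := by
  rw [truncation_eq, truncation_eq, ← integral_const_mul]
  congr 1; funext w; simp; ring

lemma tendsto_truncation (hK : IsCZKernel K cK ω) (hε : 0 < ε) {f g : Rd d → ℂ}
    {fn gn : ℕ → cubeSpan d} (hf : BddConv fn f) (hg : BddConv gn g) (x : Rd d) :
    Tendsto (fun n => truncation K ε (fn n : Rd d → ℂ) (gn n : Rd d → ℂ) x) atTop
      (𝓝 (truncation K ε f g x)) := by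
  obtain ⟨M, hM, hfb⟩ := hf.exists_bound
  obtain ⟨M', hM', hgb⟩ := hg.exists_bound
  simp only [truncation_eq]
  have hind : ∀ m : ℝ, Integrable ((Metric.closedBall (0 : Rd d) m).indicator fun _ => m)
      volume := fun m =>
    (integrable_indicator_iff measurableSet_closedBall).2
      (integrableOn_const measure_closedBall_lt_top.ne)
  have hle : ∀ (m : ℝ) (c : ℂ) (y : Rd d), ‖c‖ ≤ m ∧ (m < ‖y‖ → c = 0) →
      ‖c‖ ≤ (Metric.closedBall (0 : Rd d) m).indicator (fun _ => m) y := by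
    intro m c y h
    by_cases hb : y ∈ Metric.closedBall (0 : Rd d) m
    · rw [Set.indicator_of_mem hb]; exact h.1
    · rw [h.2 (by simpa using hb)]; simp [hb]
  refine tendsto_integral_of_dominated_convergence
    (fun w => (cK / ε ^ (2 * d)) * ((Metric.closedBall (0 : Rd d) M).indicator (fun _ => M) w.1 *
      (Metric.closedBall (0 : Rd d) M').indicator (fun _ => M') w.2)) (fun n => ?_) ?_ (fun n => ?_) ?_
  · exact (integrable_truncKer_mul hK hε (memBddCpt_cubeSpan _) (memBddCpt_cubeSpan _) x).1
  · exact ((hind M).mul_prod (hind M')).const_mul _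
  · refine Eventually.of_forall fun w => ?_
    rw [norm_mul, norm_mul]
    have h1 := hle M _ w.1 (hfb n w.1)
    have h2 := hle M' _ w.2 (hgb n w.2)
    exact mul_le_mul (norm_truncKer_le hK hε x w) (mul_le_mul h1 h2 (norm_nonneg _)
      ((norm_nonneg _).trans h1)) (by positivity) (by positivity)
  · have h1 := Measure.quasiMeasurePreserving_fst (μ := (volume : Measure (Rd d)))
      (ν := (volume : Measure (Rd d))) |>.ae hf.2
    have h2 := Measure.quasiMeasurePreserving_snd (μ := (volume : Measure (Rd d)))
      (ν := (volume : Measure (Rd d))) |>.ae hg.2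
    filter_upwards [h1, h2] with w h1 h2
    exact (h1.mul h2).const_mul _

/-- Fatou's lemma along dyadic approximants: the truncated kernel is bounded, so the truncations
converge pointwise, and the norms of the arguments converge. Arguments outside `Σ` are needed,
namely `bf` and restrictions to Euclidean balls. -/
lemma TruncationsBoundedBy.eLpNorm_le {p q : ℝ} {B : ℝ≥0} (hK : IsCZKernel K cK ω)
    (hB : TruncationsBoundedBy K p q B) (hp : 1 < p) (hq : 1 < q) (hε : 0 < ε)
    {f g : Rd d → ℂ} (hf : MemBddCpt f) (hg : MemBddCpt g) :
    eLpNorm (truncation K ε f g) (ENNReal.ofReal (sigma p q)) volume ≤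
      B * eLpNorm f (ENNReal.ofReal p) volume * eLpNorm g (ENNReal.ofReal q) volume := by
  obtain ⟨fn, hfn⟩ := exists_bddConv hf
  obtain ⟨gn, hgn⟩ := exists_bddConv hg
  have key : ∀ {h : Rd d → ℂ} {hn : ℕ → cubeSpan d} (_ : MemBddCpt h) (_ : BddConv hn h) {s : ℝ}
      (_ : 1 < s), Tendsto (fun n => eLpNorm h (ENNReal.ofReal s) volume +
        eLpNorm (fun x => (hn n : Rd d → ℂ) x - h x) (ENNReal.ofReal s) volume) atTop
        (𝓝 (eLpNorm h (ENNReal.ofReal s) volume)) ∧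
      ∀ n, eLpNorm (hn n : Rd d → ℂ) (ENNReal.ofReal s) volume ≤
        eLpNorm h (ENNReal.ofReal s) volume +
        eLpNorm (fun x => (hn n : Rd d → ℂ) x - h x) (ENNReal.ofReal s) volume := by
    intro h hn hh hhn s hs
    obtain ⟨M, hM, hb⟩ := hhn.unifBdd
    obtain ⟨M', hM', hb'⟩ := UnifBdd.const hh (ι := ℕ)
    constructor
    · have := (hb.sub hM.le hM'.le hb').tendsto_eLpNorm (l := atTop) (p := s)
        (by filter_upwards [hhn.2] with x hx; simpa using hx.sub_const (h x)) (by linarith)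
      simpa using this.const_add (eLpNorm h (ENNReal.ofReal s) volume)
    · intro n
      have := eLpNorm_add_le (μ := volume) (f := h) (g := fun x => (hn n : Rd d → ℂ) x - h x)
        (p := ENNReal.ofReal s) hh.1 ((hb n).1.sub hh.1)
        (by simpa using ENNReal.ofReal_le_ofReal hs.le)
      refine le_trans (le_of_eq ?_) this
      congr 1; funext x; simp
  obtain ⟨f1, f2⟩ := key hf hfn hp
  obtain ⟨g1, g2⟩ := key hg hgn hq
  have hlim := Lp.eLpNorm_lim_le_liminf_eLpNorm (μ := volume) (p := ENNReal.ofReal (sigma p q))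
    (fun n => aestronglyMeasurable_truncation hK hε
      (measurable_cubeSpan (fn n)).aestronglyMeasurable
      (measurable_cubeSpan (gn n)).aestronglyMeasurable) (truncation K ε f g)
    (Eventually.of_forall fun x => tendsto_truncation hK hε hfn hgn x)
  refine hlim.trans ?_
  have hfin := (hf.memLp (ENNReal.ofReal p)).2.ne
  have hgin := (hg.memLp (ENNReal.ofReal q)).2.ne
  have hmul := ENNReal.Tendsto.mul (ENNReal.Tendsto.const_mul (a := (B : ℝ≥0∞)) f1
    (Or.inr ENNReal.coe_ne_top)) (Or.inr hgin) g1
    (Or.inr (ENNReal.mul_ne_top ENNReal.coe_ne_top hfin))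
  rw [← hmul.liminf_eq]
  refine liminf_le_liminf (Eventually.of_forall fun n => (hB ε hε (fn n) (gn n)).trans ?_)
  gcongr
  exacts [f2 n, g2 n]

lemma TruncationsBoundedBy.setLIntegral_le {p q : ℝ} {B : ℝ≥0} (hK : IsCZKernel K cK ω)
    (hB : TruncationsBoundedBy K p q B) (hp : 1 < p) (hq : 1 < q) (hσ : 1 ≤ sigma p q)
    (hε : 0 < ε) {f g : Rd d → ℂ} (hf : MemBddCpt f) (hg : MemBddCpt g) (s : Set (Rd d)) :
    ∫⁻ x in s, ‖truncation K ε f g x‖ₑ ≤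
      B * eLpNorm f (ENNReal.ofReal p) volume * eLpNorm g (ENNReal.ofReal q) volume *
        volume s ^ (1 - 1 / sigma p q) :=
  (setLIntegral_enorm_le_eLpNorm (aestronglyMeasurable_truncation hK hε hf.1 hg.1) hσ s).trans
    (mul_le_mul_left (hB.eLpNorm_le hK hp hq hε hf hg) _)

end truncation

/-! ### Comparison of the operator with its truncations -/

section comparison

variable {K : Rd d → Rd d → Rd d → ℂ} {cK : ℝ≥0} {ω : ℝ → ℝ}

lemma exists_norm_truncation_le (hK : IsCZKernel K cK ω) {ε : ℝ} (hε : 0 < ε) {f g : Rd d → ℂ}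
    (hf : MemBddCpt f) (hg : MemBddCpt g) : ∃ C : ℝ, ∀ x, ‖truncation K ε f g x‖ ≤ C := by
  refine ⟨∫ w : Rd d × Rd d, cK / ε ^ (2 * d) * ‖f w.1 * g w.2‖, fun x => ?_⟩
  rw [truncation_eq]
  refine norm_integral_le_of_norm_le ((hf.integrable.mul_prod hg.integrable).norm.const_mul _)
    (Eventually.of_forall fun w => ?_)
  rw [norm_mul]
  exact mul_le_mul_of_nonneg_right (norm_truncKer_le hK hε x w) (norm_nonneg _)

lemma isBounded_dyad (n : ℕ) (k : Fin d → ℤ) : Bornology.IsBounded (dyad n k) :=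
  isBounded_cube _ _

lemma isCompact_tsupport_cubeSpan (f : cubeSpan d) : IsCompact (tsupport (f : Rd d → ℂ)) := by
  obtain ⟨M, R, h⟩ := exists_bound_cubeSpan f
  refine HasCompactSupport.intro (isCompact_closedBall (0 : Rd d) R) fun x hx => (h x).2 ?_
  simpa using hx

/-- On the compact set `closure s × (supp f × supp g)`, which misses the diagonal,
`max(|x-y|,|x-z|)` has a positive lower bound `δ`; below `δ` the truncation removes nothing from the
integral. -/
lemma exists_truncation_eq {s : Set (Rd d)} (hs : Bornology.IsBounded s) (f g : cubeSpan d)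
    (h : Disjoint (closure s) (tsupport (f : Rd d → ℂ) ∩ tsupport (g : Rd d → ℂ))) :
    ∃ δ > 0, ∀ ε, ε < δ → ∀ x ∈ s, truncation K ε (f : Rd d → ℂ) (g : Rd d → ℂ) x =
      ∫ w : Rd d × Rd d, K x w.1 w.2 * (f : Rd d → ℂ) w.1 * (g : Rd d → ℂ) w.2 := by
  have hcpt : IsCompact (closure s ×ˢ (tsupport (f : Rd d → ℂ) ×ˢ tsupport (g : Rd d → ℂ))) :=
    hs.isCompact_closure.prod
      ((isCompact_tsupport_cubeSpan f).prod (isCompact_tsupport_cubeSpan g))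
  obtain ⟨δ, hδ, hmin⟩ := hcpt.exists_forall_le' (a := 0)
    (f := fun z : Rd d × Rd d × Rd d => max ‖z.1 - z.2.1‖ ‖z.1 - z.2.2‖)
    (by fun_prop) (by
      rintro ⟨x, y, z⟩ ⟨hx, hy, hz⟩
      refine max_norm_pos ?_
      rintro ⟨e1, e2⟩
      simp only at e1 e2 hx hy hz
      subst e1 e2
      exact Set.disjoint_left.1 h hx ⟨hy, hz⟩)
  refine ⟨δ, hδ, fun ε hε x hx => ?_⟩
  rw [truncation_eq]
  congr 1
  funext w
  by_cases hw : w.1 ∈ tsupport (f : Rd d → ℂ) ∧ w.2 ∈ tsupport (g : Rd d → ℂ)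
  · have hlt := hε.trans_le (hmin (x, w) ⟨subset_closure hx, hw⟩)
    rw [truncKer, Set.indicator_of_mem (by exact hlt), mul_assoc]
  · rw [not_and_or] at hw
    rcases hw with hw | hw
    · simp [image_eq_zero_of_notMem_tsupport hw]
    · simp [image_eq_zero_of_notMem_tsupport hw]

lemma setIntegral_eq_of_disjoint {T : BilinOp d} (hT : HasKernel T K) (f g : cubeSpan d) (n : ℕ)
    (k : Fin d → ℤ)
    (h : Disjoint (closure (dyad n k)) (tsupport (f : Rd d → ℂ) ∩ tsupport (g : Rd d → ℂ))) :
    ∫ x in dyad n k, (T f g : Rd d → ℂ) x =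
      ∫ x in dyad n k, ∫ w : Rd d × Rd d,
        K x w.1 w.2 * (f : Rd d → ℂ) w.1 * (g : Rd d → ℂ) w.2 := by
  have hts : tsupport (dyadInd n k : Rd d → ℂ) ⊆ closure (dyad n k) := by
    rw [coe_dyadInd]
    exact closure_mono Set.support_indicator_subset
  have h1 := hT.repr f g (dyadInd n k) (by
    rw [← Set.disjoint_iff_inter_eq_empty]
    exact (h.mono_left hts).symm)
  rw [← integral_indicator (measurableSet_dyad n k), ← integral_indicator (measurableSet_dyad n k)]
  refine Eq.trans ?_ (h1.trans ?_) <;>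
  · congr 1
    funext x
    rw [coe_dyadInd]
    by_cases hx : x ∈ dyad n k <;> simp [hx]

/-- Near a point off the common support, testing the kernel representation against indicators of
dyadic cubes shows that `T(f,g)` and a fixed truncation have the same averages over all small dyadic
cubes. Lebesgue differentiation then makes them equal almost everywhere. -/
lemma HasKernel.ae_eq_truncation {T : BilinOp d} (hK : IsCZKernel K cK ω) (hT : HasKernel T K)
    (f g : cubeSpan d) :
    ∀ᵐ x ∂(volume : Measure (Rd d)),
      x ∉ tsupport (f : Rd d → ℂ) ∩ tsupport (g : Rd d → ℂ) → ∃ δ > 0, ∀ ε, 0 < ε → ε < δ →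
        (T f g : Rd d → ℂ) x = truncation K ε (f : Rd d → ℂ) (g : Rd d → ℂ) x := by
  set Z := tsupport (f : Rd d → ℂ) ∩ tsupport (g : Rd d → ℂ) with hZ
  have hZc : IsClosed Z := (isClosed_tsupport _).inter (isClosed_tsupport _)
  have key : ∀ n k, Disjoint (closure (dyad n k)) Z → ∀ᵐ x ∂(volume : Measure (Rd d)),
      x ∈ dyad n k → ∃ δ > 0, ∀ ε, 0 < ε → ε < δ →
        (T f g : Rd d → ℂ) x = truncation K ε (f : Rd d → ℂ) (g : Rd d → ℂ) x := by
    intro n k hdis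
    obtain ⟨δ, hδ, heq⟩ := exists_truncation_eq (K := K) (isBounded_dyad n k) f g hdis
    have hδ2 : 0 < δ / 2 := by positivity
    set F : Rd d → ℂ := fun x =>
      (T f g : Rd d → ℂ) x - truncation K (δ / 2) (f : Rd d → ℂ) (g : Rd d → ℂ) x with hF
    have hTint : ∀ s : Set (Rd d), Bornology.IsBounded s →
        IntegrableOn (T f g : Rd d → ℂ) s volume := fun s hs =>
      ((hT.locallyIntegrable f g).integrableOn_isCompact hs.isCompact_closure).mono_set
        subset_closure
    have htr : ∀ s : Set (Rd d), volume s ≠ ⊤ →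
        IntegrableOn (truncation K (δ / 2) (f : Rd d → ℂ) (g : Rd d → ℂ)) s volume := by
      intro s hs
      obtain ⟨C, hC⟩ := exists_norm_truncation_le hK hδ2 (memBddCpt_cubeSpan f)
        (memBddCpt_cubeSpan g)
      exact Measure.integrableOn_of_bounded hs (aestronglyMeasurable_truncation hK hδ2
        (measurable_cubeSpan f).aestronglyMeasurable (measurable_cubeSpan g).aestronglyMeasurable)
        (Eventually.of_forall hC)
    have hFint : Integrable ((dyad n k).indicator F) volume :=
      (integrable_indicator_iff (measurableSet_dyad n k)).2
        ((hTint _ (isBounded_dyad _ _)).sub (htr _ (volume_dyad_ne_top n k)))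
    filter_upwards [ae_tendsto_average_dyad hFint.locallyIntegrable] with x hx hxk
    have hzero : ∀ m, n ≤ m → (⨍ y in dyad m (dyadIdx m x), (dyad n k).indicator F y) = 0 := by
      intro m hm
      have hsub : dyad m (dyadIdx m x) ⊆ dyad n k := by
        have := dyad_subset_dyad hm x
        rwa [mem_dyad_iff.1 hxk] at this
      have e1 : ∫ y in dyad m (dyadIdx m x), (dyad n k).indicator F y =
          ∫ y in dyad m (dyadIdx m x), F y :=
        setIntegral_congr_fun (measurableSet_dyad _ _) fun y hy =>
          Set.indicator_of_mem (hsub hy) _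
      rw [setAverage_eq, e1, hF, integral_sub (hTint _ (isBounded_dyad _ _))
        (htr _ (volume_dyad_ne_top _ _)), setIntegral_eq_of_disjoint hT f g m _
        (hdis.mono_left (closure_mono hsub)), sub_eq_zero.2, smul_zero]
      exact (setIntegral_congr_fun (measurableSet_dyad _ _) fun y hy =>
        heq (δ / 2) (by linarith) y (hsub hy)).symm
    have hF0 : F x = 0 := by
      have h2 : Tendsto (fun m => ⨍ y in dyad m (dyadIdx m x), (dyad n k).indicator F y) atTop
          (𝓝 0) := tendsto_const_nhds.congr' (by
        filter_upwards [eventually_ge_atTop n] with m hm using (hzero m hm).symm)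
      have := tendsto_nhds_unique hx h2
      rwa [Set.indicator_of_mem hxk] at this
    refine ⟨δ, hδ, fun ε _ hεδ => ?_⟩
    rw [heq ε hεδ x hxk, ← heq (δ / 2) (by linarith) x hxk]
    exact sub_eq_zero.1 hF0
  have hall : ∀ᵐ x ∂(volume : Measure (Rd d)), ∀ n k, Disjoint (closure (dyad n k)) Z →
      x ∈ dyad n k → ∃ δ > 0, ∀ ε, 0 < ε → ε < δ →
        (T f g : Rd d → ℂ) x = truncation K ε (f : Rd d → ℂ) (g : Rd d → ℂ) x := by
    refine ae_all_iff.2 fun n => ae_all_iff.2 fun k => ?_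
    by_cases h : Disjoint (closure (dyad n k)) Z
    · filter_upwards [key n k h] with x hx _ using hx
    · exact Eventually.of_forall fun x h' => absurd h' h
  filter_upwards [hall] with x hx hxZ
  obtain ⟨s, hs, hsc, hsZ⟩ := exists_mem_nhds_isClosed_subset (hZc.isOpen_compl.mem_nhds hxZ)
  obtain ⟨n, hn⟩ := (eventually_dyad_subset hs).exists
  refine hx n _ ?_ (mem_dyad_dyadIdx n x)
  exact (Set.disjoint_compl_left_iff_subset.2 subset_rfl).mono_left
    ((closure_minimal hn hsc).trans hsZ)

/-- For a small dyadic cube `P` around `x`, both `f - f(x) 1_P` and `g - g(x) 1_P` vanish near `x`.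
Expanding, `T(f,g) = f(x) g(x) T(P,P) + f(x) T(P, g - g(x) 1_P) + T(f - f(x) 1_P, g)`, where the
last two terms agree with their truncations at `x` by `HasKernel.ae_eq_truncation`. -/
lemma HasKernel.ae_sub_eq_truncation_sub_dyad {T : BilinOp d} (hK : IsCZKernel K cK ω)
    (hT : HasKernel T K) (f g : cubeSpan d) :
    ∀ᵐ x ∂(volume : Measure (Rd d)), ∀ᶠ n in atTop, ∃ δ > 0, ∀ ε, 0 < ε → ε < δ →
      let P := dyadInd n (dyadIdx n x)
      (T f g : Rd d → ℂ) x - (f : Rd d → ℂ) x * (g : Rd d → ℂ) x * (T P P : Rd d → ℂ) x =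
        truncation K ε f g x -
          (f : Rd d → ℂ) x * (g : Rd d → ℂ) x * truncation K ε P P x := by
  -- The constants subtracted are values at the corner of the cube instead of at `x`. This leaves
  -- only countably many functions `res f n k`, so that the exceptional null sets can be united; on
  -- small cubes the corner value is `f x` anyway.
  let pt : ℕ → (Fin d → ℤ) → Rd d := fun n k => WithLp.toLp 2 fun i => (k i : ℝ) * (1 / 2) ^ n
  have hpt : ∀ n k, pt n k ∈ dyad n k := fun n k i =>
    ⟨le_rfl, by simp only [pt]; linarith [show (0 : ℝ) < (1 / 2) ^ n by positivity]⟩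
  let res : cubeSpan d → ℕ → (Fin d → ℤ) → cubeSpan d := fun f n k =>
    f - (f : Rd d → ℂ) (pt n k) • dyadInd n k
  have h1 : ∀ᵐ x ∂(volume : Measure (Rd d)), ∀ n k, _ := ae_all_iff.2 fun n => ae_all_iff.2
    fun k => hT.ae_eq_truncation hK (dyadInd n k) (res g n k)
  have h2 : ∀ᵐ x ∂(volume : Measure (Rd d)), ∀ n k, _ := ae_all_iff.2 fun n => ae_all_iff.2
    fun k => hT.ae_eq_truncation hK (res f n k) g
  have h3 : ∀ᵐ x ∂(volume : Measure (Rd d)), ∀ n k, (T f g : Rd d → ℂ) x =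
      (f : Rd d → ℂ) (pt n k) * ((g : Rd d → ℂ) (pt n k) *
        (T (dyadInd n k) (dyadInd n k) : Rd d → ℂ) x +
        (T (dyadInd n k) (res g n k) : Rd d → ℂ) x) + (T (res f n k) g : Rd d → ℂ) x := by
    refine ae_all_iff.2 fun n => ae_all_iff.2 fun k => ?_
    have e : T f g = (f : Rd d → ℂ) (pt n k) • ((g : Rd d → ℂ) (pt n k) •
        T (dyadInd n k) (dyadInd n k) + T (dyadInd n k) (res g n k)) + T (res f n k) g := by
      simp only [res, map_sub, map_smul, LinearMap.sub_apply, LinearMap.smul_apply]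
      simp
    have a1 := AEEqFun.coeFn_add ((f : Rd d → ℂ) (pt n k) • ((g : Rd d → ℂ) (pt n k) •
        T (dyadInd n k) (dyadInd n k) + T (dyadInd n k) (res g n k))) (T (res f n k) g)
    have a2 := AEEqFun.coeFn_smul ((f : Rd d → ℂ) (pt n k)) ((g : Rd d → ℂ) (pt n k) •
        T (dyadInd n k) (dyadInd n k) + T (dyadInd n k) (res g n k))
    have a3 := AEEqFun.coeFn_add ((g : Rd d → ℂ) (pt n k) •
        T (dyadInd n k) (dyadInd n k)) (T (dyadInd n k) (res g n k))
    have a4 := AEEqFun.coeFn_smul ((g : Rd d → ℂ) (pt n k)) (T (dyadInd n k) (dyadInd n k))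
    filter_upwards [a1, a2, a3, a4] with x a1 a2 a3 a4
    rw [← e] at a1
    rw [a1, Pi.add_apply, a2, Pi.smul_apply, a3, Pi.add_apply, a4]
    simp
  filter_upwards [h1, h2, h3, ae_dyad_mem_nhds, ae_eventually_eq_cubeSpan f,
    ae_eventually_eq_cubeSpan g] with x h1 h2 h3 h4 h5 h6
  filter_upwards [eventually_dyad_subset h5, eventually_dyad_subset h6] with n hf hg
  set k := dyadIdx n x with hk
  have hxk : x ∈ dyad n k := mem_dyad_dyadIdx n x
  have hres : ∀ h : cubeSpan d, (dyad n k ⊆ {y | (h : Rd d → ℂ) y = (h : Rd d → ℂ) x}) →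
      x ∉ tsupport (res h n k : Rd d → ℂ) := by
    intro h hh
    rw [notMem_tsupport_iff_eventuallyEq]
    filter_upwards [h4 n] with y hy
    have hy' : y ∈ dyad n k := hy
    have e1 : (h : Rd d → ℂ) y = (h : Rd d → ℂ) x := hh hy
    have e2 : (h : Rd d → ℂ) (pt n k) = (h : Rd d → ℂ) x := hh (hpt n k)
    simp [res, e1, e2, coe_dyadInd, hy']
  obtain ⟨δ1, hδ1, E1⟩ := h1 n k fun h => hres g hg h.2
  obtain ⟨δ2, hδ2, E2⟩ := h2 n k fun h => hres f hf h.1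
  refine ⟨min δ1 δ2, lt_min hδ1 hδ2, fun ε hε hεδ => ?_⟩
  have ef : (f : Rd d → ℂ) (pt n k) = (f : Rd d → ℂ) x := hf (hpt n k)
  have eg : (g : Rd d → ℂ) (pt n k) = (g : Rd d → ℂ) x := hg (hpt n k)
  have b : ∀ h : cubeSpan d, MemBddCpt (h : Rd d → ℂ) := memBddCpt_cubeSpan
  have t1 : truncation K ε (dyadInd n k : Rd d → ℂ) (res g n k : Rd d → ℂ) x =
      truncation K ε (dyadInd n k : Rd d → ℂ) (g : Rd d → ℂ) x -
        (g : Rd d → ℂ) x * truncation K ε (dyadInd n k : Rd d → ℂ) (dyadInd n k : Rd d → ℂ) x := by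
    rw [← truncation_smul_right]
    rw [← eg]
    exact truncation_sub_right hK hε (b _) (b g) (b ((g : Rd d → ℂ) (pt n k) • dyadInd n k)) x
  have t2 : truncation K ε (res f n k : Rd d → ℂ) (g : Rd d → ℂ) x =
      truncation K ε (f : Rd d → ℂ) (g : Rd d → ℂ) x -
        (f : Rd d → ℂ) x * truncation K ε (dyadInd n k : Rd d → ℂ) (g : Rd d → ℂ) x := by
    rw [← truncation_smul_left]
    rw [← ef]
    exact truncation_sub_left hK hε (b f) (b ((f : Rd d → ℂ) (pt n k) • dyadInd n k)) (b g) x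
  simp only
  rw [h3 n k, E1 ε hε (hεδ.trans_le (min_le_left _ _)), E2 ε hε (hεδ.trans_le (min_le_right _ _)),
    t1, t2, ef, eg]
  ring

/-- Up to a multiplication operator, `T` is locally a limit of its truncations. -/
theorem HasKernel.ae_sub_eq_truncation_sub {T : BilinOp d} (hK : IsCZKernel K cK ω)
    (hT : HasKernel T K) (f g u : cubeSpan d) :
    ∀ᵐ x ∂(volume : Measure (Rd d)), (u : Rd d → ℂ) x = 1 → ∃ δ > 0, ∀ ε, 0 < ε → ε < δ →
      (T f g : Rd d → ℂ) x - (f : Rd d → ℂ) x * (g : Rd d → ℂ) x * (T u u : Rd d → ℂ) x =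
        truncation K ε f g x -
          (f : Rd d → ℂ) x * (g : Rd d → ℂ) x * truncation K ε u u x := by
  filter_upwards [hT.ae_sub_eq_truncation_sub_dyad hK f g,
    hT.ae_sub_eq_truncation_sub_dyad hK u u] with x h1 h2 hu
  -- A scale good for both pairs gives two identities with the same cube `P`. As `u x = 1`, the one
  -- for `(u,u)` determines `T(P,P) - T_ε(P,P)`, which is then eliminated from the other.
  obtain ⟨n, ⟨δ1, hδ1, E1⟩, δ2, hδ2, E2⟩ := (h1.and h2).exists
  refine ⟨min δ1 δ2, lt_min hδ1 hδ2, fun ε hε hεδ => ?_⟩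
  have e1 := E1 ε hε (hεδ.trans_le (min_le_left _ _))
  have e2 := E2 ε hε (hεδ.trans_le (min_le_right _ _))
  simp only [hu, one_mul] at e1 e2
  linear_combination e1 - (f : Rd d → ℂ) x * (g : Rd d → ℂ) x * e2

end comparison

/-! ### A John–Nirenberg inequality -/

lemma enorm_average_sub_mul_le {F : Rd d → ℂ} {s : Set (Rd d)} (hF : IntegrableOn F s volume)
    (h0 : volume s ≠ 0) (h1 : volume s ≠ ⊤) (c : ℂ) :
    ‖(⨍ x in s, F x) - c‖ₑ * volume s ≤ ∫⁻ x in s, ‖F x - c‖ₑ := by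
  have hr : volume.real s ≠ 0 := (ENNReal.toReal_pos h0 h1).ne'
  have e : ∫ x in s, (F x - c) = volume.real s • ((⨍ x in s, F x) - c) := by
    rw [integral_sub hF (integrableOn_const h1), setIntegral_const, setAverage_eq, smul_sub,
      smul_smul, mul_inv_cancel₀ hr, one_smul]
  have h := enorm_integral_le_lintegral_enorm (μ := volume.restrict s) (fun x => F x - c)
  rw [e, enorm_smul, mul_comm] at h
  refine le_trans (le_of_eq ?_) h
  rw [Real.enorm_eq_ofReal measureReal_nonneg, measureReal_def, ENNReal.ofReal_toReal h1]

lemma lintegral_sub_average_le {F : Rd d → ℂ} {s : Set (Rd d)} (hF : IntegrableOn F s volume)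
    (h0 : volume s ≠ 0) (h1 : volume s ≠ ⊤) (c : ℂ) :
    ∫⁻ x in s, ‖F x - ⨍ y in s, F y‖ₑ ≤ 2 * ∫⁻ x in s, ‖F x - c‖ₑ := by
  calc ∫⁻ x in s, ‖F x - ⨍ y in s, F y‖ₑ
      ≤ ∫⁻ x in s, (‖F x - c‖ₑ + ‖(⨍ y in s, F y) - c‖ₑ) := by
        refine lintegral_mono fun x => ?_
        have : F x - ⨍ y in s, F y = (F x - c) - ((⨍ y in s, F y) - c) := by ring
        rw [this]; exact enorm_sub_le
    _ = (∫⁻ x in s, ‖F x - c‖ₑ) + ‖(⨍ y in s, F y) - c‖ₑ * volume s := by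
        rw [lintegral_add_right _ measurable_const, setLIntegral_const]
    _ ≤ 2 * ∫⁻ x in s, ‖F x - c‖ₑ := by
        rw [two_mul]
        gcongr
        exact enorm_average_sub_mul_le hF h0 h1 c

lemma volume_dyad_succ (n : ℕ) (k k' : Fin d → ℤ) :
    volume (dyad n k : Set (Rd d)) = 2 ^ d * volume (dyad (n + 1) k' : Set (Rd d)) := by
  rw [volume_dyad, volume_dyad, ← mul_pow]
  congr 1
  rw [show (2 : ℝ≥0∞) = ENNReal.ofReal 2 by simp, ← ENNReal.ofReal_mul (by norm_num), pow_succ]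
  congr 1; ring

/-- Calderón–Zygmund stopping at height `2A`. The stopping cubes occupy at most half of the cube,
off them `|F - c| ≤ 2A` almost everywhere, and their own averages are within `2^d · 2A` of `c`.
Hence each level of height `2^d · 2A` gains a factor `1/2`. Stating the decay for the integral of
the excess lets the induction hypothesis be applied directly on the stopping cubes. -/
theorem lintegral_dyad_tsub_le {F : Rd d → ℂ} (hF : LocallyIntegrable F volume) {A : ℝ≥0}
    (hA : ∀ n k, ∫⁻ x in dyad n k, ‖F x - ⨍ y in dyad n k, F y‖ₑ ≤ A * volume (dyad n k)) (j : ℕ) :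
    ∀ n k, ∫⁻ x in dyad n k, (‖F x - ⨍ y in dyad n k, F y‖ₑ - j * (2 ^ d * (2 * A))) ≤
      A * 2⁻¹ ^ j * volume (dyad n k) := by
  have hint : ∀ n k, IntegrableOn F (dyad n k) volume := fun n k =>
    (hF.integrableOn_isCompact (isBounded_dyad n k).isCompact_closure).mono_set subset_closure
  induction j with
  | zero => simpa using hA
  | succ j ih =>
    intro n k
    set c : ℂ := ⨍ y in dyad n k, F y with hc
    let φ : ℕ → (Fin d → ℤ) → ℝ≥0∞ := fun m κ => ∫⁻ x in dyad m κ, ‖F x - c‖ₑ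
    let Bad : ℕ → (Fin d → ℤ) → Prop := fun m κ => 2 * A * volume (dyad m κ : Set (Rd d)) < φ m κ
    -- The inequality `n < m` may be strict because the initial cube is never bad: its oscillation
    -- is at most `A`. Every stopping cube therefore has a dyadic parent that was tested.
    let Stop : ℕ → Rd d → Prop := fun m x =>
      n < m ∧ Bad m (dyadIdx m x) ∧ ∀ i, n ≤ i → i < m → ¬ Bad i (dyadIdx i x)
    have hStop : ∀ {m x y}, dyadIdx m x = dyadIdx m y → Stop m x → Stop m y := by
      rintro m x y hxy ⟨h1, h2, h3⟩
      refine ⟨h1, hxy ▸ h2, fun i hi him => ?_⟩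
      rw [← dyadIdx_mono him.le hxy]
      exact h3 i hi him
    let S : Set (ℕ × (Fin d → ℤ)) := {s | ∃ x ∈ dyad n k, x ∈ dyad s.1 s.2 ∧ Stop s.1 x}
    have hSstop : ∀ s ∈ S, ∀ y ∈ dyad s.1 s.2, y ∈ dyad n k ∧ Stop s.1 y := by
      rintro s ⟨x, hxQ, hxs, hx⟩ y hy
      have e : dyadIdx s.1 x = dyadIdx s.1 y := (mem_dyad_iff.1 hxs).trans (mem_dyad_iff.1 hy).symm
      refine ⟨mem_dyad_iff.2 ?_, hStop e hx⟩
      rw [← dyadIdx_mono hx.1.le e]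
      exact mem_dyad_iff.1 hxQ
    have hdisj : Pairwise (Function.onFun Disjoint fun s : S => dyad (d := d) s.1.1 s.1.2) := by
      intro s s' hne
      refine Set.disjoint_left.2 fun y hy hy' => hne ?_
      have h1 := (hSstop s s.2 y hy).2
      have h2 := (hSstop s' s'.2 y hy').2
      have e : s.1.1 = s'.1.1 := by
        rcases lt_trichotomy s.1.1 s'.1.1 with h | h | h
        · exact absurd h1.2.1 (h2.2.2 _ h1.1.le h)
        · exact h
        · exact absurd h2.2.1 (h1.2.2 _ h2.1.le h)
      refine Subtype.ext (Prod.ext e ?_)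
      rw [← mem_dyad_iff.1 hy, ← mem_dyad_iff.1 hy', e]
    have hsub : (⋃ s : S, dyad (d := d) s.1.1 s.1.2) ⊆ dyad n k :=
      Set.iUnion_subset fun s y hy => (hSstop s s.2 y hy).1
    have hmeas : ∀ s : S, MeasurableSet (dyad (d := d) s.1.1 s.1.2) := fun s =>
      measurableSet_dyad _ _
    -- total measure of the stopping cubes
    have hvol : 2 * A * ∑' s : S, volume (dyad (d := d) s.1.1 s.1.2) ≤ A * volume (dyad n k) := by
      rw [← ENNReal.tsum_mul_left]
      calc ∑' s : S, 2 * A * volume (dyad (d := d) s.1.1 s.1.2)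
          ≤ ∑' s : S, φ s.1.1 s.1.2 := by
            refine ENNReal.tsum_le_tsum fun s => ?_
            obtain ⟨x, -, hxs, hx⟩ := s.2
            have := hx.2.1
            rw [mem_dyad_iff.1 hxs] at this
            exact this.le
        _ = ∫⁻ x in ⋃ s : S, dyad (d := d) s.1.1 s.1.2, ‖F x - c‖ₑ :=
            (lintegral_iUnion hmeas hdisj _).symm
        _ ≤ ∫⁻ x in dyad n k, ‖F x - c‖ₑ := lintegral_mono_set hsub
        _ ≤ _ := hA n k
    -- the averages over the stopping cubes
    have hav : ∀ s : S, ‖(⨍ y in dyad s.1.1 s.1.2, F y) - c‖ₑ ≤ 2 ^ d * (2 * A) := by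
      intro s
      obtain ⟨x, -, hxs, hx⟩ := s.2
      have hidx := mem_dyad_iff.1 hxs
      -- The parent, at scale `i`, is not bad; it contains the stopping cube and has `2^d` times its
      -- volume.
      obtain ⟨i, hi⟩ : ∃ i, s.1.1 = i + 1 := Nat.exists_eq_add_one_of_ne_zero
        (Nat.ne_of_gt (Nat.zero_lt_of_lt hx.1))
      have hni : n ≤ i := by have := hx.1; omega
      have h1 := hx.2.2 i hni (by omega)
      have h2 := enorm_average_sub_mul_le (hint s.1.1 s.1.2) (volume_dyad_ne_zero _ _)
        (volume_dyad_ne_top _ _) c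
      have h3 : φ s.1.1 s.1.2 ≤ φ i (dyadIdx i x) := by
        refine lintegral_mono_set ?_
        have := dyad_subset_dyad (show i ≤ s.1.1 by omega) x
        rwa [hidx] at this
      have h4 : volume (dyad i (dyadIdx i x)) = 2 ^ d * volume (dyad (d := d) s.1.1 s.1.2) := by
        rw [hi]; exact volume_dyad_succ _ _ _
      have h5 := h2.trans (h3.trans (not_lt.1 h1))
      rw [h4] at h5
      refine (ENNReal.mul_le_mul_iff_left (volume_dyad_ne_zero s.1.1 s.1.2)
        (volume_dyad_ne_top s.1.1 s.1.2)).1 (h5.trans (le_of_eq ?_))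
      ring
    -- off the stopping cubes
    have hoff : ∀ᵐ x ∂(volume : Measure (Rd d)), x ∈ dyad n k →
        x ∉ (⋃ s : S, dyad (d := d) s.1.1 s.1.2) → ‖F x - c‖ₑ ≤ 2 ^ d * (2 * A) := by
      filter_upwards [ae_tendsto_average_dyad hF] with x hx hxQ hxS
      have hgood : ∀ m, n ≤ m → ¬ Bad m (dyadIdx m x) := by
        intro m
        induction m using Nat.strong_induction_on with
        | _ m IH =>
          intro hm hbad
          rcases hm.eq_or_lt with rfl | hlt
          · rw [mem_dyad_iff.1 hxQ] at hbad
            refine absurd ((hA n k).trans ?_) (not_le.2 hbad)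
            rw [two_mul, add_mul]
            exact le_self_add
          · refine hxS (Set.mem_iUnion.2 ⟨⟨(m, dyadIdx m x), x, hxQ, mem_dyad_dyadIdx m x, hlt,
              hbad, fun i hi him => IH i him hi⟩, mem_dyad_dyadIdx m x⟩)
      have hle : ‖F x - c‖ₑ ≤ 2 * A := by
        refine le_of_tendsto ((continuous_enorm.tendsto _).comp (hx.sub_const c)) ?_
        filter_upwards [eventually_ge_atTop n] with m hm
        have h2 := enorm_average_sub_mul_le (hint m (dyadIdx m x)) (volume_dyad_ne_zero _ _)
          (volume_dyad_ne_top _ _) c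
        exact (ENNReal.mul_le_mul_iff_left (volume_dyad_ne_zero m (dyadIdx m x))
          (volume_dyad_ne_top m (dyadIdx m x))).1 (h2.trans (not_lt.1 (hgood m hm)))
      refine hle.trans (le_mul_of_one_le_left (zero_le) (one_le_pow₀ (by norm_num)))
    calc ∫⁻ x in dyad n k, (‖F x - c‖ₑ - (j + 1 : ℕ) * (2 ^ d * (2 * A)))
        ≤ ∫⁻ x in ⋃ s : S, dyad (d := d) s.1.1 s.1.2,
            (‖F x - c‖ₑ - (j + 1 : ℕ) * (2 ^ d * (2 * A))) := by
          rw [← lintegral_indicator (measurableSet_dyad n k),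
            ← lintegral_indicator (MeasurableSet.iUnion hmeas)]
          refine lintegral_mono_ae ?_
          filter_upwards [hoff] with x hx
          by_cases hxQ : x ∈ dyad n k
          · by_cases hxS : x ∈ (⋃ s : S, dyad (d := d) s.1.1 s.1.2)
            · rw [Set.indicator_of_mem hxQ, Set.indicator_of_mem hxS]
            · rw [Set.indicator_of_mem hxQ, tsub_eq_zero_of_le]
              · exact zero_le
              · refine (hx hxQ hxS).trans (le_mul_of_one_le_left zero_le ?_)
                exact_mod_cast Nat.succ_le_succ (Nat.zero_le j)
          · rw [Set.indicator_of_notMem hxQ]; exact zero_le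
      _ = ∑' s : S, ∫⁻ x in dyad s.1.1 s.1.2,
            (‖F x - c‖ₑ - (j + 1 : ℕ) * (2 ^ d * (2 * A))) := lintegral_iUnion hmeas hdisj _
      _ ≤ ∑' s : S, A * 2⁻¹ ^ j * volume (dyad (d := d) s.1.1 s.1.2) := by
          -- One of the `j + 1` levels pays for the difference between the average on the stopping
          -- cube and `c`; the remaining `j` are left to the induction hypothesis.
          refine ENNReal.tsum_le_tsum fun s => le_trans (lintegral_mono fun x => ?_) (ih s.1.1 s.1.2)
          rw [tsub_le_iff_right]
          have e : F x - c = (F x - ⨍ y in dyad s.1.1 s.1.2, F y) +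
              ((⨍ y in dyad s.1.1 s.1.2, F y) - c) := by ring
          rw [e]
          refine (enorm_add_le _ _).trans ((add_le_add
            (le_tsub_add (a := (j : ℝ≥0∞) * (2 ^ d * (2 * A)))) (hav s)).trans (le_of_eq ?_))
          push_cast; ring
      _ = 2⁻¹ ^ (j + 1) * (2 * A * ∑' s : S, volume (dyad (d := d) s.1.1 s.1.2)) := by
          rw [ENNReal.tsum_mul_left, pow_succ,
            show (2⁻¹ : ℝ≥0∞) ^ j * 2⁻¹ * (2 * A * ∑' s : S, volume (dyad (d := d) s.1.1 s.1.2)) =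
            (2⁻¹ * 2) * (A * 2⁻¹ ^ j * ∑' s : S, volume (dyad (d := d) s.1.1 s.1.2)) by ring,
            ENNReal.inv_mul_cancel (by simp) (by simp), one_mul]
      _ ≤ 2⁻¹ ^ (j + 1) * (A * volume (dyad n k)) := by gcongr
      _ = A * 2⁻¹ ^ (j + 1) * volume (dyad n k) := by ring

/-! ### Oscillation of the truncated operators -/

lemma volume_max_le (x : Rd d) {r : ℝ} (hr : 0 ≤ r) :
    volume {w : Rd d × Rd d | max ‖x - w.1‖ ‖x - w.2‖ ≤ r} =
      ENNReal.ofReal (r ^ (2 * d)) * volume (Metric.ball (0 : Rd d × Rd d) 1) := by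
  have e : {w : Rd d × Rd d | max ‖x - w.1‖ ‖x - w.2‖ ≤ r} = Metric.closedBall (x, x) r := by
    ext w
    rw [Set.mem_ofPred_eq, Metric.mem_closedBall, Prod.dist_eq, dist_eq_norm, dist_eq_norm,
      norm_sub_rev x, norm_sub_rev x]
  have : (volume : Measure (Rd d × Rd d)).IsAddHaarMeasure :=
    inferInstanceAs ((volume : Measure (Rd d)).prod (volume : Measure (Rd d))).IsAddHaarMeasure
  rw [e, Measure.addHaar_closedBall _ _ hr]
  simp [two_mul]

/-- The constant in the bound for the oscillation of the truncated kernels. -/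
noncomputable def oscConst (d : ℕ) (cK : ℝ≥0) (ω : ℝ → ℝ) : ℝ≥0∞ :=
  (2 * diniNorm ω + cK) * (ENNReal.ofReal (2 ^ (2 * d)) * volume (Metric.ball (0 : Rd d × Rd d) 1))

/-- On the shell where `max(|x-y|,|x-z|)` is comparable to `2D·2^k`, the modulus is at most
`ω(2^(-k-1))` and the power `2d` cancels the volume of the shell. The sum over shells is the dyadic
form of the Dini integral. -/
lemma lintegral_dini_le {ω : ℝ → ℝ} (hω : IsDiniModulus ω) (x : Rd d) {D : ℝ} (hD : 0 < D) :
    ∫⁻ w in {w : Rd d × Rd d | 2 * D < max ‖x - w.1‖ ‖x - w.2‖},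
      ENNReal.ofReal (ω (D / max ‖x - w.1‖ ‖x - w.2‖) / max ‖x - w.1‖ ‖x - w.2‖ ^ (2 * d)) ≤
      2 * diniNorm ω *
        (ENNReal.ofReal (2 ^ (2 * d)) * volume (Metric.ball (0 : Rd d × Rd d) 1)) := by
  set m : Rd d × Rd d → ℝ := fun w => max ‖x - w.1‖ ‖x - w.2‖ with hm
  set V := volume (Metric.ball (0 : Rd d × Rd d) 1)
  have hmc : Continuous m := by fun_prop
  let s : ℕ → Set (Rd d × Rd d) := fun k => {w | 2 * D * 2 ^ k ≤ m w ∧ m w < 2 * D * 2 ^ (k + 1)}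
  have hs : ∀ k, MeasurableSet (s k) := fun k =>
    (isClosed_le continuous_const hmc).measurableSet.inter
      (isOpen_lt hmc continuous_const).measurableSet
  have hcover : {w : Rd d × Rd d | 2 * D < m w} ⊆ ⋃ k, s k := by
    intro w hw
    have hw' : 2 * D < m w := hw
    have h1 : 1 ≤ m w / (2 * D) := by rw [le_div_iff₀ (by positivity)]; linarith
    obtain ⟨k, hk1, hk2⟩ := exists_nat_pow_near h1 (by norm_num : (1 : ℝ) < 2)
    rw [le_div_iff₀ (by positivity)] at hk1
    rw [div_lt_iff₀ (by positivity)] at hk2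
    exact Set.mem_iUnion.2 ⟨k, by linarith, by linarith⟩
  have hshell : ∀ k, ∫⁻ w in s k, ENNReal.ofReal (ω (D / m w) / m w ^ (2 * d)) ≤
      ENNReal.ofReal (ω ((1 / 2) ^ (k + 1))) * (ENNReal.ofReal (2 ^ (2 * d)) * V) := by
    intro k
    have hr : 0 < 2 * D * 2 ^ k := by positivity
    calc ∫⁻ w in s k, ENNReal.ofReal (ω (D / m w) / m w ^ (2 * d))
        ≤ ∫⁻ w in s k, ENNReal.ofReal (ω ((1 / 2) ^ (k + 1)) / (2 * D * 2 ^ k) ^ (2 * d)) := by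
          refine setLIntegral_mono' (hs k) fun w hw => ENNReal.ofReal_le_ofReal ?_
          have hmw : 0 < m w := hr.trans_le hw.1
          refine div_le_div₀ (hω.nonneg (by positivity)) (hω.mono (Set.mem_Ici.2 (by positivity))
            (Set.mem_Ici.2 (by positivity)) ?_) (by positivity)
            (pow_le_pow_left₀ hr.le hw.1 _)
          rw [div_le_iff₀ hmw]
          have h2 : D = (1 / 2 : ℝ) ^ (k + 1) * (2 * D * 2 ^ k) := by
            rw [one_div, inv_pow, pow_succ]; field_simp
          calc D = (1 / 2 : ℝ) ^ (k + 1) * (2 * D * 2 ^ k) := h2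
            _ ≤ _ := mul_le_mul_of_nonneg_left hw.1 (by positivity)
      _ ≤ ENNReal.ofReal (ω ((1 / 2) ^ (k + 1)) / (2 * D * 2 ^ k) ^ (2 * d)) *
            (ENNReal.ofReal ((2 * D * 2 ^ (k + 1)) ^ (2 * d)) * V) := by
          rw [setLIntegral_const, ← volume_max_le x (by positivity)]
          gcongr
          exact fun w hw => hw.2.le
      _ = _ := by
          rw [← mul_assoc, ← mul_assoc, ← ENNReal.ofReal_mul (div_nonneg
            (hω.nonneg (by positivity)) (by positivity)), ← ENNReal.ofReal_mul
            (hω.nonneg (by positivity))]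
          congr 2
          rw [show 2 * D * 2 ^ (k + 1) = (2 * D * 2 ^ k) * 2 by ring, mul_pow (2 * D * 2 ^ k) 2]
          field_simp
  calc ∫⁻ w in {w : Rd d × Rd d | 2 * D < m w}, ENNReal.ofReal (ω (D / m w) / m w ^ (2 * d))
      ≤ ∫⁻ w in ⋃ k, s k, ENNReal.ofReal (ω (D / m w) / m w ^ (2 * d)) :=
        lintegral_mono_set hcover
    _ ≤ ∑' k, ∫⁻ w in s k, ENNReal.ofReal (ω (D / m w) / m w ^ (2 * d)) :=
        lintegral_iUnion_le _ _
    _ ≤ ∑' k, ENNReal.ofReal (ω ((1 / 2) ^ (k + 1))) * (ENNReal.ofReal (2 ^ (2 * d)) * V) :=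
        ENNReal.tsum_le_tsum hshell
    _ ≤ _ := by
        rw [ENNReal.tsum_mul_right]
        gcongr
        exact hω.tsum_le

section oscillation

variable {K : Rd d → Rd d → Rd d → ℂ} {cK : ℝ≥0} {ω : ℝ → ℝ}

/-- If `w` survives both truncations, regularity applies. If it survives only one, then `D < m/2`
and `m ≤ m' + D` force `m ≤ 2ε`, and the size bound `cK / ε^(2d)` is used on that region. -/
lemma norm_truncKer_sub_le (hK : IsCZKernel K cK ω) {ε : ℝ} (hε : 0 < ε) {x x' : Rd d} {D : ℝ}
    (hx : ‖x - x'‖ ≤ D) {w : Rd d × Rd d} (hw : 2 * D < max ‖x - w.1‖ ‖x - w.2‖) :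
    ‖truncKer K ε x w - truncKer K ε x' w‖ ≤
      ω (D / max ‖x - w.1‖ ‖x - w.2‖) / max ‖x - w.1‖ ‖x - w.2‖ ^ (2 * d) +
      {w : Rd d × Rd d | max ‖x - w.1‖ ‖x - w.2‖ ≤ 2 * ε}.indicator
        (fun _ => cK / ε ^ (2 * d)) w := by
  set m := max ‖x - w.1‖ ‖x - w.2‖ with hm
  set m' := max ‖x' - w.1‖ ‖x' - w.2‖ with hm'
  have hD : 0 ≤ D := (norm_nonneg _).trans hx
  have hmpos : 0 < m := by linarith
  have hdiff : ∀ u v : Rd d, (‖u‖ ≤ ‖v‖ + ‖u - v‖) := fun u v => norm_le_norm_add_norm_sub' u v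
  have hmm' : m ≤ m' + D := by
    refine max_le ?_ ?_
    · have := hdiff (x - w.1) (x' - w.1)
      rw [sub_sub_sub_cancel_right] at this
      linarith [le_max_left ‖x' - w.1‖ ‖x' - w.2‖]
    · have := hdiff (x - w.2) (x' - w.2)
      rw [sub_sub_sub_cancel_right] at this
      linarith [le_max_right ‖x' - w.1‖ ‖x' - w.2‖]
  have hind : 0 ≤ {w : Rd d × Rd d | max ‖x - w.1‖ ‖x - w.2‖ ≤ 2 * ε}.indicator
      (fun _ => (cK : ℝ) / ε ^ (2 * d)) w := Set.indicator_nonneg (fun _ _ => by positivity) _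
  have hfrac : 0 ≤ ω (D / m) / m ^ (2 * d) :=
    div_nonneg (hK.modulus.nonneg (by positivity)) (by positivity)
  by_cases h1 : ε < m
  · by_cases h2 : ε < m'
    · rw [truncKer, truncKer, Set.indicator_of_mem (by exact h1), Set.indicator_of_mem (by exact h2)]
      have hoff : ¬ (x = w.1 ∧ w.1 = w.2) := by
        rintro ⟨e1, e2⟩
        rw [hm, ← e2, ← e1] at hmpos
        simp at hmpos
      have hs : m ≤ ‖x - w.1‖ + ‖x - w.2‖ :=
        max_le (by linarith [norm_nonneg (x - w.2)]) (by linarith [norm_nonneg (x - w.1)])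
      refine (hK.regular x x' w.1 w.2 hoff (by linarith)).trans
        (le_trans ?_ (le_add_of_nonneg_right hind))
      refine div_le_div₀ (hK.modulus.nonneg (by positivity)) (hK.modulus.mono
        (Set.mem_Ici.2 (by positivity)) (Set.mem_Ici.2 (by positivity)) ?_) (by positivity)
        (pow_le_pow_left₀ hmpos.le hs _)
      exact div_le_div₀ hD hx hmpos hs
    · have h0 : truncKer K ε x' w = 0 := Set.indicator_of_notMem (by exact h2) _
      rw [h0, sub_zero, Set.indicator_of_mem (by
        show m ≤ 2 * ε
        linarith)]
      exact (norm_truncKer_le hK hε x w).trans (le_add_of_nonneg_left hfrac)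
  · have h0 : truncKer K ε x w = 0 := Set.indicator_of_notMem (by exact h1) _
    rw [h0, zero_sub, norm_neg, Set.indicator_of_mem (by
      show m ≤ 2 * ε
      linarith)]
    exact (norm_truncKer_le hK hε x' w).trans (le_add_of_nonneg_left hfrac)

/-- The region `m ≤ 2ε` has volume proportional to `ε^(2d)`, which compensates the bound `cK /
ε^(2d)` there. This makes the estimate uniform in `ε`. -/
lemma lintegral_truncKer_sub_le (hK : IsCZKernel K cK ω) {ε : ℝ} (hε : 0 < ε) {x x' : Rd d} {D : ℝ}
    (hD : 0 < D) (hx : ‖x - x'‖ ≤ D) :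
    ∫⁻ w in {w : Rd d × Rd d | 2 * D < max ‖x - w.1‖ ‖x - w.2‖},
      ‖truncKer K ε x w - truncKer K ε x' w‖ₑ ≤ oscConst d cK ω := by
  set E := {w : Rd d × Rd d | 2 * D < max ‖x - w.1‖ ‖x - w.2‖} with hE
  set N := {w : Rd d × Rd d | max ‖x - w.1‖ ‖x - w.2‖ ≤ 2 * ε} with hN
  have hEm : MeasurableSet E := measurableSet_far _ _
  have hNm : MeasurableSet N := (isClosed_le (by fun_prop) continuous_const).measurableSet
  calc ∫⁻ w in E, ‖truncKer K ε x w - truncKer K ε x' w‖ₑ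
      ≤ ∫⁻ w in E, (ENNReal.ofReal
          (ω (D / max ‖x - w.1‖ ‖x - w.2‖) / max ‖x - w.1‖ ‖x - w.2‖ ^ (2 * d)) +
          N.indicator (fun _ => ENNReal.ofReal (cK / ε ^ (2 * d))) w) := by
        refine setLIntegral_mono' hEm fun w hw => ?_
        rw [← ofReal_norm]
        refine (ENNReal.ofReal_le_ofReal (norm_truncKer_sub_le hK hε hx hw)).trans
          (ENNReal.ofReal_add_le.trans (le_of_eq ?_))
        congr 1
        by_cases hw' : w ∈ N
        · rw [Set.indicator_of_mem hw', Set.indicator_of_mem hw']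
        · rw [Set.indicator_of_notMem hw', Set.indicator_of_notMem hw', ENNReal.ofReal_zero]
    _ = (∫⁻ w in E, ENNReal.ofReal
          (ω (D / max ‖x - w.1‖ ‖x - w.2‖) / max ‖x - w.1‖ ‖x - w.2‖ ^ (2 * d))) +
          ∫⁻ w in E, N.indicator (fun _ => ENNReal.ofReal (cK / ε ^ (2 * d))) w :=
        lintegral_add_right _ (measurable_const.indicator hNm)
    _ ≤ 2 * diniNorm ω * (ENNReal.ofReal (2 ^ (2 * d)) *
          volume (Metric.ball (0 : Rd d × Rd d) 1)) +
        cK * (ENNReal.ofReal (2 ^ (2 * d)) * volume (Metric.ball (0 : Rd d × Rd d) 1)) := by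
        refine add_le_add (lintegral_dini_le hK.modulus x hD) ?_
        refine (setLIntegral_le_lintegral _ _).trans (le_of_eq ?_)
        rw [lintegral_indicator hNm, setLIntegral_const, hN, volume_max_le x (by positivity),
          ← mul_assoc, ← mul_assoc, ← ENNReal.ofReal_mul (by positivity)]
        congr 1
        rw [← ENNReal.ofReal_coe_nnreal, ← ENNReal.ofReal_mul (by positivity)]
        congr 1
        rw [mul_pow]
        field_simp
    _ = oscConst d cK ω := by rw [oscConst, add_mul]

lemma oscConst_ne_top {ω : ℝ → ℝ} (hω : IsDiniModulus ω) : oscConst d cK ω ≠ ⊤ := by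
  refine ENNReal.mul_ne_top (ENNReal.add_ne_top.2 ⟨ENNReal.mul_ne_top (by simp) hω.dini.ne,
    ENNReal.coe_ne_top⟩) (ENNReal.mul_ne_top ENNReal.ofReal_ne_top measure_ball_lt_top.ne)

end oscillation

section uniformIntegrability

variable {K : Rd d → Rd d → Rd d → ℂ} {cK : ℝ≥0} {ω : ℝ → ℝ} {p q : ℝ} {B : ℝ≥0}

lemma eLpNorm_indicator_le {f : Rd d → ℂ} (hf : ∀ x, ‖f x‖ ≤ 1) {s : Set (Rd d)}
    (hs : MeasurableSet s) (hp : 0 < p) :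
    eLpNorm (s.indicator f) (ENNReal.ofReal p) volume ≤ volume s ^ (1 / p) := by
  have h : eLpNorm (s.indicator fun _ : Rd d => (1 : ℂ)) (ENNReal.ofReal p) volume =
      volume s ^ (1 / p) := by
    rw [eLpNorm_indicator_const hs (by simpa using hp) ENNReal.ofReal_ne_top,
      ENNReal.toReal_ofReal hp.le]
    simp
  rw [← h]
  refine eLpNorm_mono fun x => ?_
  by_cases hx : x ∈ s
  · simpa [hx] using hf x
  · simp [hx]

/-- `far` integrates over the pairs `(y,z)` that do not both lie in `b`. Since `|x - x₀| ≤ D`, such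
a pair satisfies `max(|x-y|,|x-z|) > 2D`, where the kernel difference is integrable with a bound
independent of `ε` and `D`. -/
lemma enorm_far_sub_le (hK : IsCZKernel K cK ω) {ε : ℝ} (hε : 0 < ε) {f g : Rd d → ℂ}
    (hf : MemBddCpt f) (hg : MemBddCpt g) (hf1 : ∀ x, ‖f x‖ ≤ 1) (hg1 : ∀ x, ‖g x‖ ≤ 1)
    {x x₀ : Rd d} {D : ℝ} (hD : 0 < D) (hx : ‖x - x₀‖ ≤ D) :
    let b := Metric.closedBall x₀ (3 * D)
    let far := fun x => truncation K ε f g x - truncation K ε (b.indicator f) (b.indicator g) x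
    ‖far x - far x₀‖ₑ ≤ oscConst d cK ω := by
  intro b far
  have hb : MeasurableSet b := measurableSet_closedBall
  have hi1 := integrable_truncKer_mul hK hε hf hg
  have hi2 := integrable_truncKer_mul hK hε (hf.indicator hb) (hg.indicator hb)
  let h : Rd d × Rd d → ℂ := fun w => f w.1 * g w.2 - b.indicator f w.1 * b.indicator g w.2
  have e : ∀ x, far x = ∫ w, truncKer K ε x w * h w := by
    intro x
    simp only [far]
    rw [truncation_eq, truncation_eq, ← integral_sub (hi1 x) (hi2 x)]
    congr 1; funext w; simp only [h]; ring
  have hih : ∀ x, Integrable (fun w => truncKer K ε x w * h w) volume := by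
    intro x
    refine ((hi1 x).sub (hi2 x)).congr (Eventually.of_forall fun w => ?_)
    simp only [h, Pi.sub_apply]; ring
  rw [e, e, ← integral_sub (hih x) (hih x₀)]
  refine (enorm_integral_le_lintegral_enorm _).trans ?_
  refine le_trans ?_ (lintegral_truncKer_sub_le hK hε hD hx)
  rw [← lintegral_indicator (measurableSet_far _ _)]
  refine lintegral_mono fun w => ?_
  rw [← sub_mul, enorm_mul]
  by_cases hw : w ∈ {w : Rd d × Rd d | 2 * D < max ‖x - w.1‖ ‖x - w.2‖}
  · rw [Set.indicator_of_mem hw]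
    refine mul_le_of_le_one_right' ?_
    rw [← ofReal_norm]
    refine ENNReal.ofReal_le_one.2 ?_
    simp only [h]
    by_cases hb2 : w.1 ∈ b ∧ w.2 ∈ b
    · simp [hb2.1, hb2.2]
    · have : b.indicator f w.1 * b.indicator g w.2 = 0 := by
        rw [not_and_or] at hb2
        rcases hb2 with hb2 | hb2 <;> simp [hb2]
      rw [this, sub_zero, norm_mul]
      exact mul_le_one₀ (hf1 _) (norm_nonneg _) (hg1 _)
  · rw [Set.indicator_of_notMem hw]
    have hmem : ∀ v : Rd d, ‖x - v‖ ≤ 2 * D → v ∈ b := by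
      intro v hv
      rw [Metric.mem_closedBall, dist_eq_norm, norm_sub_rev]
      have := norm_le_norm_add_norm_sub' (x₀ - v) (x - v)
      rw [sub_sub_sub_cancel_right, norm_sub_rev x₀ x] at this
      linarith
    have hw' : max ‖x - w.1‖ ‖x - w.2‖ ≤ 2 * D := not_lt.1 hw
    have h1 := hmem w.1 ((le_max_left _ _).trans hw')
    have h2 := hmem w.2 ((le_max_right _ _).trans hw')
    simp [h, h1, h2]

/-! ### Uniform `BMO` bounds and uniform integrability of the truncations. -/

/-- The truncated operators map bounded functions into `BMO`, uniformly. -/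
theorem TruncationsBoundedBy.exists_oscillation_le (hd : 1 ≤ d) (hK : IsCZKernel K cK ω)
    (hB : TruncationsBoundedBy K p q B) (hp : 1 < p) (hq : 1 < q) (hσ : 1 ≤ sigma p q)
    {f g : Rd d → ℂ} (hf : MemBddCpt f) (hg : MemBddCpt g) (hf1 : ∀ x, ‖f x‖ ≤ 1)
    (hg1 : ∀ x, ‖g x‖ ≤ 1) :
    ∃ A : ℝ≥0, ∀ ε, 0 < ε → ∀ n k, ∃ c : ℂ,
      ∫⁻ x in dyad n k, ‖truncation K ε f g x - c‖ₑ ≤ A * volume (dyad n k) := by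
  -- The ratio of the volume of the ball of radius `3·d·ℓ(Q)` to that of the cube `Q`.
  set c₁ : ℝ≥0∞ := ENNReal.ofReal ((3 * d) ^ d) * volume (Metric.ball (0 : Rd d) 1) with hc₁
  have hc₁t : c₁ ≠ ⊤ := ENNReal.mul_ne_top ENNReal.ofReal_ne_top measure_ball_lt_top.ne
  set A : ℝ≥0∞ := B * c₁ ^ (1 / p) * c₁ ^ (1 / q) + oscConst d cK ω with hA
  have hp' : (0 : ℝ) ≤ 1 / p := by positivity
  have hq' : (0 : ℝ) ≤ 1 / q := by positivity
  have hAt : A ≠ ⊤ := ENNReal.add_ne_top.2 ⟨ENNReal.mul_ne_top (ENNReal.mul_ne_top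
    ENNReal.coe_ne_top (ENNReal.rpow_ne_top_of_nonneg hp' hc₁t))
    (ENNReal.rpow_ne_top_of_nonneg hq' hc₁t), oscConst_ne_top hK.modulus⟩
  refine ⟨A.toNNReal, fun ε hε n k => ?_⟩
  rw [ENNReal.coe_toNNReal hAt]
  have hd0 : (0 : ℝ) < d := by exact_mod_cast hd
  set l : ℝ := (1 / 2) ^ n with hl
  have hl0 : 0 < l := by positivity
  set x₀ : Rd d := WithLp.toLp 2 fun i => (k i : ℝ) * (1 / 2) ^ n with hx₀
  have hx₀m : x₀ ∈ dyad n k := fun i => ⟨le_rfl, by simp only [hx₀]; linarith⟩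
  set D : ℝ := d * l with hD
  have hD0 : 0 < D := by positivity
  set b := Metric.closedBall x₀ (3 * D) with hb
  have hbm : MeasurableSet b := measurableSet_closedBall
  set v := volume (dyad n k : Set (Rd d)) with hv
  have hv0 : v ≠ 0 := volume_dyad_ne_zero n k
  have hvt : v ≠ ⊤ := volume_dyad_ne_top n k
  have hvb : volume b = c₁ * v := by
    rw [hb, Measure.addHaar_closedBall _ _ (by positivity), hc₁, hv, volume_dyad,
      ← ENNReal.ofReal_pow (by positivity), mul_right_comm, ← ENNReal.ofReal_mul (by positivity)]
    congr 2
    simp only [finrank_euclideanSpace, Fintype.card_fin, hD]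
    rw [← mul_pow]; congr 1; ring
  set far := fun x => truncation K ε f g x - truncation K ε (b.indicator f) (b.indicator g) x
    with hfar
  refine ⟨far x₀, ?_⟩
  -- The local part only needs the assumed bound: the powers `1/p + 1/q` of the volume from the
  -- arguments and `1 - 1/σ` from Hölder's inequality on the cube add up to `1`.
  have hloc : ∫⁻ x in dyad n k, ‖truncation K ε (b.indicator f) (b.indicator g) x‖ₑ ≤
      B * c₁ ^ (1 / p) * c₁ ^ (1 / q) * v := by
    refine (hB.setLIntegral_le hK hp hq hσ hε (hf.indicator hbm) (hg.indicator hbm) _).trans ?_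
    calc _ ≤ B * volume b ^ (1 / p) * volume b ^ (1 / q) * v ^ (1 - 1 / sigma p q) := by
          gcongr
          · exact eLpNorm_indicator_le hf1 hbm (by linarith)
          · exact eLpNorm_indicator_le hg1 hbm (by linarith)
      _ = B * c₁ ^ (1 / p) * c₁ ^ (1 / q) * (v ^ (1 / p) * v ^ (1 / q) *
            v ^ (1 - 1 / sigma p q)) := by
          rw [hvb, ENNReal.mul_rpow_of_nonneg _ _ hp', ENNReal.mul_rpow_of_nonneg _ _ hq']
          ring
      _ = B * c₁ ^ (1 / p) * c₁ ^ (1 / q) * v := by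
          rw [← ENNReal.rpow_add _ _ hv0 hvt, ← ENNReal.rpow_add _ _ hv0 hvt]
          have : 1 / p + 1 / q + (1 - 1 / sigma p q) = 1 := by rw [sigma]; simp
          rw [this, ENNReal.rpow_one]
  calc ∫⁻ x in dyad n k, ‖truncation K ε f g x - far x₀‖ₑ
      ≤ ∫⁻ x in dyad n k, (‖truncation K ε (b.indicator f) (b.indicator g) x‖ₑ +
          oscConst d cK ω) := by
        refine setLIntegral_mono' (measurableSet_dyad n k) fun x hx => ?_
        have e : truncation K ε f g x - far x₀ =
            truncation K ε (b.indicator f) (b.indicator g) x + (far x - far x₀) := by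
          simp only [hfar]; ring
        rw [e]
        refine (enorm_add_le _ _).trans (add_le_add le_rfl ?_)
        exact enorm_far_sub_le hK hε hf hg hf1 hg1 hD0 (norm_sub_le_of_mem_dyad hx hx₀m)
    _ = (∫⁻ x in dyad n k, ‖truncation K ε (b.indicator f) (b.indicator g) x‖ₑ) +
          oscConst d cK ω * v := by
        rw [lintegral_add_right _ measurable_const, setLIntegral_const]
    _ ≤ A * v := by rw [hA, add_mul]; gcongr

lemma exists_finset_dyad_cover {s : Set (Rd d)} (hs : Bornology.IsBounded s) :
    ∃ J : Finset (Fin d → ℤ), s ⊆ ⋃ k ∈ J, dyad 0 k := by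
  obtain ⟨R, hR⟩ := hs.exists_norm_le
  obtain ⟨N, hN⟩ := exists_int_gt (R + 1)
  refine ⟨Fintype.piFinset fun _ => Finset.Icc (-N) N, fun x hx => ?_⟩
  refine Set.mem_iUnion₂.2 ⟨dyadIdx 0 x, Fintype.mem_piFinset.2 fun i => ?_, mem_dyad_dyadIdx 0 x⟩
  have h1 := abs_le.1 ((abs_coord_le_norm x i).trans (hR x hx))
  rw [Finset.mem_Icc, dyadIdx, pow_zero, mul_one]
  constructor
  · rw [Int.le_floor]; push_cast; linarith
  · have : (⌊x i⌋ : ℝ) ≤ N := (Int.floor_le _).trans (by linarith)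
    exact_mod_cast this

/-- Uniform integrability in `ε`, which an `L^1` bound could not give. The height `t` is found by
covering `s` by unit dyadic cubes and applying John–Nirenberg on each; only the averages over these
cubes use the norm bound for `T_ε`. -/
theorem TruncationsBoundedBy.exists_tsub_le (hd : 1 ≤ d) (hK : IsCZKernel K cK ω)
    (hB : TruncationsBoundedBy K p q B) (hp : 1 < p) (hq : 1 < q) (hσ : 1 ≤ sigma p q)
    {f g : Rd d → ℂ} (hf : MemBddCpt f) (hg : MemBddCpt g) (hf1 : ∀ x, ‖f x‖ ≤ 1)
    (hg1 : ∀ x, ‖g x‖ ≤ 1) {s : Set (Rd d)} (hs : Bornology.IsBounded s) {η : ℝ≥0∞} (hη : 0 < η) :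
    ∃ t : ℝ≥0, ∀ ε, 0 < ε → ∫⁻ x in s, (‖truncation K ε f g x‖ₑ - t) ≤ η := by
  obtain ⟨A, hA⟩ := hB.exists_oscillation_le hd hK hp hq hσ hf hg hf1 hg1
  obtain ⟨J, hJ⟩ := exists_finset_dyad_cover hs
  set C : ℝ≥0∞ := B * eLpNorm f (ENNReal.ofReal p) volume * eLpNorm g (ENNReal.ofReal q) volume
    with hC
  have hCt : C ≠ ⊤ := ENNReal.mul_ne_top (ENNReal.mul_ne_top ENNReal.coe_ne_top
    (hf.memLp _).2.ne) (hg.memLp _).2.ne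
  have hlim : Tendsto (fun j : ℕ => (J.card : ℝ≥0∞) * (((2 * A : ℝ≥0) : ℝ≥0∞) * 2⁻¹ ^ j)) atTop
      (𝓝 0) := by
    have h1 := ENNReal.tendsto_pow_atTop_nhds_zero_of_lt_one (r := 2⁻¹) (by simp)
    have h2 := ENNReal.Tendsto.const_mul (a := ((2 * A : ℝ≥0) : ℝ≥0∞)) h1
      (Or.inr ENNReal.coe_ne_top)
    have h3 := ENNReal.Tendsto.const_mul (a := (J.card : ℝ≥0∞)) h2
      (Or.inr (ENNReal.natCast_ne_top _))
    simpa using h3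
  -- `j` levels of John–Nirenberg bring the total excess over the cubes in `J` below `η`. The
  -- constant is `2 * A` because the oscillation about the mean is at most twice that about another
  -- constant. The final height is the height `t₀` of these levels plus the bound `C` for the
  -- averages.
  obtain ⟨j, hj⟩ := (hlim.eventually (gt_mem_nhds hη)).exists
  set t₀ : ℝ≥0∞ := j * (2 ^ d * (2 * (2 * A : ℝ≥0))) with ht₀
  have ht₀t : t₀ ≠ ⊤ := by
    rw [ht₀]
    exact ENNReal.mul_ne_top (ENNReal.natCast_ne_top _) (ENNReal.mul_ne_top (by simp)
      (ENNReal.mul_ne_top (by simp) ENNReal.coe_ne_top))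
  refine ⟨(t₀ + C).toNNReal, fun ε hε => ?_⟩
  rw [ENNReal.coe_toNNReal (ENNReal.add_ne_top.2 ⟨ht₀t, hCt⟩)]
  obtain ⟨M, hM⟩ := exists_norm_truncation_le hK hε hf hg
  have hmeas := aestronglyMeasurable_truncation hK hε hf.1 hg.1
  have hint : ∀ s : Set (Rd d), volume s ≠ ⊤ → IntegrableOn (truncation K ε f g) s volume :=
    fun s hs => Measure.integrableOn_of_bounded hs hmeas (Eventually.of_forall hM)
  have hloc : LocallyIntegrable (truncation K ε f g) volume :=
    locallyIntegrable_iff.2 fun k hk => hint k hk.measure_lt_top.ne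
  have hosc : ∀ n k, ∫⁻ x in dyad n k, ‖truncation K ε f g x -
      ⨍ y in dyad n k, truncation K ε f g y‖ₑ ≤ (2 * A : ℝ≥0) * volume (dyad n k) := by
    intro n k
    obtain ⟨c, hc⟩ := hA ε hε n k
    refine (lintegral_sub_average_le (hint _ (volume_dyad_ne_top n k)) (volume_dyad_ne_zero n k)
      (volume_dyad_ne_top n k) c).trans ?_
    rw [ENNReal.coe_mul, mul_assoc]
    exact mul_le_mul_right hc _
  have hJN := lintegral_dyad_tsub_le hloc hosc j 0
  have hv : ∀ k : Fin d → ℤ, volume (dyad 0 k : Set (Rd d)) = 1 := fun k => by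
    rw [volume_dyad]; simp
  have hone : ∀ k : Fin d → ℤ, ∫⁻ x in dyad 0 k, (‖truncation K ε f g x‖ₑ - (t₀ + C)) ≤
      (2 * A : ℝ≥0) * 2⁻¹ ^ j := by
    intro k
    have h1 := hJN k
    rw [hv, mul_one] at h1
    refine le_trans (lintegral_mono fun x => ?_) h1
    have hav : ‖⨍ y in dyad 0 k, truncation K ε f g y‖ₑ ≤ C := by
      have h2 := enorm_average_sub_mul_le (hint _ (volume_dyad_ne_top 0 k))
        (volume_dyad_ne_zero 0 k) (volume_dyad_ne_top 0 k) 0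
      simp only [sub_zero, hv, mul_one] at h2
      refine h2.trans ((hB.setLIntegral_le hK hp hq hσ hε hf hg _).trans (le_of_eq ?_))
      rw [hv, ENNReal.one_rpow, mul_one]
    rw [tsub_le_iff_right]
    set a := ⨍ y in dyad 0 k, truncation K ε f g y
    calc ‖truncation K ε f g x‖ₑ = ‖(truncation K ε f g x - a) + a‖ₑ := by rw [sub_add_cancel]
      _ ≤ ‖truncation K ε f g x - a‖ₑ + ‖a‖ₑ := enorm_add_le _ _
      _ ≤ (‖truncation K ε f g x - a‖ₑ - t₀ + t₀) + C := by
          gcongr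
          exact le_tsub_add
      _ = _ := by rw [add_assoc]
  calc ∫⁻ x in s, (‖truncation K ε f g x‖ₑ - (t₀ + C))
      ≤ ∫⁻ x in ⋃ k ∈ J, dyad 0 k, (‖truncation K ε f g x‖ₑ - (t₀ + C)) := lintegral_mono_set hJ
    _ = ∑ k ∈ J, ∫⁻ x in dyad 0 k, (‖truncation K ε f g x‖ₑ - (t₀ + C)) := by
        refine lintegral_biUnion_finset (fun k _ k' _ hkk => ?_)
          (fun k _ => measurableSet_dyad 0 k) _
        exact Set.disjoint_left.2 fun y hy hy' =>
          hkk ((mem_dyad_iff.1 hy).symm.trans (mem_dyad_iff.1 hy'))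
    _ ≤ ∑ _k ∈ J, ((2 * A : ℝ≥0) : ℝ≥0∞) * 2⁻¹ ^ j := Finset.sum_le_sum fun k _ => hone k
    _ ≤ η := by
        rw [Finset.sum_const, nsmul_eq_mul]
        exact hj.le

end uniformIntegrability

/-! ### Extension of the operator to bounded functions of bounded support -/

lemma lintegral_enorm_le_of_tendsto {α : Type*} [MeasurableSpace α] {μ : Measure α}
    {Y : ℕ → α → ℂ} {X : α → ℂ} {a : ℝ≥0∞} (hY : ∀ j, AEStronglyMeasurable (Y j) μ)
    (hlim : ∀ᵐ x ∂μ, Tendsto (fun j => Y j x) atTop (𝓝 (X x))) (ha : ∀ j, ∫⁻ x, ‖Y j x‖ₑ ∂μ ≤ a) :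
    ∫⁻ x, ‖X x‖ₑ ∂μ ≤ a := by
  calc ∫⁻ x, ‖X x‖ₑ ∂μ ≤ ∫⁻ x, liminf (fun j => ‖Y j x‖ₑ) atTop ∂μ := by
        refine lintegral_mono_ae ?_
        filter_upwards [hlim] with x hx
        exact (((continuous_enorm.tendsto _).comp hx).liminf_eq).ge
    _ ≤ liminf (fun j => ∫⁻ x, ‖Y j x‖ₑ ∂μ) atTop := lintegral_liminf_le' fun j => (hY j).enorm
    _ ≤ a := (liminf_le_liminf (Eventually.of_forall ha)).trans (by simp)

/-- Cutting `F` at height `t` gives `|w||F| ≤ M(|F| - t)₊ + t|w|`. The first term is small uniformly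
in `j` by uniform integrability, and the second tends to zero by dominated convergence and does not
involve `j`. -/
lemma tendsto_iSup_lintegral_mul {ι κ : Type*} {l : Filter ι} [l.IsCountablyGenerated]
    {s : Set (Rd d)} (hs : volume s ≠ ⊤) {F : κ → Rd d → ℂ}
    (hF : ∀ η : ℝ≥0∞, 0 < η → ∃ t : ℝ≥0, ∀ j, ∫⁻ x in s, (‖F j x‖ₑ - t) ≤ η)
    {w : ι → Rd d → ℂ} {M : ℝ≥0} (hw : ∀ i, AEStronglyMeasurable (w i) volume)
    (hM : ∀ i, ∀ᵐ x ∂(volume : Measure (Rd d)), ‖w i x‖ₑ ≤ M)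
    (hlim : ∀ᵐ x ∂(volume : Measure (Rd d)), Tendsto (fun i => w i x) l (𝓝 0)) :
    Tendsto (fun i => ⨆ j, ∫⁻ x in s, ‖w i x‖ₑ * ‖F j x‖ₑ) l (𝓝 0) := by
  have hw0 : Tendsto (fun i => ∫⁻ x in s, ‖w i x‖ₑ) l (𝓝 0) := by
    have := tendsto_lintegral_of_dominated (μ := volume.restrict s) (l := l)
      (F := fun i x => ‖w i x‖ₑ) (f := fun _ => 0) (fun _ => (M : ℝ≥0∞))
      (fun i => (hw i).restrict.enorm) (fun i => ae_restrict_of_ae (hM i))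
      (by rw [setLIntegral_const]; exact ENNReal.mul_ne_top ENNReal.coe_ne_top hs)
      (ae_restrict_of_ae (by
        filter_upwards [hlim] with x hx
        simpa [Function.comp_def] using (continuous_enorm.tendsto (0 : ℂ)).comp hx))
    simpa using this
  rw [ENNReal.tendsto_nhds_zero]
  intro η hη
  have hη2 : 0 < η / 2 := ENNReal.half_pos hη.ne'
  obtain ⟨t, ht⟩ := hF (η / 2 / (M + 1)) (ENNReal.div_pos hη2.ne' (by simp))
  have h2 : Tendsto (fun i => (t : ℝ≥0∞) * ∫⁻ x in s, ‖w i x‖ₑ) l (𝓝 0) := by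
    simpa using ENNReal.Tendsto.const_mul (a := (t : ℝ≥0∞)) hw0 (Or.inr ENNReal.coe_ne_top)
  filter_upwards [(ENNReal.tendsto_nhds_zero.1 h2) _ hη2] with i hi
  refine iSup_le fun j => ?_
  calc ∫⁻ x in s, ‖w i x‖ₑ * ‖F j x‖ₑ
      ≤ ∫⁻ x in s, (M * (‖F j x‖ₑ - t) + t * ‖w i x‖ₑ) := by
        refine lintegral_mono_ae (ae_restrict_of_ae ?_)
        filter_upwards [hM i] with x hx
        calc ‖w i x‖ₑ * ‖F j x‖ₑ ≤ ‖w i x‖ₑ * (‖F j x‖ₑ - t + t) := by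
              gcongr; exact le_tsub_add
          _ = ‖w i x‖ₑ * (‖F j x‖ₑ - t) + t * ‖w i x‖ₑ := by ring
          _ ≤ _ := by gcongr
    _ = M * (∫⁻ x in s, (‖F j x‖ₑ - t)) + t * ∫⁻ x in s, ‖w i x‖ₑ := by
        rw [lintegral_add_right' _ ((hw i).restrict.enorm.const_mul _),
          lintegral_const_mul' _ _ ENNReal.coe_ne_top,
          lintegral_const_mul' _ _ ENNReal.coe_ne_top]
    _ ≤ (M + 1) * (η / 2 / (M + 1)) + η / 2 := by
        gcongr
        · exact le_self_add
        · exact ht j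
    _ ≤ η := by
        rw [ENNReal.mul_div_cancel (by simp) (by simp), ENNReal.add_halves]

lemma UnifBdd.exists_eLpNorm_le {ι : Type*} {M : ℝ} {w : ι → Rd d → ℂ} (hw : UnifBdd M w) (p : ℝ) :
    ∃ C : ℝ≥0, ∀ i, eLpNorm (w i) (ENNReal.ofReal p) volume ≤ C := by
  set g : Rd d → ℂ := (Metric.closedBall (0 : Rd d) M).indicator fun _ => (M : ℂ) with hg
  have h1 : MemLp g (ENNReal.ofReal p) (volume : Measure (Rd d)) :=
    memLp_indicator_const _ measurableSet_closedBall _ (Or.inr measure_closedBall_lt_top.ne)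
  refine ⟨(eLpNorm g (ENNReal.ofReal p) volume).toNNReal, fun i => ?_⟩
  rw [ENNReal.coe_toNNReal h1.2.ne]
  refine eLpNorm_mono_ae ?_
  filter_upwards [(hw i).2] with x hx
  by_cases hb : x ∈ Metric.closedBall (0 : Rd d) M
  · rw [hg, Set.indicator_of_mem hb]
    simpa using hx.1.trans (le_abs_self M)
  · rw [hx.2 (by simpa using hb)]; simp

lemma exists_cubeSpan_eq_one (R : ℝ) : ∃ u : cubeSpan d,
    (∀ x, ‖(u : Rd d → ℂ) x‖ ≤ 1) ∧ ∀ x ∈ Metric.ball (0 : Rd d) R, (u : Rd d → ℂ) x = 1 := by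
  refine ⟨cubeInd (WithLp.toLp 2 fun _ => -(|R| + 1)) (2 * (|R| + 1)) (by positivity),
    fun x => ?_, fun x hx => ?_⟩
  · rw [coe_cubeInd]
    exact (norm_indicator_le_norm_self _ _).trans (by simp)
  · rw [coe_cubeInd]
    refine Set.indicator_of_mem (mem_centeredCube (l := |R| + 1) ?_) _
    have : ‖x‖ < R := by simpa using hx
    linarith [le_abs_self R]

section extension

variable {K : Rd d → Rd d → Rd d → ℂ} {cK : ℝ≥0} {ω : ℝ → ℝ} {p q : ℝ} {B : ℝ≥0} {T : BilinOp d}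

lemma tendsto_of_eventually_eq {Y : ℝ → ℂ} {X : ℂ}
    (h : ∃ δ > 0, ∀ ε, 0 < ε → ε < δ → X = Y ε) :
    Tendsto (fun j : ℕ => Y (1 / ((j : ℝ) + 1))) atTop (𝓝 X) := by
  obtain ⟨δ, hδ, h⟩ := h
  refine tendsto_const_nhds.congr' ?_
  filter_upwards [tendsto_one_div_add_atTop_nhds_zero_nat.eventually (gt_mem_nhds hδ)] with j hj
  exact h _ (by positivity) hj

/-- A single integrable function is uniformly integrable; the index type `Unit` presents it as a
family for `tendsto_iSup_lintegral_mul`. -/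
lemma exists_lintegral_tsub_le_of_integrable {s : Set (Rd d)} {F : Rd d → ℂ}
    (hF : IntegrableOn F s volume) {η : ℝ≥0∞} (hη : 0 < η) :
    ∃ t : ℝ≥0, ∀ _ : Unit, ∫⁻ x in s, (‖F x‖ₑ - t) ≤ η := by
  have h : Tendsto (fun n : ℕ => ∫⁻ x in s, (‖F x‖ₑ - ((n : ℝ≥0) : ℝ≥0∞))) atTop
      (𝓝 (∫⁻ _ in s, 0)) := by
    refine tendsto_lintegral_of_dominated (fun x => ‖F x‖ₑ) (fun n => hF.1.enorm.sub_const _)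
      (fun n => Eventually.of_forall fun x => tsub_le_self) hF.2.ne
      (Eventually.of_forall fun x => ?_)
    refine tendsto_const_nhds.congr' ?_
    obtain ⟨m, hm⟩ := exists_nat_ge ‖F x‖₊
    filter_upwards [eventually_ge_atTop m] with n hn
    refine (tsub_eq_zero_of_le ?_).symm
    rw [enorm_eq_nnnorm]
    exact_mod_cast hm.trans (by exact_mod_cast hn)
  rw [lintegral_zero] at h
  obtain ⟨n, hn⟩ := (h.eventually (gt_mem_nhds hη)).exists
  exact ⟨n, fun _ => hn.le⟩

lemma HasKernel.integrableOn_ball (hT : HasKernel T K) (f g : cubeSpan d) (R : ℝ) :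
    IntegrableOn (T f g : Rd d → ℂ) (Metric.ball 0 R) volume :=
  ((hT.locallyIntegrable f g).integrableOn_isCompact (isCompact_closedBall 0 R)).mono_set
    Metric.ball_subset_closedBall

/-- On the ball `u = 1`, so `T(f,g) - f g T(u,u)` is the limit of `T_ε(f,g) - f g T_ε(u,u)`, and
Fatou's lemma applies. In the resulting bound `T` acts only on the fixed pair `(u,u)`, and `f` and
`g` enter through norms and through their product. -/
lemma HasKernel.lintegral_le (hK : IsCZKernel K cK ω) (hT : HasKernel T K)
    (hB : TruncationsBoundedBy K p q B) (hp : 1 < p) (hq : 1 < q) (hσ : 1 ≤ sigma p q)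
    {R : ℝ} {u : cubeSpan d} (hu : ∀ x ∈ Metric.ball (0 : Rd d) R, (u : Rd d → ℂ) x = 1)
    (f g : cubeSpan d) :
    ∫⁻ x in Metric.ball 0 R, ‖(T f g : Rd d → ℂ) x‖ₑ ≤
      (∫⁻ x in Metric.ball 0 R, ‖(f : Rd d → ℂ) x * (g : Rd d → ℂ) x‖ₑ *
        ‖(T u u : Rd d → ℂ) x‖ₑ) +
      (B * eLpNorm (f : Rd d → ℂ) (ENNReal.ofReal p) volume *
        eLpNorm (g : Rd d → ℂ) (ENNReal.ofReal q) volume *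
        volume (Metric.ball (0 : Rd d) R) ^ (1 - 1 / sigma p q) +
      ⨆ ε : Set.Ioi (0 : ℝ), ∫⁻ x in Metric.ball 0 R,
        ‖(f : Rd d → ℂ) x * (g : Rd d → ℂ) x‖ₑ * ‖truncation K ε u u x‖ₑ) := by
  have hm : ∀ f : cubeSpan d, AEStronglyMeasurable (f : Rd d → ℂ) volume := fun f =>
    (measurable_cubeSpan f).aestronglyMeasurable
  have hmt : ∀ ε, 0 < ε → ∀ f g : cubeSpan d, AEStronglyMeasurable (truncation K ε f g) volume :=
    fun ε hε f g => aestronglyMeasurable_truncation hK hε (hm f) (hm g)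
  have h1 : ∫⁻ x in Metric.ball 0 R, ‖(T f g : Rd d → ℂ) x -
      (f : Rd d → ℂ) x * (g : Rd d → ℂ) x * (T u u : Rd d → ℂ) x‖ₑ ≤
      (B * eLpNorm (f : Rd d → ℂ) (ENNReal.ofReal p) volume *
        eLpNorm (g : Rd d → ℂ) (ENNReal.ofReal q) volume *
        volume (Metric.ball (0 : Rd d) R) ^ (1 - 1 / sigma p q) +
      ⨆ ε : Set.Ioi (0 : ℝ), ∫⁻ x in Metric.ball 0 R,
        ‖(f : Rd d → ℂ) x * (g : Rd d → ℂ) x‖ₑ * ‖truncation K ε u u x‖ₑ) := by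
    refine lintegral_enorm_le_of_tendsto (Y := fun (j : ℕ) x =>
      truncation K (1 / ((j : ℝ) + 1)) f g x - (f : Rd d → ℂ) x * (g : Rd d → ℂ) x *
        truncation K (1 / ((j : ℝ) + 1)) u u x) (fun j => ?_) ?_ (fun j => ?_)
    · have hj : (0 : ℝ) < 1 / ((j : ℝ) + 1) := by positivity
      exact ((hmt _ hj f g).sub (((hm f).mul (hm g)).mul (hmt _ hj u u))).restrict
    · filter_upwards [ae_restrict_of_ae (hT.ae_sub_eq_truncation_sub hK f g u),
        ae_restrict_mem measurableSet_ball] with x hx hxb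
      exact tendsto_of_eventually_eq (hx (hu x hxb))
    · have hj : (0 : ℝ) < 1 / ((j : ℝ) + 1) := by positivity
      calc _ ≤ ∫⁻ x in Metric.ball 0 R, (‖truncation K (1 / ((j : ℝ) + 1)) f g x‖ₑ +
            ‖(f : Rd d → ℂ) x * (g : Rd d → ℂ) x‖ₑ *
              ‖truncation K (1 / ((j : ℝ) + 1)) u u x‖ₑ) := by
            refine lintegral_mono fun x => ?_
            rw [← enorm_mul]
            exact enorm_sub_le
        _ = _ := lintegral_add_left' (hmt _ hj f g).restrict.enorm _
        _ ≤ _ := by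
            refine add_le_add (hB.setLIntegral_le hK hp hq hσ hj (memBddCpt_cubeSpan f)
              (memBddCpt_cubeSpan g) _) ?_
            exact le_iSup (fun ε : Set.Ioi (0 : ℝ) => ∫⁻ x in Metric.ball 0 R,
              ‖(f : Rd d → ℂ) x * (g : Rd d → ℂ) x‖ₑ * ‖truncation K ε u u x‖ₑ)
              ⟨1 / ((j : ℝ) + 1), hj⟩
  calc ∫⁻ x in Metric.ball 0 R, ‖(T f g : Rd d → ℂ) x‖ₑ
      ≤ ∫⁻ x in Metric.ball 0 R, (‖(f : Rd d → ℂ) x * (g : Rd d → ℂ) x‖ₑ *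
          ‖(T u u : Rd d → ℂ) x‖ₑ + ‖(T f g : Rd d → ℂ) x -
          (f : Rd d → ℂ) x * (g : Rd d → ℂ) x * (T u u : Rd d → ℂ) x‖ₑ) := by
        refine lintegral_mono fun x => ?_
        rw [← enorm_mul]
        refine le_trans (le_of_eq ?_) (enorm_add_le _ _)
        rw [add_sub_cancel]
    _ = _ := lintegral_add_left' ((((hm f).mul (hm g)).restrict.enorm).mul
        (hT.integrableOn_ball u u R).1.enorm) _
    _ ≤ _ := add_le_add le_rfl h1

lemma ae_tendsto_mul_zero {ι : Type*} [Countable ι] {l : Filter ι} {M : ℝ} {f g : ι → Rd d → ℂ}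
    (hg : UnifBdd M g)
    (h0 : ∀ᵐ x ∂(volume : Measure (Rd d)), Tendsto (fun i => f i x) l (𝓝 0)) :
    ∀ᵐ x ∂(volume : Measure (Rd d)), Tendsto (fun i => f i x * g i x) l (𝓝 0) := by
  filter_upwards [h0, ae_all_iff.2 fun i => (hg i).2] with x hx hgx
  rw [tendsto_zero_iff_norm_tendsto_zero] at hx ⊢
  refine squeeze_zero (fun i => norm_nonneg _) (fun i => ?_) (by simpa using hx.mul_const M)
  rw [norm_mul]
  exact mul_le_mul_of_nonneg_left (hgx i).1 (norm_nonneg _)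

lemma UnifBdd.mul_enorm_le {ι : Type*} {M : ℝ} {f g : ι → Rd d → ℂ}
    (hf : UnifBdd M f) (hg : UnifBdd M g) (i : ι) :
    ∀ᵐ x ∂(volume : Measure (Rd d)), ‖f i x * g i x‖ₑ ≤ ((M.toNNReal * M.toNNReal : ℝ≥0) : ℝ≥0∞) := by
  have h : ∀ {z : ℂ}, ‖z‖ ≤ M → ‖z‖ₑ ≤ (M.toNNReal : ℝ≥0∞) := fun {z} hz => by
    rw [← ofReal_norm]; exact ENNReal.ofReal_le_ofReal hz
  filter_upwards [(hf i).2, (hg i).2] with x h1 h2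
  rw [enorm_mul, ENNReal.coe_mul]
  exact mul_le_mul' (h h1.1) (h h2.1)

lemma TruncationsBoundedBy.exists_tsub_le_cubeSpan (hd : 1 ≤ d) (hK : IsCZKernel K cK ω)
    (hB : TruncationsBoundedBy K p q B) (hp : 1 < p) (hq : 1 < q) (hσ : 1 ≤ sigma p q)
    {u : cubeSpan d} (hu1 : ∀ x, ‖(u : Rd d → ℂ) x‖ ≤ 1) (R : ℝ) (η : ℝ≥0∞) (hη : 0 < η) :
    ∃ t : ℝ≥0, ∀ ε : Set.Ioi (0 : ℝ),
      ∫⁻ x in Metric.ball 0 R, (‖truncation K ε u u x‖ₑ - t) ≤ η := by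
  obtain ⟨t, ht⟩ := hB.exists_tsub_le hd hK hp hq hσ (memBddCpt_cubeSpan u) (memBddCpt_cubeSpan u)
    hu1 hu1 (s := Metric.ball 0 R) Metric.isBounded_ball hη
  exact ⟨t, fun ε => ht ε ε.2⟩

/-- Continuity of `T` under bounded convergence to zero of one of the factors. -/
theorem HasKernel.tendsto_lintegral_zero (hd : 1 ≤ d) (hK : IsCZKernel K cK ω)
    (hT : HasKernel T K) (hB : TruncationsBoundedBy K p q B) (hp : 1 < p) (hq : 1 < q)
    (hσ : 1 ≤ sigma p q) {ι : Type*} [Countable ι] {l : Filter ι} [l.IsCountablyGenerated]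
    {M : ℝ} {f g : ι → cubeSpan d} (hf : UnifBdd M fun i => (f i : Rd d → ℂ))
    (hg : UnifBdd M fun i => (g i : Rd d → ℂ))
    (h0 : (∀ᵐ x ∂(volume : Measure (Rd d)), Tendsto (fun i => (f i : Rd d → ℂ) x) l (𝓝 0)) ∨
      ∀ᵐ x ∂(volume : Measure (Rd d)), Tendsto (fun i => (g i : Rd d → ℂ) x) l (𝓝 0)) (R : ℝ) :
    Tendsto (fun i => ∫⁻ x in Metric.ball 0 R, ‖(T (f i) (g i) : Rd d → ℂ) x‖ₑ) l (𝓝 0) := by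
  obtain ⟨u, hu1, hu⟩ := exists_cubeSpan_eq_one (d := d) R
  have hw : ∀ i, AEStronglyMeasurable
      (fun x => (f i : Rd d → ℂ) x * (g i : Rd d → ℂ) x) volume := fun i => (hf i).1.mul (hg i).1
  have hw0 : ∀ᵐ x ∂(volume : Measure (Rd d)),
      Tendsto (fun i => (f i : Rd d → ℂ) x * (g i : Rd d → ℂ) x) l (𝓝 0) := by
    rcases h0 with h0 | h0
    · exact ae_tendsto_mul_zero hg h0
    · simpa only [mul_comm] using ae_tendsto_mul_zero hf h0
  have hv : volume (Metric.ball (0 : Rd d) R) ≠ ⊤ := measure_ball_lt_top.ne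
  have t1 := tendsto_iSup_lintegral_mul (l := l) hv
    (F := fun (_ : Unit) => (T u u : Rd d → ℂ)) (fun η hη =>
      exists_lintegral_tsub_le_of_integrable (hT.integrableOn_ball u u R) hη)
    hw (hf.mul_enorm_le hg) hw0
  have t2 := tendsto_iSup_lintegral_mul (l := l) hv
    (F := fun (ε : Set.Ioi (0 : ℝ)) => truncation K ε u u)
    (hB.exists_tsub_le_cubeSpan hd hK hp hq hσ hu1 R) hw (hf.mul_enorm_le hg) hw0
  have t3 : Tendsto (fun i => B * eLpNorm (f i : Rd d → ℂ) (ENNReal.ofReal p) volume *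
      eLpNorm (g i : Rd d → ℂ) (ENNReal.ofReal q) volume *
        volume (Metric.ball (0 : Rd d) R) ^ (1 - 1 / sigma p q)) l (𝓝 0) := by
    have hvt : volume (Metric.ball (0 : Rd d) R) ^ (1 - 1 / sigma p q) ≠ ⊤ :=
      ENNReal.rpow_ne_top_of_nonneg (by
        rw [sub_nonneg, div_le_one (by linarith)]; exact hσ) hv
    obtain ⟨Cf, hCf⟩ := hf.exists_eLpNorm_le p
    obtain ⟨Cg, hCg⟩ := hg.exists_eLpNorm_le q
    have key : Tendsto (fun i => eLpNorm (f i : Rd d → ℂ) (ENNReal.ofReal p) volume *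
        eLpNorm (g i : Rd d → ℂ) (ENNReal.ofReal q) volume) l (𝓝 0) := by
      rcases h0 with h0 | h0
      · have h2 := ENNReal.Tendsto.mul_const (b := (Cg : ℝ≥0∞))
          (hf.tendsto_eLpNorm h0 (p := p) (by linarith)) (Or.inr ENNReal.coe_ne_top)
        rw [zero_mul] at h2
        exact tendsto_of_tendsto_of_tendsto_of_le_of_le tendsto_const_nhds h2 (fun i => zero_le)
          fun i => mul_le_mul_right (hCg i) _
      · have h2 := ENNReal.Tendsto.const_mul (a := (Cf : ℝ≥0∞))
          (hg.tendsto_eLpNorm h0 (p := q) (by linarith)) (Or.inr ENNReal.coe_ne_top)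
        rw [mul_zero] at h2
        exact tendsto_of_tendsto_of_tendsto_of_le_of_le tendsto_const_nhds h2 (fun i => zero_le)
          fun i => mul_le_mul_left (hCf i) _
    have h3 := ENNReal.Tendsto.mul_const (b := volume (Metric.ball (0 : Rd d) R) ^
      (1 - 1 / sigma p q)) (ENNReal.Tendsto.const_mul (a := (B : ℝ≥0∞)) key
        (Or.inr ENNReal.coe_ne_top)) (Or.inr hvt)
    simpa [mul_assoc] using h3
  have hsum := t1.add (t3.add t2)
  simp only [add_zero] at hsum
  refine tendsto_of_tendsto_of_tendsto_of_le_of_le tendsto_const_nhds hsum (fun i => zero_le)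
    fun i => (hT.lintegral_le hK hB hp hq hσ hu (f i) (g i)).trans ?_
  refine add_le_add ?_ le_rfl
  exact le_iSup (fun _ : Unit => ∫⁻ x in Metric.ball 0 R,
    ‖(f i : Rd d → ℂ) x * (g i : Rd d → ℂ) x‖ₑ * ‖(T u u : Rd d → ℂ) x‖ₑ) ()

/-- By bilinearity the difference is `T(f - f', g) + T(f', g - g')`. The filter is general so that
the same statement serves for the Cauchy property of one sequence and for the independence of the
choice of sequences. -/
theorem HasKernel.tendsto_lintegral_sub (hd : 1 ≤ d) (hK : IsCZKernel K cK ω)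
    (hT : HasKernel T K) (hB : TruncationsBoundedBy K p q B) (hp : 1 < p) (hq : 1 < q)
    (hσ : 1 ≤ sigma p q) {ι : Type*} [Countable ι] {l : Filter ι} [l.IsCountablyGenerated]
    {M : ℝ} (hM : 0 ≤ M) {f g f' g' : ι → cubeSpan d} (hf : UnifBdd M fun i => (f i : Rd d → ℂ))
    (hg : UnifBdd M fun i => (g i : Rd d → ℂ)) (hf' : UnifBdd M fun i => (f' i : Rd d → ℂ))
    (hg' : UnifBdd M fun i => (g' i : Rd d → ℂ))
    (h0 : ∀ᵐ x ∂(volume : Measure (Rd d)),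
      Tendsto (fun i => (f i : Rd d → ℂ) x - (f' i : Rd d → ℂ) x) l (𝓝 0))
    (h1 : ∀ᵐ x ∂(volume : Measure (Rd d)),
      Tendsto (fun i => (g i : Rd d → ℂ) x - (g' i : Rd d → ℂ) x) l (𝓝 0)) (R : ℝ) :
    Tendsto (fun i => ∫⁻ x in Metric.ball 0 R,
      ‖(T (f i) (g i) : Rd d → ℂ) x - (T (f' i) (g' i) : Rd d → ℂ) x‖ₑ) l (𝓝 0) := by
  have hmono : ∀ {w : ι → Rd d → ℂ}, UnifBdd M w → UnifBdd (M + M) w := fun {w} hw i =>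
    ⟨(hw i).1, by
      filter_upwards [(hw i).2] with x hx
      exact ⟨hx.1.trans (by linarith), fun h => hx.2 (by linarith)⟩⟩
  have a1 := hT.tendsto_lintegral_zero hd hK hB hp hq hσ (l := l) (f := fun i => f i - f' i)
    (hf.sub hM hM hf') (hmono hg) (Or.inl h0) R
  have a2 := hT.tendsto_lintegral_zero hd hK hB hp hq hσ (l := l) (g := fun i => g i - g' i)
    (hmono hf') (hg.sub hM hM hg') (Or.inr h1) R
  have a3 := a1.add a2
  rw [add_zero] at a3
  refine tendsto_of_tendsto_of_tendsto_of_le_of_le tendsto_const_nhds a3 (fun i => zero_le)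
    fun i => ?_
  simp only
  rw [← lintegral_add_left' ((hT.integrableOn_ball _ _ R).1.enorm)]
  refine lintegral_mono_ae (ae_restrict_of_ae ?_)
  have e : T (f i) (g i) - T (f' i) (g' i) = T (f i - f' i) (g i) + T (f' i) (g i - g' i) := by
    simp
  filter_upwards [AEEqFun.coeFn_sub (T (f i) (g i)) (T (f' i) (g' i)),
    AEEqFun.coeFn_add (T (f i - f' i) (g i)) (T (f' i) (g i - g' i))] with x h1 h2
  rw [← e, h1] at h2
  simp only [Pi.sub_apply, Pi.add_apply] at h2
  rw [h2]
  exact enorm_add_le _ _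

end extension

/-! ### Completeness of `L^1_loc` -/

lemma exists_limit_of_cauchy {F : ℕ → Rd d → ℂ} {s : Set (Rd d)}
    (hF : ∀ n, IntegrableOn (F n) s volume)
    (hc : Tendsto (fun i : ℕ × ℕ => ∫⁻ x in s, ‖F i.1 x - F i.2 x‖ₑ) atTop (𝓝 0)) :
    ∃ G : Rd d → ℂ, IntegrableOn G s volume ∧
      Tendsto (fun n => ∫⁻ x in s, ‖F n x - G x‖ₑ) atTop (𝓝 0) := by
  have hL : ∀ n, MemLp (F n) 1 (volume.restrict s) := fun n => memLp_one_iff_integrable.2 (hF n)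
  have hcs : CauchySeq fun n => (hL n).toLp (F n) := by
    rw [EMetric.cauchySeq_iff]
    intro η hη
    obtain ⟨⟨N, N'⟩, hN⟩ := eventually_atTop.1 (hc.eventually (gt_mem_nhds hη))
    refine ⟨max N N', fun m hm n hn => ?_⟩
    rw [Lp.edist_toLp_toLp, eLpNorm_one_eq_lintegral_enorm]
    exact hN (m, n) ⟨(le_max_left _ _).trans hm, (le_max_right _ _).trans hn⟩
  obtain ⟨G, hG⟩ := cauchySeq_tendsto_of_complete hcs
  refine ⟨G, memLp_one_iff_integrable.1 (Lp.memLp G), ?_⟩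
  have h := tendsto_iff_edist_tendsto_0.1 hG
  refine h.congr fun n => ?_
  rw [Lp.edist_def, eLpNorm_one_eq_lintegral_enorm]
  refine lintegral_congr_ae ?_
  filter_upwards [(hL n).coeFn_toLp] with x hx
  simp [hx]

lemma ae_eq_of_tendsto_lintegral {α : Type*} [MeasurableSpace α] {μ : Measure α}
    {F : ℕ → α → ℂ} {G G' : α → ℂ} (hF : ∀ n, AEStronglyMeasurable (F n) μ)
    (hG : AEStronglyMeasurable G μ) (hG' : AEStronglyMeasurable G' μ)
    (h : Tendsto (fun n => ∫⁻ x, ‖F n x - G x‖ₑ ∂μ) atTop (𝓝 0))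
    (h' : Tendsto (fun n => ∫⁻ x, ‖F n x - G' x‖ₑ ∂μ) atTop (𝓝 0)) : G =ᵐ[μ] G' := by
  have h0 : ∫⁻ x, ‖G x - G' x‖ₑ ∂μ = 0 := by
    have hsum := h.add h'
    rw [add_zero] at hsum
    refine le_antisymm (ge_of_tendsto' hsum fun n => ?_) zero_le
    have hm : AEMeasurable (fun x => ‖F n x - G x‖ₑ) μ := ((hF n).sub hG).enorm
    rw [← lintegral_add_left' hm]
    refine lintegral_mono fun x => ?_
    have e : G x - G' x = (F n x - G' x) - (F n x - G x) := by ring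
    rw [e, add_comm]
    exact enorm_sub_le
  have hm : AEMeasurable (fun x => ‖G x - G' x‖ₑ) μ := (hG.sub hG').enorm
  rw [lintegral_eq_zero_iff' hm] at h0
  filter_upwards [h0] with x hx
  simpa [sub_eq_zero] using hx

lemma exists_locallyIntegrable_limit {F : ℕ → Rd d → ℂ}
    (hF : ∀ n, ∀ R : ℝ, IntegrableOn (F n) (Metric.ball 0 R) volume)
    (hc : ∀ R : ℝ, Tendsto (fun i : ℕ × ℕ => ∫⁻ x in Metric.ball 0 R, ‖F i.1 x - F i.2 x‖ₑ) atTop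
      (𝓝 0)) :
    ∃ u : Rd d → ℂ, LocallyIntegrable u volume ∧
      ∀ R : ℝ, Tendsto (fun n => ∫⁻ x in Metric.ball 0 R, ‖F n x - u x‖ₑ) atTop (𝓝 0) := by
  choose G hGi hG using fun N : ℕ => exists_limit_of_cauchy (hF · N) (hc N)
  have hball : ∀ {i j : ℕ}, i ≤ j → Metric.ball (0 : Rd d) i ⊆ Metric.ball 0 j := fun h =>
    Metric.ball_subset_ball (by exact_mod_cast h)
  have hmono : ∀ {s t : Set (Rd d)} {f : ℕ → Rd d → ℂ}, s ⊆ t →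
      Tendsto (fun n => ∫⁻ x in t, ‖f n x‖ₑ) atTop (𝓝 0) →
      Tendsto (fun n => ∫⁻ x in s, ‖f n x‖ₑ) atTop (𝓝 0) := fun hst h =>
    tendsto_of_tendsto_of_tendsto_of_le_of_le tendsto_const_nhds h (fun _ => zero_le)
      fun _ => lintegral_mono_set hst
  have hagree : ∀ᵐ x ∂(volume : Measure (Rd d)), ∀ i j : ℕ, i ≤ j → x ∈ Metric.ball (0 : Rd d) i →
      G i x = G j x := by
    refine ae_all_iff.2 fun i => ae_all_iff.2 fun j => ?_
    by_cases hij : i ≤ j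
    · have h := ae_eq_of_tendsto_lintegral (fun n => (hF n i).1) (hGi i).1
        ((hGi j).mono_set (hball hij)).1 (hG i) (hmono (hball hij) (hG j))
      filter_upwards [(ae_restrict_iff' measurableSet_ball).1 h] with x hx _ hxi using hx hxi
    · exact Eventually.of_forall fun x h => absurd h hij
  -- The limits on integer balls agree almost everywhere where both are defined; at `x` the value is
  -- taken from the smallest integer ball containing `x`.
  let u : Rd d → ℂ := fun x => G (⌊‖x‖⌋₊ + 1) x
  have hu : ∀ N : ℕ, u =ᵐ[volume.restrict (Metric.ball 0 N)] G N := by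
    intro N
    refine (ae_restrict_iff' measurableSet_ball).2 ?_
    filter_upwards [hagree] with x hx hxN
    have hxN' : ‖x‖ < N := by simpa using hxN
    refine hx _ _ (Nat.succ_le_of_lt ((Nat.floor_lt (norm_nonneg x)).2 hxN')) ?_
    simpa using Nat.lt_floor_add_one ‖x‖
  refine ⟨u, ?_, fun R => ?_⟩
  · rw [locallyIntegrable_iff]
    intro k hk
    obtain ⟨R, hR⟩ := hk.isBounded.exists_norm_le
    obtain ⟨N, hN⟩ := exists_nat_gt R
    have hi : IntegrableOn u (Metric.ball 0 N) volume := (hGi N).congr (hu N).symm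
    exact hi.mono_set fun x hx => by simpa using (hR x hx).trans_lt hN
  · obtain ⟨N, hN⟩ := exists_nat_ge R
    refine hmono (Metric.ball_subset_ball hN) ((hG N).congr fun n => ?_)
    refine lintegral_congr_ae ?_
    filter_upwards [hu N] with x hx
    rw [hx]

/-! ### Existence of the extended values of `T`. -/

section extension

variable {K : Rd d → Rd d → Rd d → ℂ} {cK : ℝ≥0} {ω : ℝ → ℝ} {p q : ℝ} {B : ℝ≥0} {T : BilinOp d}

lemma UnifBdd.mono {ι : Type*} {M M' : ℝ} (h : M ≤ M') {w : ι → Rd d → ℂ} (hw : UnifBdd M w) :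
    UnifBdd M' w := fun i => ⟨(hw i).1, by
  filter_upwards [(hw i).2] with x hx
  exact ⟨hx.1.trans h, fun h' => hx.2 (h.trans_lt h')⟩⟩

/-- `T` extends to pairs of bounded functions of bounded support. -/
theorem HasKernel.exists_isExtValue (hd : 1 ≤ d) (hK : IsCZKernel K cK ω) (hT : HasKernel T K)
    (hB : TruncationsBoundedBy K p q B) (hp : 1 < p) (hq : 1 < q) (hσ : 1 ≤ sigma p q)
    {f g : Rd d → ℂ} (hf : MemBddCpt f) (hg : MemBddCpt g) : ∃ u, IsExtValue T f g u := by
  obtain ⟨fn, hfn⟩ := exists_bddConv hf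
  obtain ⟨gn, hgn⟩ := exists_bddConv hg
  obtain ⟨M, hM, hfb⟩ := hfn.unifBdd
  obtain ⟨M', hM', hgb⟩ := hgn.unifBdd
  have hdiff : ∀ {h : Rd d → ℂ} {hn : ℕ → cubeSpan d}, BddConv hn h →
      ∀ᵐ x ∂(volume : Measure (Rd d)), Tendsto
        (fun i : ℕ × ℕ => (hn i.1 : Rd d → ℂ) x - (hn i.2 : Rd d → ℂ) x) atTop (𝓝 0) := by
    intro h hn hhn
    filter_upwards [hhn.2] with x hx
    have h1 := hx.comp (tendsto_fst (f := (atTop : Filter ℕ)) (g := (atTop : Filter ℕ)))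
    have h2 := hx.comp (tendsto_snd (f := (atTop : Filter ℕ)) (g := (atTop : Filter ℕ)))
    rw [prod_atTop_atTop_eq] at h1 h2
    simpa using h1.sub h2
  have hcau := hT.tendsto_lintegral_sub hd hK hB hp hq hσ (l := (atTop : Filter (ℕ × ℕ)))
    (M := max M M') (hM.le.trans (le_max_left _ _))
    (f := fun i => fn i.1) (g := fun i => gn i.1) (f' := fun i => fn i.2) (g' := fun i => gn i.2)
    (fun i => hfb.mono (le_max_left _ _) i.1) (fun i => hgb.mono (le_max_right _ _) i.1)
    (fun i => hfb.mono (le_max_left _ _) i.2) (fun i => hgb.mono (le_max_right _ _) i.2)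
    (hdiff hfn) (hdiff hgn)
  obtain ⟨u, hu, hlim⟩ := exists_locallyIntegrable_limit
    (F := fun n => (T (fn n) (gn n) : Rd d → ℂ)) (fun n R => hT.integrableOn_ball _ _ R) hcau
  refine ⟨u, hf, hg, hu, fun hn kn hhn hkn R => ?_⟩
  obtain ⟨N, hN, hhb⟩ := hhn.unifBdd
  obtain ⟨N', hN', hkb⟩ := hkn.unifBdd
  have hzero : ∀ {h : Rd d → ℂ} {hn hn' : ℕ → cubeSpan d}, BddConv hn h → BddConv hn' h →
      ∀ᵐ x ∂(volume : Measure (Rd d)), Tendsto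
        (fun i : ℕ => (hn i : Rd d → ℂ) x - (hn' i : Rd d → ℂ) x) atTop (𝓝 0) := by
    intro h hn hn' hhn hhn'
    filter_upwards [hhn.2, hhn'.2] with x hx hx'
    simpa using hx.sub hx'
  set L := max (max M M') (max N N') with hL
  have h1 : M ≤ L := (le_max_left _ _).trans (le_max_left _ _)
  have h2 : M' ≤ L := (le_max_right _ _).trans (le_max_left _ _)
  have h3 : N ≤ L := (le_max_left _ _).trans (le_max_right _ _)
  have h4 : N' ≤ L := (le_max_right _ _).trans (le_max_right _ _)
  have hsub := hT.tendsto_lintegral_sub hd hK hB hp hq hσ (l := (atTop : Filter ℕ))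
    (M := L) (hM.le.trans h1) (hhb.mono h3) (hkb.mono h4) (hfb.mono h1) (hgb.mono h2)
    (hzero hhn hfn) (hzero hkn hgn) R
  have hsum := hsub.add (hlim R)
  rw [add_zero] at hsum
  refine tendsto_of_tendsto_of_tendsto_of_le_of_le tendsto_const_nhds hsum (fun _ => zero_le)
    fun n => ?_
  simp only
  have hm : AEMeasurable (fun x => ‖(T (hn n) (kn n) : Rd d → ℂ) x -
      (T (fn n) (gn n) : Rd d → ℂ) x‖ₑ) (volume.restrict (Metric.ball 0 R)) :=
    ((hT.integrableOn_ball _ _ R).1.sub (hT.integrableOn_ball _ _ R).1).enorm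
  rw [← lintegral_add_left' hm]
  refine lintegral_mono fun x => ?_
  refine le_trans (le_of_eq ?_) (enorm_add_le _ _)
  congr 1; ring

end extension

/-! ### Campanato's characterization of Hölder continuity -/

lemma setLIntegral_le_of_oscNorm_le {b : Rd d → ℂ} {α : ℝ} {A : ℝ≥0} (hA : oscNorm b α ≤ A)
    (a : Rd d) {l : ℝ} (hl : 0 < l) :
    ∫⁻ x in cube a l, ‖b x - ⨍ y in cube a l, b y‖ₑ ≤
      ENNReal.ofReal (A * l ^ α) * volume (cube a l) := by
  have h1 : ENNReal.ofReal (l ^ (-α)) *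
      ((∫⁻ x in cube a l, ‖b x - ⨍ y in cube a l, b y‖ₑ) / volume (cube a l)) ≤ A :=
    iSup_le_iff.1 (iSup_le_iff.1 (iSup_le_iff.1 hA a) l) hl
  rw [← ENNReal.div_le_iff (volume_cube_ne_zero a hl) (volume_cube_ne_top a l)]
  set t := (∫⁻ x in cube a l, ‖b x - ⨍ y in cube a l, b y‖ₑ) / volume (cube a l)
  have hlα : 0 < l ^ α := Real.rpow_pos_of_pos hl _
  calc t = ENNReal.ofReal (l ^ α) * (ENNReal.ofReal (l ^ (-α)) * t) := by
        rw [← mul_assoc, ← ENNReal.ofReal_mul hlα.le, ← Real.rpow_add hl]; simp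
    _ ≤ ENNReal.ofReal (l ^ α) * A := by gcongr
    _ = _ := by
        rw [mul_comm (A : ℝ), ENNReal.ofReal_mul hlα.le, ENNReal.ofReal_coe_nnreal]

/-- The lower corner of the dyadic child of `cube a l` that contains `x`. -/
noncomputable def childCorner (x a : Rd d) (l : ℝ) : Rd d :=
  WithLp.toLp 2 fun i => if x i < a i + l / 2 then a i else a i + l / 2

lemma mem_child {x a : Rd d} {l : ℝ} (hx : x ∈ cube a l) :
    x ∈ cube (childCorner x a l) (l / 2) := by
  intro i
  have := hx i
  simp only [childCorner]
  split_ifs with h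
  · exact ⟨this.1, h⟩
  · exact ⟨not_lt.1 h, by linarith⟩

lemma child_subset (x a : Rd d) {l : ℝ} (hl : 0 < l) :
    cube (childCorner x a l) (l / 2) ⊆ cube a l := by
  intro y hy i
  have := hy i
  simp only [childCorner] at this
  split_ifs at this with h
  · exact ⟨this.1, by linarith⟩
  · exact ⟨by linarith, by linarith⟩

lemma volume_cube_half (a a' : Rd d) {l : ℝ} :
    volume (cube a l) = 2 ^ d * volume (cube a' (l / 2)) := by
  rw [volume_cube, volume_cube, ← mul_pow]
  congr 1
  rw [show (2 : ℝ≥0∞) = ENNReal.ofReal 2 by simp, ← ENNReal.ofReal_mul (by norm_num)]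
  congr 1; ring

lemma norm_average_child_sub_le {b : Rd d → ℂ} (hb : LocallyIntegrable b volume) {α : ℝ} {A : ℝ≥0}
    (hA : oscNorm b α ≤ A) (x a : Rd d) {l : ℝ} (hl : 0 < l) :
    ‖(⨍ y in cube (childCorner x a l) (l / 2), b y) - ⨍ y in cube a l, b y‖ ≤
      2 ^ d * (A * l ^ α) := by
  have hl2 : 0 < l / 2 := by positivity
  have hint : IntegrableOn b (cube (childCorner x a l) (l / 2)) volume :=
    (hb.integrableOn_isCompact (isBounded_cube _ _).isCompact_closure).mono_set subset_closure
  have h1 := enorm_average_sub_mul_le hint (volume_cube_ne_zero _ hl2) (volume_cube_ne_top _ _)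
    (⨍ y in cube a l, b y)
  have h2 := (h1.trans (lintegral_mono_set (child_subset x a hl))).trans
    (setLIntegral_le_of_oscNorm_le hA a hl)
  rw [volume_cube_half a (childCorner x a l), ← mul_assoc] at h2
  have h3 := (ENNReal.mul_le_mul_iff_left (volume_cube_ne_zero (childCorner x a l) hl2)
    (volume_cube_ne_top _ _)).1 h2
  rw [← ofReal_norm, show (2 : ℝ≥0∞) ^ d = ENNReal.ofReal (2 ^ d) by
    rw [ENNReal.ofReal_pow (by norm_num)]; simp, ← ENNReal.ofReal_mul (by positivity)] at h3
  rw [mul_comm]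
  exact (ENNReal.ofReal_le_ofReal_iff (by positivity)).1 h3

/-- The corners of the descendants of `cube a l` containing `x`. -/
noncomputable def descCorner (x a : Rd d) (l : ℝ) : ℕ → Rd d
  | 0 => a
  | k + 1 => childCorner x (descCorner x a l k) (l / 2 ^ k)

lemma mem_desc {x a : Rd d} {l : ℝ} (hx : x ∈ cube a l) (k : ℕ) :
    x ∈ cube (descCorner x a l k) (l / 2 ^ k) := by
  induction k with
  | zero => simpa [descCorner] using hx
  | succ k ih =>
    have := mem_child ih
    rwa [div_div, ← pow_succ] at this

/-- Halving the cube multiplies the bound for the jump of the average by `2^(-α)`, and the averages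
converge to `b x`. The telescoping sum is thus geometric, which is where `α > 0` is needed. -/
lemma norm_sub_average_le {b : Rd d → ℂ} (hb : LocallyIntegrable b volume) {α : ℝ} (hα : 0 < α)
    {A : ℝ≥0} (hA : oscNorm b α ≤ A) {x a : Rd d} {l : ℝ} (hl : 0 < l)
    (hleb : Tendsto (fun k => ⨍ y in cube (descCorner x a l k) (l / 2 ^ k), b y) atTop (𝓝 (b x))) :
    ‖b x - ⨍ y in cube a l, b y‖ ≤ 2 ^ d * (A * l ^ α) / (1 - (1 / 2) ^ α) := by
  have hr : (1 / 2 : ℝ) ^ α < 1 := Real.rpow_lt_one (by norm_num) (by norm_num) hα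
  have h := dist_le_of_le_geometric_of_tendsto₀ ((1 / 2 : ℝ) ^ α) (2 ^ d * (A * l ^ α)) hr
    (f := fun k => ⨍ y in cube (descCorner x a l k) (l / 2 ^ k), b y) (fun k => ?_) hleb
  · simpa [descCorner, dist_eq_norm, norm_sub_rev] using h
  · have h2 := norm_average_child_sub_le hb hA x (descCorner x a l k)
      (show 0 < l / 2 ^ k by positivity)
    rw [div_div, ← pow_succ] at h2
    rw [dist_eq_norm, norm_sub_rev]
    refine h2.trans (le_of_eq ?_)
    rw [Real.div_rpow hl.le (by positivity), ← Real.rpow_natCast, ← Real.rpow_natCast,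
      ← Real.rpow_natCast, ← Real.rpow_mul (by norm_num), ← Real.rpow_mul (by norm_num),
      mul_comm (k : ℝ) α, one_div, Real.inv_rpow (by norm_num)]
    ring

/-- A function with bounded fractional oscillation is Hölder continuous off a null set. -/
theorem exists_holder_of_oscNorm_le (d : ℕ) {α : ℝ} (hα : 0 < α) :
    ∃ C : ℝ≥0, ∀ (b : Rd d → ℂ) (A : ℝ≥0), LocallyIntegrable b volume → oscNorm b α ≤ A →
      ∃ s : Set (Rd d), (∀ᵐ x ∂(volume : Measure (Rd d)), x ∈ s) ∧
        ∀ x ∈ s, ∀ y ∈ s, ‖b x - b y‖ ≤ C * A * ‖x - y‖ ^ α := by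
  have hr : (1 / 2 : ℝ) ^ α < 1 := Real.rpow_lt_one (by norm_num) (by norm_num) hα
  have hr' : 0 < 1 - (1 / 2 : ℝ) ^ α := sub_pos.2 hr
  -- Two points, each within `2^d · A · (2r)^α / (1 - 2^(-α))` of the average over a common cube of
  -- side `2r`.
  refine ⟨(2 * (2 ^ d * 2 ^ α / (1 - (1 / 2 : ℝ) ^ α))).toNNReal, fun b A hb hA => ?_⟩
  rw [Real.coe_toNNReal _ (by positivity)]
  refine ⟨_, ae_tendsto_average_cube hb, fun x hx y hy => ?_⟩
  rcases eq_or_ne x y with rfl | hne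
  · simp [Real.zero_rpow hα.ne']
  set r := ‖x - y‖ with hrdef
  have hrpos : 0 < r := norm_pos_iff.2 (sub_ne_zero.2 hne)
  -- The coordinatewise minimum as lower corner leaves gaps of at most `r`; side `2r` accommodates
  -- the half-open upper faces.
  set a : Rd d := WithLp.toLp 2 fun i => min (x i) (y i) with ha
  have hl : 0 < 2 * r := by positivity
  have hmem : x ∈ cube a (2 * r) ∧ y ∈ cube a (2 * r) := by
    have hi : ∀ i, |x i - y i| ≤ r := fun i => abs_coord_le_norm (x - y) i
    constructor <;> intro i <;> have := abs_le.1 (hi i) <;> simp only [ha]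
    · refine ⟨min_le_left _ _, ?_⟩
      rcases min_cases (x i) (y i) with h | h <;> rw [h.1] <;> linarith
    · refine ⟨min_le_right _ _, ?_⟩
      rcases min_cases (x i) (y i) with h | h <;> rw [h.1] <;> linarith
  have hlim : Tendsto (fun k : ℕ => 2 * r / 2 ^ k) atTop (𝓝 0) := by
    have := (tendsto_pow_atTop_nhds_zero_of_lt_one (r := (1 / 2 : ℝ)) (by norm_num)
      (by norm_num)).const_mul (2 * r)
    simpa [div_eq_mul_inv] using this
  have hx1 := norm_sub_average_le hb hα hA hl
    (hx _ _ (fun k => by positivity) hlim (mem_desc hmem.1))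
  have hy1 := norm_sub_average_le hb hα hA hl
    (hy _ _ (fun k => by positivity) hlim (mem_desc hmem.2))
  have e : b x - b y = (b x - ⨍ z in cube a (2 * r), b z) - (b y - ⨍ z in cube a (2 * r), b z) := by
    ring
  rw [e]
  refine (norm_sub_le _ _).trans ((add_le_add hx1 hy1).trans (le_of_eq ?_))
  rw [Real.mul_rpow (by norm_num) hrpos.le]
  ring

/-! ### The integral representation of the commutator -/

section commutator

variable {K : Rd d → Rd d → Rd d → ℂ} {cK : ℝ≥0} {ω : ℝ → ℝ} {p q : ℝ} {B : ℝ≥0} {T : BilinOp d}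

lemma exists_bound_of_holder {b : Rd d → ℂ} {s : Set (Rd d)}
    (hs : ∀ᵐ x ∂(volume : Measure (Rd d)), x ∈ s) {H α : ℝ} (hα : 0 < α) (hH : 0 ≤ H)
    (hb : ∀ x ∈ s, ∀ y ∈ s, ‖b x - b y‖ ≤ H * ‖x - y‖ ^ α) (R : ℝ) :
    ∃ M : ℝ≥0, ∀ᵐ x ∂(volume : Measure (Rd d)), ‖x‖ ≤ R → ‖b x‖ ≤ M := by
  obtain ⟨y, hy⟩ := hs.exists
  refine ⟨(‖b y‖ + H * (|R| + ‖y‖) ^ α).toNNReal, ?_⟩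
  rw [Real.coe_toNNReal _ (by positivity)]
  filter_upwards [hs] with x hx hxR
  have h1 : ‖x - y‖ ≤ |R| + ‖y‖ := (norm_sub_le _ _).trans (by linarith [le_abs_self R])
  have h2 := norm_le_norm_add_norm_sub' (b x) (b y)
  have h3 : ‖x - y‖ ^ α ≤ (|R| + ‖y‖) ^ α := Real.rpow_le_rpow (norm_nonneg _) h1 hα.le
  have h4 := mul_le_mul_of_nonneg_left h3 hH
  linarith [hb x hx y hy]

lemma MemBddCpt.mul_of_bound {b f : Rd d → ℂ} (hbm : AEStronglyMeasurable b volume)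
    (hb : ∀ R : ℝ, ∃ M : ℝ≥0, ∀ᵐ x ∂(volume : Measure (Rd d)), ‖x‖ ≤ R → ‖b x‖ ≤ M)
    (hf : MemBddCpt f) : MemBddCpt fun x => b x * f x := by
  obtain ⟨M, hM, h⟩ := hf.exists_bound
  obtain ⟨M', h'⟩ := hb M
  refine ⟨hbm.mul hf.1, M' * M, M, ?_⟩
  filter_upwards [h, h'] with x h h'
  refine ⟨?_, fun hx => by rw [h.2 hx, mul_zero]⟩
  by_cases hx : M < ‖x‖
  · rw [h.2 hx, mul_zero, norm_zero]; positivity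
  · rw [norm_mul]
    exact mul_le_mul (h' (not_lt.1 hx)) h.1 (norm_nonneg _) M'.2

lemma BddConv.tendsto_eLpNorm_sub {hn : ℕ → cubeSpan d} {h : Rd d → ℂ} (hh : MemBddCpt h)
    (hhn : BddConv hn h) {s : ℝ} (hs : 0 < s) :
    Tendsto (fun n => eLpNorm (fun x => (hn n : Rd d → ℂ) x - h x) (ENNReal.ofReal s) volume) atTop
      (𝓝 0) := by
  obtain ⟨M, hM, hb⟩ := hhn.unifBdd
  obtain ⟨M', hM', hb'⟩ := UnifBdd.const hh (ι := ℕ)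
  exact (hb.sub hM.le hM'.le hb').tendsto_eLpNorm (l := atTop)
    (by filter_upwards [hhn.2] with x hx; simpa using hx.sub_const (h x)) hs

/-- Bilinearity and a bound independent of `ε` make the convergence uniform in `ε`, so that the
limits in `n` and in `ε` can be taken in either order. -/
lemma TruncationsBoundedBy.tendsto_iSup (hK : IsCZKernel K cK ω)
    (hB : TruncationsBoundedBy K p q B) (hp : 1 < p) (hq : 1 < q) (hσ : 1 ≤ sigma p q)
    {f g : Rd d → ℂ} (hf : MemBddCpt f) (hg : MemBddCpt g) {fn gn : ℕ → cubeSpan d}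
    (hfn : BddConv fn f) (hgn : BddConv gn g) (R : ℝ) :
    Tendsto (fun n => ⨆ ε : Set.Ioi (0 : ℝ), ∫⁻ x in Metric.ball 0 R,
      ‖truncation K ε (fn n) (gn n) x - truncation K ε f g x‖ₑ) atTop (𝓝 0) := by
  set V := volume (Metric.ball (0 : Rd d) R) ^ (1 - 1 / sigma p q) with hV
  have hVt : V ≠ ⊤ := ENNReal.rpow_ne_top_of_nonneg (by
    rw [sub_nonneg, div_le_one (by linarith)]; exact hσ) measure_ball_lt_top.ne
  obtain ⟨M', hM', hgb⟩ := hgn.unifBdd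
  obtain ⟨Cg, hCg⟩ := hgb.exists_eLpNorm_le q
  set Cf := eLpNorm f (ENNReal.ofReal p) volume with hCf
  have hCft : Cf ≠ ⊤ := (hf.memLp _).2.ne
  have t1 := ENNReal.Tendsto.mul_const (b := V) (ENNReal.Tendsto.mul_const (b := (Cg : ℝ≥0∞))
    (ENNReal.Tendsto.const_mul (a := (B : ℝ≥0∞)) (hfn.tendsto_eLpNorm_sub hf (s := p) (by linarith))
      (Or.inr ENNReal.coe_ne_top)) (Or.inr ENNReal.coe_ne_top)) (Or.inr hVt)
  have t2 := ENNReal.Tendsto.mul_const (b := V) (ENNReal.Tendsto.const_mul (a := (B : ℝ≥0∞) * Cf)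
    (hgn.tendsto_eLpNorm_sub hg (s := q) (by linarith))
      (Or.inr (ENNReal.mul_ne_top ENNReal.coe_ne_top hCft))) (Or.inr hVt)
  have t3 := t1.add t2
  simp only [mul_zero, zero_mul, add_zero] at t3
  refine tendsto_of_tendsto_of_tendsto_of_le_of_le tendsto_const_nhds t3 (fun _ => zero_le)
    fun n => iSup_le fun ε => ?_
  have hε : 0 < (ε : ℝ) := ε.2
  have bf := memBddCpt_cubeSpan (fn n)
  have bg := memBddCpt_cubeSpan (gn n)
  have h1 := hB.setLIntegral_le hK hp hq hσ hε (bf.sub hf) bg (Metric.ball 0 R)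
  have h2 := hB.setLIntegral_le hK hp hq hσ hε hf (bg.sub hg) (Metric.ball 0 R)
  calc _ ≤ ∫⁻ x in Metric.ball 0 R, (‖truncation K ε (fun y => (fn n : Rd d → ℂ) y - f y)
          (gn n) x‖ₑ + ‖truncation K ε f (fun y => (gn n : Rd d → ℂ) y - g y) x‖ₑ) := by
        refine lintegral_mono fun x => ?_
        rw [truncation_sub_left hK hε bf hf bg, truncation_sub_right hK hε hf bg hg]
        refine le_trans (le_of_eq ?_) (enorm_add_le _ _)
        congr 1; ring
    _ = _ := lintegral_add_left' (aestronglyMeasurable_truncation hK hε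
        (bf.sub hf).1 bg.1).restrict.enorm _
    _ ≤ _ := add_le_add (h1.trans (by gcongr; exact hCg n)) h2

/-- The integral representing the commutator. -/
noncomputable def commutatorIntegral (K : Rd d → Rd d → Rd d → ℂ) (b f g : Rd d → ℂ) (x : Rd d) : ℂ :=
  ∫ w : Rd d × Rd d, (b x - b w.1) * K x w.1 w.2 * (f w.1 * g w.2)

lemma tendsto_truncation_commutator (hK : IsCZKernel K cK ω) {b f g : Rd d → ℂ}
    (hf : MemBddCpt f) (hbf : MemBddCpt fun x => b x * f x) (hg : MemBddCpt g) {x : Rd d}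
    (hx : Integrable (fun w : Rd d × Rd d => (b x - b w.1) * K x w.1 w.2 * (f w.1 * g w.2))
      volume) :
    Tendsto (fun j : ℕ => b x * truncation K (1 / ((j : ℝ) + 1)) f g x -
      truncation K (1 / ((j : ℝ) + 1)) (fun x => b x * f x) g x) atTop
      (𝓝 (commutatorIntegral K b f g x)) := by
  have e : ∀ j : ℕ, b x * truncation K (1 / ((j : ℝ) + 1)) f g x -
      truncation K (1 / ((j : ℝ) + 1)) (fun x => b x * f x) g x =
      ∫ w : Rd d × Rd d, (b x - b w.1) * truncKer K (1 / ((j : ℝ) + 1)) x w *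
        (f w.1 * g w.2) := by
    intro j
    have hj : (0 : ℝ) < 1 / ((j : ℝ) + 1) := by positivity
    rw [truncation_eq, truncation_eq, ← integral_const_mul, ← integral_sub
      ((integrable_truncKer_mul hK hj hf hg x).const_mul _) (integrable_truncKer_mul hK hj hbf hg x)]
    congr 1; funext w; ring
  have hint : ∀ j : ℕ, Integrable (fun w : Rd d × Rd d =>
      (b x - b w.1) * truncKer K (1 / ((j : ℝ) + 1)) x w * (f w.1 * g w.2)) volume := by
    intro j
    have hj : (0 : ℝ) < 1 / ((j : ℝ) + 1) := by positivity
    refine (((integrable_truncKer_mul hK hj hf hg x).const_mul (b x)).sub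
      (integrable_truncKer_mul hK hj hbf hg x)).congr (Eventually.of_forall fun w => ?_)
    simp only [Pi.sub_apply]; ring
  simp only [e]
  refine tendsto_integral_of_dominated_convergence _ (fun j => (hint j).1) hx.norm
    (fun j => Eventually.of_forall fun w => ?_) (Eventually.of_forall fun w => ?_)
  · simp only [norm_mul]
    gcongr
    exact norm_indicator_le_norm_self _ _
  -- The only point that no truncation reaches is `w = (x,x)`, and there the factor `b x - b w.1`
  -- vanishes.
  · rcases eq_or_ne (max ‖x - w.1‖ ‖x - w.2‖) 0 with h0 | h0
    · have : ‖x - w.1‖ ≤ 0 := h0 ▸ le_max_left _ _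
      have hxw : x = w.1 := sub_eq_zero.1 (norm_le_zero_iff.1 this)
      simp [← hxw]
    · have hpos : 0 < max ‖x - w.1‖ ‖x - w.2‖ :=
        lt_of_le_of_ne ((norm_nonneg _).trans (le_max_left _ _)) h0.symm
      refine tendsto_const_nhds.congr' ?_
      filter_upwards [tendsto_one_div_add_atTop_nhds_zero_nat.eventually (gt_mem_nhds hpos)] with j hj
      rw [truncKer, Set.indicator_of_mem (by exact hj)]

lemma aestronglyMeasurable_commutatorIntegral (hK : IsCZKernel K cK ω) {b f g : Rd d → ℂ}
    (hbm : AEStronglyMeasurable b volume)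
    (hf : MemBddCpt f) (hbf : MemBddCpt fun x => b x * f x) (hg : MemBddCpt g)
    (hint : ∀ᵐ x ∂(volume : Measure (Rd d)), Integrable (fun w : Rd d × Rd d =>
      (b x - b w.1) * K x w.1 w.2 * (f w.1 * g w.2)) volume) :
    AEStronglyMeasurable (commutatorIntegral K b f g) volume := by
  refine aestronglyMeasurable_of_tendsto_ae atTop (f := fun (j : ℕ) x =>
    b x * truncation K (1 / ((j : ℝ) + 1)) f g x -
      truncation K (1 / ((j : ℝ) + 1)) (fun x => b x * f x) g x) (fun j => ?_) ?_
  · have hj : (0 : ℝ) < 1 / ((j : ℝ) + 1) := by positivity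
    exact (hbm.mul (aestronglyMeasurable_truncation hK hj hf.1 hg.1)).sub
      (aestronglyMeasurable_truncation hK hj hbf.1 hg.1)
  · filter_upwards [hint] with x hx
    exact tendsto_truncation_commutator hK hf hbf hg hx

/-- Here `hn` approximates `b f` but is not `b` times `fn`, so the multiplication terms cancel only
up to `w T(u₁,u₁)` and `w T_ε(u₁,u₁)`. After this correction the identity with the truncations holds
for small `ε`, and Fatou's lemma compares it with the limit of `b T_ε(f,g) - T_ε(bf,g)`. -/
lemma lintegral_commutator_sub_le (hK : IsCZKernel K cK ω) (hT : HasKernel T K) {b f g : Rd d → ℂ}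
    (hbm : AEStronglyMeasurable b volume) {R : ℝ} {M : ℝ≥0}
    (hb : ∀ᵐ x ∂(volume : Measure (Rd d)), ‖x‖ ≤ R → ‖b x‖ ≤ M)
    (hf : MemBddCpt f) (hbf : MemBddCpt fun x => b x * f x) (hg : MemBddCpt g)
    (hint : ∀ᵐ x ∂(volume : Measure (Rd d)), Integrable (fun w : Rd d × Rd d =>
      (b x - b w.1) * K x w.1 w.2 * (f w.1 * g w.2)) volume)
    {u₁ : cubeSpan d} (hu : ∀ x ∈ Metric.ball (0 : Rd d) R, (u₁ : Rd d → ℂ) x = 1)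
    (fn hn gn : cubeSpan d) :
    let w : Rd d → ℂ := fun x =>
      (b x * (fn : Rd d → ℂ) x - (hn : Rd d → ℂ) x) * (gn : Rd d → ℂ) x
    ∫⁻ x in Metric.ball 0 R, ‖b x * (T fn gn : Rd d → ℂ) x - (T hn gn : Rd d → ℂ) x -
        w x * (T u₁ u₁ : Rd d → ℂ) x - commutatorIntegral K b f g x‖ₑ ≤
      M * (⨆ ε : Set.Ioi (0 : ℝ), ∫⁻ x in Metric.ball 0 R,
        ‖truncation K ε fn gn x - truncation K ε f g x‖ₑ) +
      ((⨆ ε : Set.Ioi (0 : ℝ), ∫⁻ x in Metric.ball 0 R,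
        ‖truncation K ε hn gn x - truncation K ε (fun x => b x * f x) g x‖ₑ) +
      ⨆ ε : Set.Ioi (0 : ℝ), ∫⁻ x in Metric.ball 0 R, ‖w x‖ₑ * ‖truncation K ε u₁ u₁ x‖ₑ) := by
  intro w
  have hm : ∀ f : cubeSpan d, AEStronglyMeasurable (f : Rd d → ℂ) volume := fun f =>
    (measurable_cubeSpan f).aestronglyMeasurable
  have hwm : AEStronglyMeasurable w volume := ((hbm.mul (hm fn)).sub (hm hn)).mul (hm gn)
  let ε : ℕ → Set.Ioi (0 : ℝ) := fun j => ⟨1 / ((j : ℝ) + 1), by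
    show (0 : ℝ) < 1 / ((j : ℝ) + 1)
    positivity⟩
  have hmt : ∀ (j : ℕ) {f g : Rd d → ℂ}, AEStronglyMeasurable f volume →
      AEStronglyMeasurable g volume → AEStronglyMeasurable (truncation K (ε j) f g) volume :=
    fun j f g hf hg => aestronglyMeasurable_truncation hK (ε j).2 hf hg
  have hm1 : ∀ j, AEStronglyMeasurable (fun x => truncation K (ε j) fn gn x -
      truncation K (ε j) f g x) volume := fun j =>
    (hmt j (hm fn) (hm gn)).sub (hmt j hf.1 hg.1)
  have hm2 : ∀ j, AEStronglyMeasurable (fun x => truncation K (ε j) hn gn x -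
      truncation K (ε j) (fun x => b x * f x) g x) volume := fun j =>
    (hmt j (hm hn) (hm gn)).sub (hmt j hbf.1 hg.1)
  refine lintegral_enorm_le_of_tendsto (Y := fun (j : ℕ) x =>
    b x * (truncation K (ε j) fn gn x - truncation K (ε j) f g x) -
      (truncation K (ε j) hn gn x - truncation K (ε j) (fun x => b x * f x) g x) -
      w x * truncation K (ε j) u₁ u₁ x) (fun j => ?_) ?_ (fun j => ?_)
  · exact (((hbm.mul (hm1 j)).sub (hm2 j)).sub (hwm.mul (hmt j (hm u₁) (hm u₁)))).restrict
  · filter_upwards [ae_restrict_of_ae (hT.ae_sub_eq_truncation_sub hK fn gn u₁),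
      ae_restrict_of_ae (hT.ae_sub_eq_truncation_sub hK hn gn u₁), ae_restrict_of_ae hint,
      ae_restrict_mem measurableSet_ball] with x h1 h2 h3 hxb
    have t1 := (tendsto_of_eventually_eq (h1 (hu x hxb))).const_mul (b x)
    have t2 := tendsto_of_eventually_eq (h2 (hu x hxb))
    have t3 := tendsto_truncation_commutator hK hf hbf hg h3
    have t := (t1.sub t2).sub t3
    refine (t.congr fun j => ?_).trans (le_of_eq ?_)
    · simp only [w, ε]; ring
    · congr 1; simp only [w]; ring
  · calc _ ≤ ∫⁻ x in Metric.ball 0 R, (M * ‖truncation K (ε j) fn gn x -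
            truncation K (ε j) f g x‖ₑ + (‖truncation K (ε j) hn gn x -
            truncation K (ε j) (fun x => b x * f x) g x‖ₑ +
            ‖w x‖ₑ * ‖truncation K (ε j) u₁ u₁ x‖ₑ)) := by
          refine lintegral_mono_ae ?_
          filter_upwards [ae_restrict_of_ae hb, ae_restrict_mem measurableSet_ball] with x hx hxb
          have hbx : ‖b x‖ₑ ≤ M := by
            have := hx (by simpa using (Metric.mem_ball.1 hxb).le)
            rw [← ofReal_norm, ← ENNReal.ofReal_coe_nnreal]
            exact ENNReal.ofReal_le_ofReal this
          refine enorm_sub_le.trans ((add_le_add_left enorm_sub_le _).trans ?_)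
          rw [enorm_mul, enorm_mul, add_assoc]
          gcongr
      _ = M * (∫⁻ x in Metric.ball 0 R, ‖truncation K (ε j) fn gn x -
            truncation K (ε j) f g x‖ₑ) + ((∫⁻ x in Metric.ball 0 R, ‖truncation K (ε j) hn gn x -
            truncation K (ε j) (fun x => b x * f x) g x‖ₑ) +
            ∫⁻ x in Metric.ball 0 R, ‖w x‖ₑ * ‖truncation K (ε j) u₁ u₁ x‖ₑ) := by
          rw [lintegral_add_left' ((hm1 j).restrict.enorm.const_mul _),
            lintegral_add_left' (hm2 j).restrict.enorm,
            lintegral_const_mul' _ _ ENNReal.coe_ne_top]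
      _ ≤ _ := by
          gcongr
          · exact le_iSup (fun ε : Set.Ioi (0 : ℝ) => ∫⁻ x in Metric.ball 0 R,
              ‖truncation K ε fn gn x - truncation K ε f g x‖ₑ) (ε j)
          · exact le_iSup (fun ε : Set.Ioi (0 : ℝ) => ∫⁻ x in Metric.ball 0 R,
              ‖truncation K ε hn gn x - truncation K ε (fun x => b x * f x) g x‖ₑ) (ε j)
          · exact le_iSup (fun ε : Set.Ioi (0 : ℝ) => ∫⁻ x in Metric.ball 0 R,
              ‖w x‖ₑ * ‖truncation K ε u₁ u₁ x‖ₑ) (ε j)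

end commutator

section commutator

variable {K : Rd d → Rd d → Rd d → ℂ} {cK : ℝ≥0} {ω : ℝ → ℝ} {p q : ℝ} {B : ℝ≥0} {T : BilinOp d}

lemma UnifBdd.mul_of_bound {b : Rd d → ℂ} (hbm : AEStronglyMeasurable b volume)
    (hb : ∀ R : ℝ, ∃ M : ℝ≥0, ∀ᵐ x ∂(volume : Measure (Rd d)), ‖x‖ ≤ R → ‖b x‖ ≤ M)
    {ι : Type*} {M : ℝ} (hM : 0 ≤ M) {w : ι → Rd d → ℂ} (hw : UnifBdd M w) :
    ∃ M' : ℝ, 0 ≤ M' ∧ UnifBdd M' fun i x => b x * w i x := by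
  obtain ⟨C, hC⟩ := hb M
  refine ⟨max M (C * M), hM.trans (le_max_left _ _), fun i => ⟨hbm.mul (hw i).1, ?_⟩⟩
  filter_upwards [(hw i).2, hC] with x h1 h2
  refine ⟨?_, fun hx => by rw [h1.2 ((le_max_left _ _).trans_lt hx), mul_zero]⟩
  by_cases hx : M < ‖x‖
  · rw [h1.2 hx, mul_zero, norm_zero]; exact hM.trans (le_max_left _ _)
  · rw [norm_mul]
    exact (mul_le_mul (h2 (not_lt.1 hx)) h1.1 (norm_nonneg _) C.2).trans (le_max_right _ _)

/-- The commutator is given by an absolutely convergent integral. -/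
theorem HasKernel.commutator_ae_eq (hd : 1 ≤ d) (hK : IsCZKernel K cK ω) (hT : HasKernel T K)
    (hB : TruncationsBoundedBy K p q B) (hp : 1 < p) (hq : 1 < q) (hσ : 1 ≤ sigma p q)
    {b f g u v : Rd d → ℂ} (hbm : AEStronglyMeasurable b volume)
    (hb : ∀ R : ℝ, ∃ M : ℝ≥0, ∀ᵐ x ∂(volume : Measure (Rd d)), ‖x‖ ≤ R → ‖b x‖ ≤ M)
    (hint : ∀ᵐ x ∂(volume : Measure (Rd d)), Integrable (fun w : Rd d × Rd d =>
      (b x - b w.1) * K x w.1 w.2 * (f w.1 * g w.2)) volume)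
    (hu : IsExtValue T f g u) (hv : IsExtValue T (fun x => b x * f x) g v) :
    ∀ᵐ x ∂(volume : Measure (Rd d)), b x * u x - v x = commutatorIntegral K b f g x := by
  obtain ⟨hf, hg, hul, hulim⟩ := hu
  obtain ⟨hbf, -, hvl, hvlim⟩ := hv
  have hum := hul.aestronglyMeasurable
  have hvm := hvl.aestronglyMeasurable
  have hCm := aestronglyMeasurable_commutatorIntegral hK hbm hf hbf hg hint
  obtain ⟨fn, hfn⟩ := exists_bddConv hf
  obtain ⟨hn, hhn⟩ := exists_bddConv hbf
  obtain ⟨gn, hgn⟩ := exists_bddConv hg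
  have hm : ∀ f : cubeSpan d, AEStronglyMeasurable (f : Rd d → ℂ) volume := fun f =>
    (measurable_cubeSpan f).aestronglyMeasurable
  let w : ℕ → Rd d → ℂ := fun n x =>
    (b x * (fn n : Rd d → ℂ) x - (hn n : Rd d → ℂ) x) * (gn n : Rd d → ℂ) x
  have hwm : ∀ n, AEStronglyMeasurable (w n) volume := fun n =>
    ((hbm.mul (hm _)).sub (hm _)).mul (hm _)
  obtain ⟨M₁, hM₁, hfb⟩ := hfn.unifBdd
  obtain ⟨M₂, hM₂, hhb⟩ := hhn.unifBdd
  obtain ⟨M₃, hM₃, hgb⟩ := hgn.unifBdd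
  obtain ⟨M₄, hM₄, hbfb⟩ := hfb.mul_of_bound hbm hb hM₁.le
  have hwb := ((hbfb.sub hM₄ hM₂.le hhb).mono (le_max_left (M₄ + M₂) M₃)).mul_enorm_le
    (hgb.mono (le_max_right (M₄ + M₂) M₃))
  -- The correction tends to `(b f - b f) g = 0` boundedly, so both terms containing `u₁` disappear
  -- in the limit, the truncated one uniformly in `ε`.
  have hw0 : ∀ᵐ x ∂(volume : Measure (Rd d)), Tendsto (fun n => w n x) atTop (𝓝 0) := by
    filter_upwards [hfn.2, hhn.2, hgn.2] with x h1 h2 h3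
    simpa using (((h1.const_mul (b x)).sub h2).mul h3)
  have hball : ∀ N : ℕ, ∀ᵐ x ∂(volume : Measure (Rd d)), x ∈ Metric.ball (0 : Rd d) N →
      b x * u x - v x = commutatorIntegral K b f g x := by
    intro N
    obtain ⟨M, hMb⟩ := hb N
    obtain ⟨u₁, hu₁, hu₁'⟩ := exists_cubeSpan_eq_one (d := d) N
    have hvol : volume (Metric.ball (0 : Rd d) N) ≠ ⊤ := measure_ball_lt_top.ne
    have t1 := ENNReal.Tendsto.const_mul (a := (M : ℝ≥0∞)) (hulim fn gn hfn hgn N)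
      (Or.inr ENNReal.coe_ne_top)
    have t2 := hvlim hn gn hhn hgn N
    have t3 := tendsto_iSup_lintegral_mul (l := atTop) hvol
      (F := fun (_ : Unit) => (T u₁ u₁ : Rd d → ℂ)) (fun η hη =>
        exists_lintegral_tsub_le_of_integrable (hT.integrableOn_ball u₁ u₁ N) hη) hwm hwb hw0
    have t4 := ENNReal.Tendsto.const_mul (a := (M : ℝ≥0∞))
      (hB.tendsto_iSup hK hp hq hσ hf hg hfn hgn N) (Or.inr ENNReal.coe_ne_top)
    have t5 := hB.tendsto_iSup hK hp hq hσ hbf hg hhn hgn N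
    have t6 := tendsto_iSup_lintegral_mul (l := atTop) hvol
      (F := fun (ε : Set.Ioi (0 : ℝ)) => truncation K ε u₁ u₁)
      (hB.exists_tsub_le_cubeSpan hd hK hp hq hσ hu₁ N) hwm hwb hw0
    have hsum := t1.add (t2.add (t3.add (t4.add (t5.add t6))))
    simp only [mul_zero, add_zero] at hsum
    have hle : ∫⁻ x in Metric.ball 0 N, ‖b x * u x - v x - commutatorIntegral K b f g x‖ₑ = 0 := by
      refine le_antisymm (ge_of_tendsto' hsum fun n => ?_) zero_le
      have hX := lintegral_commutator_sub_le hK hT hbm hMb hf hbf hg hint hu₁' (fn n) (hn n) (gn n)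
      set X : Rd d → ℂ := fun x => b x * (T (fn n) (gn n) : Rd d → ℂ) x -
        (T (hn n) (gn n) : Rd d → ℂ) x - w n x * (T u₁ u₁ : Rd d → ℂ) x -
        commutatorIntegral K b f g x with hXdef
      have hT1 : AEStronglyMeasurable (fun x => (T (fn n) (gn n) : Rd d → ℂ) x - u x)
          (volume.restrict (Metric.ball 0 N)) :=
        (hT.integrableOn_ball _ _ N).1.sub hum.restrict
      have hT2 : AEStronglyMeasurable (fun x => (T (hn n) (gn n) : Rd d → ℂ) x - v x)
          (volume.restrict (Metric.ball 0 N)) :=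
        (hT.integrableOn_ball _ _ N).1.sub hvm.restrict
      have hT3 : AEMeasurable (fun x => ‖w n x‖ₑ * ‖(T u₁ u₁ : Rd d → ℂ) x‖ₑ)
          (volume.restrict (Metric.ball 0 N)) :=
        (hwm n).restrict.enorm.mul (hT.integrableOn_ball u₁ u₁ N).1.enorm
      calc ∫⁻ x in Metric.ball 0 N, ‖b x * u x - v x - commutatorIntegral K b f g x‖ₑ
          ≤ ∫⁻ x in Metric.ball 0 N, (M * ‖(T (fn n) (gn n) : Rd d → ℂ) x - u x‖ₑ +
              (‖(T (hn n) (gn n) : Rd d → ℂ) x - v x‖ₑ +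
              (‖w n x‖ₑ * ‖(T u₁ u₁ : Rd d → ℂ) x‖ₑ + ‖X x‖ₑ))) := by
            refine lintegral_mono_ae ?_
            filter_upwards [ae_restrict_of_ae hMb, ae_restrict_mem measurableSet_ball] with x hx hxb
            have hbx : ‖b x‖ₑ ≤ M := by
              have := hx (by simpa using (Metric.mem_ball.1 hxb).le)
              rw [← ofReal_norm, ← ENNReal.ofReal_coe_nnreal]
              exact ENNReal.ofReal_le_ofReal this
            have e : b x * u x - v x - commutatorIntegral K b f g x =
                ((T (hn n) (gn n) : Rd d → ℂ) x - v x) +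
                (w n x * (T u₁ u₁ : Rd d → ℂ) x + X x) -
                b x * ((T (fn n) (gn n) : Rd d → ℂ) x - u x) := by
              simp only [hXdef]; ring
            rw [e, add_comm ((M : ℝ≥0∞) * _)]
            refine enorm_sub_le.trans (add_le_add ?_ ?_)
            · refine (enorm_add_le _ _).trans (add_le_add le_rfl ((enorm_add_le _ _).trans ?_))
              rw [enorm_mul]
            · rw [enorm_mul]; gcongr
        _ = M * (∫⁻ x in Metric.ball 0 N, ‖(T (fn n) (gn n) : Rd d → ℂ) x - u x‖ₑ) +
              ((∫⁻ x in Metric.ball 0 N, ‖(T (hn n) (gn n) : Rd d → ℂ) x - v x‖ₑ) +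
              ((∫⁻ x in Metric.ball 0 N, ‖w n x‖ₑ * ‖(T u₁ u₁ : Rd d → ℂ) x‖ₑ) +
                ∫⁻ x in Metric.ball 0 N, ‖X x‖ₑ)) := by
            rw [lintegral_add_left' (hT1.enorm.const_mul _), lintegral_add_left' hT2.enorm,
              lintegral_add_left' hT3,
              lintegral_const_mul' _ _ ENNReal.coe_ne_top]
        _ ≤ _ := by
            gcongr
            · exact le_iSup (fun _ : Unit => ∫⁻ x in Metric.ball 0 N,
                ‖w n x‖ₑ * ‖(T u₁ u₁ : Rd d → ℂ) x‖ₑ) ()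
    have hmeas : AEMeasurable (fun x => ‖b x * u x - v x - commutatorIntegral K b f g x‖ₑ)
        (volume.restrict (Metric.ball 0 N)) :=
      (((hbm.mul hum).sub hvm).sub hCm).restrict.enorm
    rw [lintegral_eq_zero_iff' hmeas] at hle
    filter_upwards [(ae_restrict_iff' measurableSet_ball).1 hle] with x hx hxb
    simpa [sub_eq_zero] using hx hxb
  filter_upwards [ae_all_iff.2 hball] with x hx
  obtain ⟨N, hN⟩ := exists_nat_gt ‖x‖
  exact hx N (by simpa using hN)

end commutator

/-! ### Geometric sums over dyadic scales -/

lemma two_rpow_zpow (m : ℤ) : (2 : ℝ≥0∞) ^ (m : ℝ) = (2 : ℝ≥0∞) ^ m := ENNReal.rpow_intCast _ _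

lemma two_rpow_add (s t : ℝ) : (2 : ℝ≥0∞) ^ (s + t) = 2 ^ s * 2 ^ t :=
  ENNReal.rpow_add _ _ two_ne_zero ENNReal.ofNat_ne_top

lemma two_rpow_ne_top (s : ℝ) : (2 : ℝ≥0∞) ^ s ≠ ⊤ :=
  ENNReal.rpow_ne_top_of_ne_zero two_ne_zero ENNReal.ofNat_ne_top

lemma two_rpow_ne_zero (s : ℝ) : (2 : ℝ≥0∞) ^ s ≠ 0 :=
  (ENNReal.rpow_pos (by norm_num) ENNReal.ofNat_ne_top).ne'

lemma two_rpow_neg_mul (s : ℝ) : (2 : ℝ≥0∞) ^ (-s) * 2 ^ s = 1 := by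
  rw [← two_rpow_add, neg_add_cancel, ENNReal.rpow_zero]

lemma exists_two_rpow_mem_Ioc {b : ℝ≥0∞} (h0 : b ≠ 0) (ht : b ≠ ⊤) :
    ∃ m : ℤ, (2 : ℝ≥0∞) ^ (m : ℝ) < b ∧ b ≤ 2 ^ ((m : ℝ) + 1) := by
  obtain ⟨m, h1, h2⟩ := ENNReal.exists_mem_Ioc_zpow (x := b) (y := 2) h0 ht (by norm_num)
    ENNReal.ofNat_ne_top
  refine ⟨m, by rwa [two_rpow_zpow], ?_⟩
  have := two_rpow_zpow (m + 1)
  push_cast at this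
  rwa [this]

/-- A geometric sum running down from the largest admissible scale, hence comparable to its top
term. -/
lemma exists_tsum_two_rpow_le {β : ℝ} (hβ : 0 < β) : ∃ C : ℝ≥0, ∀ b : ℝ≥0∞,
    ∑' k : ℤ, (if (2 : ℝ≥0∞) ^ (k : ℝ) ≤ b then (2 : ℝ≥0∞) ^ ((k : ℝ) * β) else 0) ≤ C * b ^ β := by
  have hlt : (2 : ℝ≥0∞) ^ (-β) < 1 := ENNReal.rpow_lt_one_of_one_lt_of_neg (by norm_num) (by linarith)
  set G : ℝ≥0∞ := (1 - 2 ^ (-β))⁻¹ with hG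
  have hGt : G ≠ ⊤ := ENNReal.inv_ne_top.2 (tsub_pos_of_lt hlt).ne'
  have hCt : 2 ^ β * G + 1 ≠ ⊤ := ENNReal.add_ne_top.2
    ⟨ENNReal.mul_ne_top (two_rpow_ne_top _) hGt, ENNReal.one_ne_top⟩
  refine ⟨(2 ^ β * G + 1).toNNReal, fun b => ?_⟩
  rw [ENNReal.coe_toNNReal hCt]
  rcases eq_or_ne b 0 with rfl | h0
  · refine le_trans (le_of_eq (ENNReal.tsum_eq_zero.2 fun k => ?_)) zero_le
    rw [if_neg]
    rw [nonpos_iff_eq_zero]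
    exact two_rpow_ne_zero _
  rcases eq_or_ne b ⊤ with rfl | ht
  · rw [ENNReal.top_rpow_of_pos hβ, ENNReal.mul_top (by simp)]; exact le_top
  obtain ⟨m, hm1, hm2⟩ := exists_two_rpow_mem_Ioc h0 ht
  have hle : ∀ k : ℤ, (2 : ℝ≥0∞) ^ (k : ℝ) ≤ b → k ≤ m + 1 := by
    intro k hk
    have h1 := hk.trans hm2
    by_contra hcon
    have : (m : ℝ) + 1 < k := by exact_mod_cast not_le.1 hcon
    exact absurd h1 (not_le.2 (ENNReal.rpow_lt_rpow_of_exponent_lt (by norm_num)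
      ENNReal.ofNat_ne_top this))
  have hinj : Function.Injective fun n : ℕ => m + 1 - (n : ℤ) := fun a b h => by
    simp only at h; omega
  calc _ = ∑' n : ℕ, (if (2 : ℝ≥0∞) ^ (((m + 1 - (n : ℤ) : ℤ)) : ℝ) ≤ b then
          (2 : ℝ≥0∞) ^ (((m + 1 - (n : ℤ) : ℤ) : ℝ) * β) else 0) := by
        refine (hinj.tsum_eq fun k hk => ?_).symm
        have hk' : (2 : ℝ≥0∞) ^ (k : ℝ) ≤ b := by
          by_contra hcon
          exact hk (if_neg hcon)
        exact ⟨(m + 1 - k).toNat, by have := hle k hk'; simp only; omega⟩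
    _ ≤ ∑' n : ℕ, (2 : ℝ≥0∞) ^ (((m : ℝ) + 1) * β) * ((2 : ℝ≥0∞) ^ (-β)) ^ n := by
        refine ENNReal.tsum_le_tsum fun n => ?_
        split_ifs
        · rw [← ENNReal.rpow_natCast, ← ENNReal.rpow_mul, ← two_rpow_add]
          refine le_of_eq ?_
          congr 1; push_cast; ring
        · exact zero_le
    _ = 2 ^ β * G * (2 ^ (m : ℝ)) ^ β := by
        rw [ENNReal.tsum_mul_left, ENNReal.tsum_geometric, ← ENNReal.rpow_mul, add_mul, one_mul,
          two_rpow_add, ← hG]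
        ring
    _ ≤ _ := by
        gcongr
        exact le_self_add

lemma exists_tsum_two_rpow_neg_le {β : ℝ} (hβ : 0 < β) : ∃ C : ℝ≥0, ∀ b : ℝ≥0∞,
    ∑' k : ℤ, (if b ≤ (2 : ℝ≥0∞) ^ (k : ℝ) then (2 : ℝ≥0∞) ^ (-((k : ℝ) * β)) else 0) ≤
      C * b ^ (-β) := by
  obtain ⟨C, hC⟩ := exists_tsum_two_rpow_le hβ
  refine ⟨C, fun b => ?_⟩
  refine le_trans (le_of_eq ?_) ((hC b⁻¹).trans (le_of_eq ?_))
  · rw [← (Equiv.neg ℤ).tsum_eq]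
    refine tsum_congr fun k => ?_
    simp only [Equiv.neg_apply, Int.cast_neg, neg_mul, neg_neg, ENNReal.rpow_neg,
      ENNReal.le_inv_iff_le_inv]
  · rw [ENNReal.inv_rpow, ENNReal.rpow_neg]

/-- The sum of dyadic scales in Hedberg's argument. -/
lemma exists_tsum_min_le {a γ : ℝ} (ha : 0 < a) (haγ : a < γ) : ∃ C : ℝ≥0, ∀ M N : ℝ≥0∞,
    ∑' k : ℤ, (2 : ℝ≥0∞) ^ ((k : ℝ) * a) * min M (N * 2 ^ (-((k : ℝ) * γ))) ≤
      C * (M ^ (1 - a / γ) * N ^ (a / γ)) := by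
  obtain ⟨C₁, h₁⟩ := exists_tsum_two_rpow_le ha
  obtain ⟨C₂, h₂⟩ := exists_tsum_two_rpow_neg_le (sub_pos.2 haγ)
  have hγ : 0 < γ := ha.trans haγ
  have hθ : 0 < a / γ := div_pos ha hγ
  have hθ' : 0 < 1 - a / γ := by rw [sub_pos, div_lt_one hγ]; exact haγ
  refine ⟨C₁ + C₂ + 1, fun M N => ?_⟩
  rcases eq_or_ne M 0 with rfl | hM0
  · simp
  rcases eq_or_ne N 0 with rfl | hN0
  · simp
  have hp : ∀ {x : ℝ≥0∞} {s : ℝ}, x ≠ 0 → 0 < s → x ^ s ≠ 0 := fun {x s} hx hs =>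
    (ENNReal.rpow_pos_of_nonneg (pos_iff_ne_zero.2 hx) hs.le).ne'
  have hC0 : ((C₁ + C₂ + 1 : ℝ≥0) : ℝ≥0∞) ≠ 0 := by
    rw [ENNReal.coe_ne_zero]; positivity
  rcases eq_or_ne M ⊤ with rfl | hMt
  · rw [ENNReal.top_rpow_of_pos hθ', ENNReal.top_mul (hp hN0 hθ), ENNReal.mul_top hC0]
    exact le_top
  rcases eq_or_ne N ⊤ with rfl | hNt
  · rw [ENNReal.top_rpow_of_pos hθ, ENNReal.mul_top (hp hM0 hθ'), ENNReal.mul_top hC0]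
    exact le_top
  -- The scale at which the two bounds balance, `M = N τ^(-γ)`. Below it `M` is used, above it the
  -- decaying bound, and both geometric sums equal `M^(1-a/γ) N^(a/γ)` up to constants.
  set τ := (N / M) ^ (1 / γ) with hτ
  have e1 : M * τ ^ a = M ^ (1 - a / γ) * N ^ (a / γ) := by
    rw [hτ, ← ENNReal.rpow_mul, show 1 / γ * a = a / γ by ring, ENNReal.div_rpow_of_nonneg _ _ hθ.le,
      ENNReal.rpow_sub _ _ hM0 hMt, ENNReal.rpow_one, ENNReal.div_eq_inv_mul, ENNReal.div_eq_inv_mul]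
    ring
  have e2 : N * τ ^ (-(γ - a)) = M ^ (1 - a / γ) * N ^ (a / γ) := by
    rw [hτ, ← ENNReal.rpow_mul, show 1 / γ * -(γ - a) = -(1 - a / γ) by field_simp,
      ENNReal.rpow_neg, ENNReal.div_rpow_of_nonneg _ _ hθ'.le,
      ENNReal.inv_div (Or.inl (ENNReal.rpow_ne_top_of_nonneg hθ'.le hMt)) (Or.inl (hp hM0 hθ')),
      ENNReal.div_eq_inv_mul, ← mul_assoc, mul_comm]
    congr 1
    rw [← ENNReal.rpow_neg]
    nth_rewrite 1 [← ENNReal.rpow_one N]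
    rw [← ENNReal.rpow_add _ _ hN0 hNt]
    congr 1; ring
  calc _ ≤ ∑' k : ℤ, (M * (if (2 : ℝ≥0∞) ^ (k : ℝ) ≤ τ then (2 : ℝ≥0∞) ^ ((k : ℝ) * a) else 0) +
        N * (if τ ≤ (2 : ℝ≥0∞) ^ (k : ℝ) then (2 : ℝ≥0∞) ^ (-((k : ℝ) * (γ - a))) else 0)) := by
        refine ENNReal.tsum_le_tsum fun k => ?_
        rcases le_total ((2 : ℝ≥0∞) ^ (k : ℝ)) τ with h | h
        · rw [if_pos h, mul_comm M]
          exact (mul_le_mul_right (min_le_left _ _) _).trans le_self_add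
        · rw [if_pos h]
          refine le_trans ?_ le_add_self
          refine (mul_le_mul_right (min_le_right _ _) _).trans (le_of_eq ?_)
          rw [mul_left_comm, ← two_rpow_add]
          congr 2; ring
    _ ≤ M * (C₁ * τ ^ a) + N * (C₂ * τ ^ (-(γ - a))) := by
        rw [ENNReal.tsum_add, ENNReal.tsum_mul_left, ENNReal.tsum_mul_left]
        gcongr
        · exact h₁ τ
        · exact h₂ τ
    _ = (C₁ + C₂) * (M ^ (1 - a / γ) * N ^ (a / γ)) := by
        rw [mul_left_comm M, e1, mul_left_comm N, e2, add_mul]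
    _ ≤ _ := by
        push_cast
        exact mul_le_mul_left le_self_add _

/-- A dyadic substitute for the layer cake formula: the largest power of `2` below `a` already
contributes enough, and for `a = ⊤` the sum diverges. -/
lemma rpow_le_tsum {p : ℝ} (hp : 0 < p) (a : ℝ≥0∞) :
    a ^ p ≤ ∑' k : ℤ, (if (2 : ℝ≥0∞) ^ (k : ℝ) < a then (2 : ℝ≥0∞) ^ (((k : ℝ) + 1) * p) else 0) := by
  rcases eq_or_ne a 0 with rfl | h0
  · simp [ENNReal.zero_rpow_of_pos hp]
  rcases eq_or_ne a ⊤ with rfl | ht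
  · refine le_trans (le_top.trans_eq (ENNReal.tsum_const_eq_top_of_ne_zero (α := ℕ) (c := 1)
      one_ne_zero).symm) (le_trans ?_ (ENNReal.tsum_comp_le_tsum_of_injective
      (Nat.cast_injective (R := ℤ)) _))
    refine ENNReal.tsum_le_tsum fun n => ?_
    rw [if_pos (two_rpow_ne_top _).lt_top]
    exact ENNReal.one_le_rpow (by norm_num) (by push_cast; positivity)
  · obtain ⟨m, h1, h2⟩ := exists_two_rpow_mem_Ioc h0 ht
    refine le_trans ?_ (ENNReal.le_tsum m)
    rw [if_pos h1, ENNReal.rpow_mul]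
    exact ENNReal.rpow_le_rpow h2 hp.le

/-! ### The Hardy–Littlewood maximal function over dyadic radii -/

/-- The average of `φ` over the ball of radius `2^k`. -/
noncomputable def ballAvg (φ : Rd d → ℝ≥0∞) (k : ℤ) (x : Rd d) : ℝ≥0∞ :=
  (∫⁻ y in Metric.closedBall x ((2 : ℝ) ^ k), φ y) / volume (Metric.closedBall x ((2 : ℝ) ^ k))

/-- The centred maximal function over balls of dyadic radius. -/
noncomputable def maxFun (φ : Rd d → ℝ≥0∞) (x : Rd d) : ℝ≥0∞ := ⨆ k : ℤ, ballAvg φ k x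

lemma volume_closedBall_eq (x : Rd d) {s : ℝ} (hs : 0 ≤ s) :
    volume (Metric.closedBall x s) = ENNReal.ofReal s ^ d * volume (Metric.ball (0 : Rd d) 1) := by
  rw [Measure.addHaar_closedBall _ _ hs, finrank_euclideanSpace_fin, ENNReal.ofReal_pow hs]

lemma ofReal_two_zpow (k : ℤ) : ENNReal.ofReal ((2 : ℝ) ^ k) = (2 : ℝ≥0∞) ^ (k : ℝ) := by
  rw [← Real.rpow_intCast, ← ENNReal.ofReal_rpow_of_pos two_pos, ENNReal.ofReal_ofNat]

lemma volume_closedBall_two_zpow (x : Rd d) (k : ℤ) :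
    volume (Metric.closedBall x ((2 : ℝ) ^ k)) =
      2 ^ ((k : ℝ) * d) * volume (Metric.ball (0 : Rd d) 1) := by
  rw [volume_closedBall_eq x (by positivity), ofReal_two_zpow, ENNReal.rpow_mul,
    ENNReal.rpow_natCast]

lemma volume_closedBall_ne_zero (x : Rd d) {s : ℝ} (hs : 0 < s) :
    volume (Metric.closedBall x s) ≠ 0 := (Metric.measure_closedBall_pos _ _ hs).ne'

lemma volume_closedBall_ne_top (x : Rd d) (s : ℝ) :
    volume (Metric.closedBall x s) ≠ ⊤ := measure_closedBall_lt_top.ne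

lemma measurable_setLIntegral_closedBall {φ : Rd d → ℝ≥0∞} (hφ : Measurable φ) (s : ℝ) :
    Measurable fun x => ∫⁻ y in Metric.closedBall x s, φ y := by
  have hm : MeasurableSet {z : Rd d × Rd d | dist z.2 z.1 ≤ s} :=
    measurableSet_le (by fun_prop) measurable_const
  have h := ((hφ.comp measurable_snd).indicator hm).lintegral_prod_right'
    (ν := (volume : Measure (Rd d)))
  have e : (fun x => ∫⁻ y in Metric.closedBall x s, φ y) = fun x => ∫⁻ y : Rd d,
      {z : Rd d × Rd d | dist z.2 z.1 ≤ s}.indicator (φ ∘ Prod.snd) (x, y) := by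
    funext x
    rw [← lintegral_indicator Metric.isClosed_closedBall.measurableSet]
    rfl
  rw [e]; exact h

lemma measurable_maxFun {φ : Rd d → ℝ≥0∞} (hφ : Measurable φ) : Measurable (maxFun φ) :=
  Measurable.iSup fun k => by
    have : ballAvg φ k = fun x => (∫⁻ y in Metric.closedBall x ((2 : ℝ) ^ k), φ y) /
        (2 ^ ((k : ℝ) * d) * volume (Metric.ball (0 : Rd d) 1)) := by
      funext x; rw [ballAvg, volume_closedBall_two_zpow]
    rw [this]
    exact (measurable_setLIntegral_closedBall hφ _).div_const _

/-- The weak `(1,1)` inequality. -/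
lemma mul_volume_lt_maxFun_le (hd : 1 ≤ d) {φ : Rd d → ℝ≥0∞} (t : ℝ≥0∞) (ht : t ≠ 0) :
    t * volume {x | t < maxFun φ x} ≤ 5 ^ d * ∫⁻ x, φ x := by
  rcases eq_or_ne (∫⁻ x, φ x) ⊤ with h | hfin
  · rw [h, ENNReal.mul_top (by simp)]; exact le_top
  set E := {x | t < maxFun φ x} with hE
  have hk : ∀ x : Rd d, ∃ k : ℤ, x ∈ E → t < ballAvg φ k x := by
    intro x
    by_cases hx : x ∈ E
    · obtain ⟨k, hk⟩ := lt_iSup_iff.1 (show t < ⨆ k, ballAvg φ k x from hx)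
      exact ⟨k, fun _ => hk⟩
    · exact ⟨0, fun h => absurd h hx⟩
  choose κ hκ using hk
  set r : Rd d → ℝ := fun x => (2 : ℝ) ^ κ x with hr
  have hr0 : ∀ x, 0 < r x := fun x => by positivity
  have hκ' : ∀ x ∈ E, t * volume (Metric.closedBall x (r x)) ≤
      ∫⁻ y in Metric.closedBall x (r x), φ y := fun x hx => by
    have := (hκ x hx).le
    rwa [ballAvg, ENNReal.le_div_iff_mul_le (Or.inl (volume_closedBall_ne_zero _ (hr0 x)))
      (Or.inl (volume_closedBall_ne_top _ _))] at this
  -- Vitali's lemma needs bounded radii. A selected ball has volume at most `∫ φ / t`, and for a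
  -- radius `r ≥ 1` one has `r ≤ r^d` because `d ≥ 1`.
  obtain ⟨R, hR⟩ : ∃ R : ℝ, ∀ x ∈ E, r x ≤ R := by
    set V := volume (Metric.ball (0 : Rd d) 1) with hV
    have hV0 : V ≠ 0 := (Metric.measure_ball_pos _ _ one_pos).ne'
    have hVt : V ≠ ⊤ := measure_ball_lt_top.ne
    have hq : (∫⁻ x, φ x) / (t * V) ≠ ⊤ := ENNReal.div_ne_top hfin (mul_ne_zero ht hV0)
    refine ⟨max 1 ((∫⁻ x, φ x) / (t * V)).toReal, fun x hx => ?_⟩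
    rcases le_total (r x) 1 with h1 | h1
    · exact h1.trans (le_max_left _ _)
    refine le_trans ?_ (le_max_right _ _)
    have h2 := (hκ' x hx).trans (setLIntegral_le_lintegral _ _)
    rw [volume_closedBall_eq x (hr0 x).le, ← hV] at h2
    have h3 : ENNReal.ofReal (r x) ≤ (∫⁻ x, φ x) / (t * V) := by
      refine ENNReal.le_div_iff_mul_le (Or.inl (mul_ne_zero ht hV0)) (Or.inr hfin) |>.2 ?_
      refine le_trans ?_ h2
      rw [mul_comm, mul_assoc t, mul_comm _ V]
      gcongr
      exact le_self_pow₀ (by rw [← ENNReal.ofReal_one]; exact ENNReal.ofReal_le_ofReal h1) (by omega)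
    exact (ENNReal.ofReal_le_iff_le_toReal hq).1 h3
  obtain ⟨u, huE, hdisj, hcov⟩ : ∃ u ⊆ E, (u.PairwiseDisjoint fun a => Metric.closedBall a (r a)) ∧
      ∀ a ∈ E, ∃ b ∈ u, Metric.closedBall a (r a) ⊆ Metric.closedBall b (5 * r b) := Vitali.exists_disjoint_subfamily_covering_enlargement_closedBall
    E id r R hR 5 (by norm_num)
  have hucount : u.Countable := hdisj.countable_of_nonempty_interior fun x hx =>
    ⟨x, mem_interior_iff_mem_nhds.2 (Metric.closedBall_mem_nhds _ (hr0 x))⟩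
  have hsub : E ⊆ ⋃ x ∈ u, Metric.closedBall x (5 * r x) := fun x hx => by
    obtain ⟨y, hy, hxy⟩ := hcov x hx
    exact Set.mem_biUnion hy (hxy (Metric.mem_closedBall_self (hr0 x).le))
  have := hucount.to_subtype
  calc t * volume E ≤ t * ∑' x : u, volume (Metric.closedBall (x : Rd d) (5 * r x)) := by
        gcongr
        exact (measure_mono hsub).trans (measure_biUnion_le _ hucount _)
    _ = 5 ^ d * ∑' x : u, t * volume (Metric.closedBall (x : Rd d) (r x)) := by
        rw [← ENNReal.tsum_mul_left, ← ENNReal.tsum_mul_left]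
        refine tsum_congr fun x => ?_
        rw [volume_closedBall_eq _ (by have := hr0 x; positivity),
          volume_closedBall_eq _ (hr0 x).le, ENNReal.ofReal_mul (by norm_num), mul_pow]
        simp only [ENNReal.ofReal_ofNat]
        ring
    _ ≤ 5 ^ d * ∑' x : u, ∫⁻ y in Metric.closedBall (x : Rd d) (r x), φ y := by
        gcongr with x
        exact hκ' x (huE x.2)
    _ = 5 ^ d * ∫⁻ y in ⋃ x ∈ u, Metric.closedBall x (r x), φ y := by
        rw [lintegral_biUnion hucount (fun x _ => Metric.isClosed_closedBall.measurableSet) hdisj]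
    _ ≤ _ := by gcongr; exact Measure.restrict_le_self

lemma maxFun_le_add {φ ψ : Rd d → ℝ≥0∞} {c : ℝ≥0∞} (hψ : Measurable ψ) (h : ∀ x, φ x ≤ ψ x + c)
    (x : Rd d) : maxFun φ x ≤ maxFun ψ x + c := by
  refine iSup_le fun k => le_trans ?_ (add_le_add_left (le_iSup (fun k => ballAvg ψ k x) k) c)
  have h0 := volume_closedBall_ne_zero x (s := (2 : ℝ) ^ k) (by positivity)
  have ht := volume_closedBall_ne_top x ((2 : ℝ) ^ k)
  rw [ballAvg, ballAvg, ENNReal.div_le_iff h0 ht, add_mul, ENNReal.div_mul_cancel h0 ht]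
  calc _ ≤ ∫⁻ y in Metric.closedBall x ((2 : ℝ) ^ k), (ψ y + c) := lintegral_mono h
    _ = _ := by rw [lintegral_add_left hψ, setLIntegral_const]

/-- The maximal function is bounded on `L^p`, `p > 1`. -/
theorem exists_lintegral_maxFun_rpow_le (hd : 1 ≤ d) {p : ℝ} (hp : 1 < p) : ∃ C : ℝ≥0,
    ∀ φ : Rd d → ℝ≥0∞, Measurable φ → ∫⁻ x, maxFun φ x ^ p ≤ C * ∫⁻ x, φ x ^ p := by
  obtain ⟨C, hC⟩ := exists_tsum_two_rpow_le (sub_pos.2 hp)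
  have hCt : (5 : ℝ≥0∞) ^ d * 2 ^ (p + 1) * C * 2 ^ (p - 1) ≠ ⊤ :=
    ENNReal.mul_ne_top (ENNReal.mul_ne_top (ENNReal.mul_ne_top
      (ENNReal.pow_ne_top ENNReal.ofNat_ne_top) (two_rpow_ne_top _)) ENNReal.coe_ne_top)
      (two_rpow_ne_top _)
  refine ⟨_, fun φ hφ => le_of_le_of_eq ?_ (congrArg (· * _) (ENNReal.coe_toNNReal hCt).symm)⟩
  have hmM := measurable_maxFun hφ
  -- Marcinkiewicz's splitting: the part of `φ` below `2^(k-1)` contributes at most `2^(k-1)` to the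
  -- maximal function, so the weak type inequality is applied only to the part above.
  have hlevel : ∀ k : ℤ, volume {x | (2 : ℝ≥0∞) ^ (k : ℝ) < maxFun φ x} ≤
      5 ^ d * 2 ^ (1 - (k : ℝ)) * ∫⁻ x, if (2 : ℝ≥0∞) ^ (k : ℝ) ≤ 2 * φ x then φ x else 0 := by
    intro k
    set ψ : Rd d → ℝ≥0∞ := fun x => if (2 : ℝ≥0∞) ^ (k : ℝ) ≤ 2 * φ x then φ x else 0 with hψ
    have hψm : Measurable ψ := Measurable.ite
      (measurableSet_le measurable_const (hφ.const_mul 2)) hφ measurable_const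
    have e2 : (2 : ℝ≥0∞) ^ (k : ℝ) = 2 * 2 ^ ((k : ℝ) - 1) := by
      nth_rewrite 2 [← ENNReal.rpow_one 2]
      rw [← two_rpow_add]; congr 1; ring
    have hle : ∀ x, φ x ≤ ψ x + 2 ^ ((k : ℝ) - 1) := fun x => by
      simp only [hψ]
      split_ifs with h
      · exact le_self_add
      · rw [zero_add]
        rw [e2, not_le, ENNReal.mul_lt_mul_iff_right two_ne_zero ENNReal.ofNat_ne_top] at h
        exact h.le
    have hsub : {x | (2 : ℝ≥0∞) ^ (k : ℝ) < maxFun φ x} ⊆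
        {x | (2 : ℝ≥0∞) ^ ((k : ℝ) - 1) < maxFun ψ x} := fun x hx => by
      by_contra hcon
      have h1 := maxFun_le_add hψm hle x
      have h2 : maxFun ψ x ≤ 2 ^ ((k : ℝ) - 1) := not_lt.1 hcon
      have h3 : maxFun φ x ≤ 2 ^ (k : ℝ) := by
        rw [e2, two_mul]; exact h1.trans (add_le_add_left h2 _)
      exact absurd hx (not_lt.2 h3)
    have hw := mul_volume_lt_maxFun_le hd (φ := ψ) (2 ^ ((k : ℝ) - 1)) (two_rpow_ne_zero _)
    calc _ ≤ volume {x | (2 : ℝ≥0∞) ^ ((k : ℝ) - 1) < maxFun ψ x} := measure_mono hsub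
      _ = 2 ^ (1 - (k : ℝ)) *
          (2 ^ ((k : ℝ) - 1) * volume {x | (2 : ℝ≥0∞) ^ ((k : ℝ) - 1) < maxFun ψ x}) := by
          rw [← mul_assoc, ← neg_sub (k : ℝ) 1, two_rpow_neg_mul, one_mul]
      _ ≤ 2 ^ (1 - (k : ℝ)) * (5 ^ d * ∫⁻ x, ψ x) := by gcongr
      _ = _ := by ring
  calc ∫⁻ x, maxFun φ x ^ p
      ≤ ∫⁻ x, ∑' k : ℤ, (if (2 : ℝ≥0∞) ^ (k : ℝ) < maxFun φ x then
          (2 : ℝ≥0∞) ^ (((k : ℝ) + 1) * p) else 0) :=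
        lintegral_mono fun x => rpow_le_tsum (by linarith) _
    _ = ∑' k : ℤ, (2 : ℝ≥0∞) ^ (((k : ℝ) + 1) * p) *
          volume {x | (2 : ℝ≥0∞) ^ (k : ℝ) < maxFun φ x} := by
        have hms : ∀ k : ℤ, MeasurableSet {x | (2 : ℝ≥0∞) ^ (k : ℝ) < maxFun φ x} := fun k =>
          measurableSet_lt measurable_const hmM
        rw [lintegral_tsum fun k => (Measurable.ite (hms k) measurable_const
          measurable_const).aemeasurable]
        refine tsum_congr fun k => ?_
        rw [← lintegral_indicator_const (hms k)]
        refine lintegral_congr fun x => ?_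
        simp [Set.indicator_apply]
    _ ≤ ∑' k : ℤ, (2 : ℝ≥0∞) ^ (((k : ℝ) + 1) * p) * (5 ^ d * 2 ^ (1 - (k : ℝ)) *
          ∫⁻ x, if (2 : ℝ≥0∞) ^ (k : ℝ) ≤ 2 * φ x then φ x else 0) := by
        gcongr with k
        exact hlevel k
    _ = 5 ^ d * 2 ^ (p + 1) * ∫⁻ x, ∑' k : ℤ, φ x *
          (if (2 : ℝ≥0∞) ^ (k : ℝ) ≤ 2 * φ x then 2 ^ ((k : ℝ) * (p - 1)) else 0) := by
        have hms : ∀ k : ℤ, MeasurableSet {x | (2 : ℝ≥0∞) ^ (k : ℝ) ≤ 2 * φ x} := fun k =>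
          measurableSet_le measurable_const (hφ.const_mul 2)
        have hm : ∀ k : ℤ, Measurable fun x => φ x *
            (if (2 : ℝ≥0∞) ^ (k : ℝ) ≤ 2 * φ x then (2 : ℝ≥0∞) ^ ((k : ℝ) * (p - 1)) else 0) :=
          fun k => hφ.mul (Measurable.ite (hms k) measurable_const measurable_const)
        rw [lintegral_tsum fun k => (hm k).aemeasurable, ← ENNReal.tsum_mul_left]
        refine tsum_congr fun k => ?_
        have e : ∀ x, φ x * (if (2 : ℝ≥0∞) ^ (k : ℝ) ≤ 2 * φ x then
            (2 : ℝ≥0∞) ^ ((k : ℝ) * (p - 1)) else 0) =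
            2 ^ ((k : ℝ) * (p - 1)) * if (2 : ℝ≥0∞) ^ (k : ℝ) ≤ 2 * φ x then φ x else 0 := by
          intro x; split_ifs <;> ring
        simp only [e]
        rw [lintegral_const_mul' _ _ (two_rpow_ne_top _), mul_left_comm, mul_assoc, mul_assoc]
        congr 1
        rw [← mul_assoc, ← mul_assoc, ← two_rpow_add, ← two_rpow_add]
        congr 2
        ring
    _ ≤ 5 ^ d * 2 ^ (p + 1) * ∫⁻ x, C * 2 ^ (p - 1) * φ x ^ p := by
        gcongr with x
        rw [ENNReal.tsum_mul_left]
        refine (mul_le_mul_right (hC (2 * φ x)) _).trans (le_of_eq ?_)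
        rw [ENNReal.mul_rpow_of_nonneg _ _ (sub_nonneg.2 hp.le)]
        have : φ x ^ p = φ x * φ x ^ (p - 1) := by
          nth_rewrite 2 [← ENNReal.rpow_one (φ x)]
          rw [← ENNReal.rpow_add_of_nonneg _ _ zero_le_one (by linarith)]
          congr 1; ring
        rw [this]; ring
    _ = _ := by
        rw [lintegral_const_mul' _ _ (ENNReal.mul_ne_top ENNReal.coe_ne_top (two_rpow_ne_top _))]
        ring

/-! ### The Hardy–Littlewood–Sobolev inequality -/

/-- The fractional integral of order `a`, without normalization. -/
noncomputable def fracInt (a : ℝ) (φ : Rd d → ℝ≥0∞) (x : Rd d) : ℝ≥0∞ :=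
  ∫⁻ y, ENNReal.ofReal (‖x - y‖ ^ (a - d)) * φ y

lemma measurable_fracInt (a : ℝ) {φ : Rd d → ℝ≥0∞} (hφ : Measurable φ) :
    Measurable (fracInt a φ) := by
  have h : Measurable fun z : Rd d × Rd d => ENNReal.ofReal (‖z.1 - z.2‖ ^ (a - d)) * φ z.2 :=
    (by fun_prop : Measurable fun z : Rd d × Rd d => ENNReal.ofReal (‖z.1 - z.2‖ ^ (a - d))).mul
      (hφ.comp measurable_snd)
  exact h.lintegral_prod_right'

lemma ofReal_rpow_norm_le_tsum {a : ℝ} (ha : a < d) (x y : Rd d) :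
    ENNReal.ofReal (‖x - y‖ ^ (a - d)) ≤ ∑' k : ℤ, (2 : ℝ≥0∞) ^ (((k : ℝ) - 1) * (a - d)) *
      (Metric.closedBall x ((2 : ℝ) ^ k)).indicator 1 y := by
  rcases eq_or_ne x y with rfl | hxy
  -- On the diagonal the left side is `0`, since the real power of `0` with a nonzero exponent is
  -- `0`.
  · simp [Real.zero_rpow (sub_neg.2 ha).ne]
  have hpos : 0 < ‖x - y‖ := norm_sub_pos_iff.2 hxy
  obtain ⟨m, h1, h2⟩ := exists_two_rpow_mem_Ioc (b := ENNReal.ofReal ‖x - y‖)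
    (by simpa using hxy |> sub_ne_zero.2) ENNReal.ofReal_ne_top
  refine le_trans ?_ (ENNReal.le_tsum (m + 1))
  have hmem : y ∈ Metric.closedBall x ((2 : ℝ) ^ (m + 1)) := by
    rw [Metric.mem_closedBall, dist_comm, dist_eq_norm]
    have h3 := ofReal_two_zpow (m + 1)
    push_cast at h3
    rw [← h3] at h2
    exact (ENNReal.ofReal_le_ofReal_iff (by positivity)).1 h2
  rw [Set.indicator_of_mem hmem, Pi.one_apply, mul_one, ← ENNReal.ofReal_rpow_of_pos hpos]
  push_cast
  rw [add_sub_cancel_right, ENNReal.rpow_mul]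
  rw [← neg_sub (d : ℝ) a, ENNReal.rpow_neg, ENNReal.rpow_neg, ENNReal.inv_le_inv]
  exact ENNReal.rpow_le_rpow h1.le (sub_nonneg.2 ha.le)

lemma fracInt_le_tsum {a : ℝ} (ha : a < d) {φ : Rd d → ℝ≥0∞} (hφ : Measurable φ) (x : Rd d) :
    fracInt a φ x ≤ 2 ^ (d - a) * volume (Metric.ball (0 : Rd d) 1) *
      ∑' k : ℤ, 2 ^ ((k : ℝ) * a) * ballAvg φ k x := by
  have hms : ∀ k : ℤ, MeasurableSet (Metric.closedBall x ((2 : ℝ) ^ k)) := fun k =>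
    Metric.isClosed_closedBall.measurableSet
  calc fracInt a φ x ≤ ∫⁻ y, ∑' k : ℤ, (2 : ℝ≥0∞) ^ (((k : ℝ) - 1) * (a - d)) *
          (Metric.closedBall x ((2 : ℝ) ^ k)).indicator φ y := by
        refine lintegral_mono fun y => ?_
        refine (mul_le_mul_left (ofReal_rpow_norm_le_tsum ha x y) _).trans (le_of_eq ?_)
        rw [← ENNReal.tsum_mul_right]
        refine tsum_congr fun k => ?_
        rw [mul_assoc]
        congr 1
        by_cases hy : y ∈ Metric.closedBall x ((2 : ℝ) ^ k)
        · rw [Set.indicator_of_mem hy, Set.indicator_of_mem hy, Pi.one_apply, one_mul]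
        · rw [Set.indicator_of_notMem hy, Set.indicator_of_notMem hy, zero_mul]
    _ = ∑' k : ℤ, (2 : ℝ≥0∞) ^ (((k : ℝ) - 1) * (a - d)) *
          ∫⁻ y in Metric.closedBall x ((2 : ℝ) ^ k), φ y := by
        rw [lintegral_tsum fun k => ((hφ.indicator (hms k)).const_mul _).aemeasurable]
        refine tsum_congr fun k => ?_
        rw [lintegral_const_mul' _ _ (two_rpow_ne_top _), lintegral_indicator (hms k)]
    _ = _ := by
        rw [← ENNReal.tsum_mul_left]
        refine tsum_congr fun k => ?_
        have h0 := volume_closedBall_ne_zero x (s := (2 : ℝ) ^ k) (by positivity)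
        have ht := volume_closedBall_ne_top x ((2 : ℝ) ^ k)
        have e : ∫⁻ y in Metric.closedBall x ((2 : ℝ) ^ k), φ y =
            ballAvg φ k x * (2 ^ ((k : ℝ) * d) * volume (Metric.ball (0 : Rd d) 1)) := by
          rw [← volume_closedBall_two_zpow x, ballAvg, ENNReal.div_mul_cancel h0 ht]
        have e2 : (2 : ℝ≥0∞) ^ (((k : ℝ) - 1) * (a - d)) * 2 ^ ((k : ℝ) * d) =
            2 ^ ((d : ℝ) - a) * 2 ^ ((k : ℝ) * a) := by
          rw [← two_rpow_add, ← two_rpow_add]; congr 1; ring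
        calc _ = ((2 : ℝ≥0∞) ^ (((k : ℝ) - 1) * (a - d)) * 2 ^ ((k : ℝ) * d)) *
              volume (Metric.ball (0 : Rd d) 1) * ballAvg φ k x := by rw [e]; ring
          _ = _ := by rw [e2]; ring

lemma ballAvg_le {p : ℝ} (hp : 1 < p) {φ : Rd d → ℝ≥0∞} (hφ : Measurable φ) (k : ℤ) (x : Rd d) :
    ballAvg φ k x ≤ (∫⁻ y, φ y ^ p) ^ (1 / p) *
      volume (Metric.ball (0 : Rd d) 1) ^ (-(1 / p)) * 2 ^ (-((k : ℝ) * (d / p))) := by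
  have hpq := Real.HolderConjugate.conjExponent hp
  have h0 := volume_closedBall_ne_zero x (s := (2 : ℝ) ^ k) (by positivity)
  have ht := volume_closedBall_ne_top x ((2 : ℝ) ^ k)
  set V := volume (Metric.closedBall x ((2 : ℝ) ^ k)) with hV
  have h1 := ENNReal.lintegral_mul_le_Lp_mul_Lq
    (volume.restrict (Metric.closedBall x ((2 : ℝ) ^ k))) hpq hφ.aemeasurable
    (aemeasurable_const (b := (1 : ℝ≥0∞)))
  simp only [Pi.mul_apply, mul_one, ENNReal.one_rpow, setLIntegral_one, ← hV] at h1
  have e : V ^ (-(1 / p)) = volume (Metric.ball (0 : Rd d) 1) ^ (-(1 / p)) *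
      2 ^ (-((k : ℝ) * (d / p))) := by
    rw [hV, volume_closedBall_two_zpow, ENNReal.mul_rpow_of_ne_zero (two_rpow_ne_zero _)
      (Metric.measure_ball_pos _ _ one_pos).ne', ← ENNReal.rpow_mul, mul_comm]
    congr 2; ring
  rw [mul_assoc, ← e, ballAvg, ENNReal.div_le_iff h0 ht, mul_assoc]
  refine h1.trans ?_
  have e2 : V ^ (-(1 / p)) * V = V ^ (1 / p.conjExponent) := by
    nth_rewrite 2 [← ENNReal.rpow_one V]
    rw [← ENNReal.rpow_add _ _ h0 ht]
    congr 1
    have := hpq.inv_add_inv_eq_one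
    simp only [one_div]; linarith
  rw [e2]
  gcongr
  exact Measure.restrict_le_self

/-- Hedberg's inequality. -/
lemma exists_fracInt_le (hd : 1 ≤ d) {a p : ℝ} (hp : 1 < p) (ha : 0 < a) (hap : a < d / p) :
    ∃ C : ℝ≥0, ∀ φ : Rd d → ℝ≥0∞, Measurable φ → ∀ x : Rd d,
      fracInt a φ x ≤ C * (maxFun φ x ^ (1 - a / (d / p)) *
        ((∫⁻ y, φ y ^ p) ^ (1 / p)) ^ (a / (d / p))) := by
  obtain ⟨C, hC⟩ := exists_tsum_min_le ha hap
  have hd' : (0 : ℝ) < d := by exact_mod_cast hd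
  have hγ : (0 : ℝ) < d / p := by positivity
  have had : a < d := hap.trans_le (div_le_self hd'.le hp.le)
  set V := volume (Metric.ball (0 : Rd d) 1) with hV
  have hV0 : V ≠ 0 := (Metric.measure_ball_pos _ _ one_pos).ne'
  have hVt : V ≠ ⊤ := measure_ball_lt_top.ne
  have hCt : 2 ^ (d - a) * V * C * (V ^ (-(1 / p))) ^ (a / (d / p)) ≠ ⊤ :=
    ENNReal.mul_ne_top (ENNReal.mul_ne_top (ENNReal.mul_ne_top (two_rpow_ne_top _) hVt)
      ENNReal.coe_ne_top) (ENNReal.rpow_ne_top_of_nonneg (by positivity)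
        (ENNReal.rpow_ne_top_of_ne_zero hV0 hVt))
  refine ⟨_, fun φ hφ x => le_of_le_of_eq ?_ (congrArg (· * _) (ENNReal.coe_toNNReal hCt).symm)⟩
  calc fracInt a φ x ≤ 2 ^ (d - a) * V * ∑' k : ℤ, 2 ^ ((k : ℝ) * a) * ballAvg φ k x :=
        fracInt_le_tsum had hφ x
    -- Each average is bounded both by the maximal function and, through Hölder's inequality, by the
    -- `L^p` norm with decay `2^(-k d/p)`; the sum of the minima interpolates between the two.
    _ ≤ 2 ^ (d - a) * V * ∑' k : ℤ, 2 ^ ((k : ℝ) * a) * min (maxFun φ x)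
          ((∫⁻ y, φ y ^ p) ^ (1 / p) * V ^ (-(1 / p)) * 2 ^ (-((k : ℝ) * (d / p)))) := by
        gcongr with k
        exact le_min (le_iSup (fun k => ballAvg φ k x) k) (ballAvg_le hp hφ k x)
    _ ≤ 2 ^ (d - a) * V * (C * (maxFun φ x ^ (1 - a / (d / p)) *
          ((∫⁻ y, φ y ^ p) ^ (1 / p) * V ^ (-(1 / p))) ^ (a / (d / p)))) := by
        gcongr
        exact hC _ _
    _ = _ := by
        rw [ENNReal.mul_rpow_of_nonneg _ _ (by positivity)]
        ring

/-- The Hardy–Littlewood–Sobolev inequality. -/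
theorem exists_fracInt_rpow_le (hd : 1 ≤ d) {a p s : ℝ} (hp : 1 < p) (ha : 0 < a)
    (hap : a < d / p) (hs : 1 / s = 1 / p - a / d) :
    ∃ C : ℝ≥0, ∀ φ : Rd d → ℝ≥0∞, Measurable φ →
      (∫⁻ x, fracInt a φ x ^ s) ^ (1 / s) ≤ C * (∫⁻ y, φ y ^ p) ^ (1 / p) := by
  obtain ⟨C₁, h₁⟩ := exists_fracInt_le hd hp ha hap
  obtain ⟨C₂, h₂⟩ := exists_lintegral_maxFun_rpow_le hd hp
  have hd' : (0 : ℝ) < d := by exact_mod_cast hd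
  have hp0 : 0 < p := by linarith
  set θ := a / (d / p) with hθ
  have hθ0 : 0 < θ := by positivity
  have hθ1 : θ < 1 := by rw [hθ, div_lt_one (by positivity)]; exact hap
  have hs' : 1 / s = (1 - θ) / p := by rw [hs, hθ]; field_simp
  have hs0 : 0 < s := by
    rw [← one_div_pos, hs']; exact div_pos (by linarith) hp0
  -- In the `s`-th power of Hedberg's inequality the maximal function then occurs exactly to the
  -- power `p`.
  have hsp : (1 - θ) * s = p := by field_simp at hs'; linarith
  have hCt : (C₁ : ℝ≥0∞) * (C₂ : ℝ≥0∞) ^ (1 / s) ≠ ⊤ := ENNReal.mul_ne_top ENNReal.coe_ne_top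
    (ENNReal.rpow_ne_top_of_nonneg (by positivity) ENNReal.coe_ne_top)
  refine ⟨_, fun φ hφ => le_of_le_of_eq ?_ (congrArg (· * _) (ENNReal.coe_toNNReal hCt).symm)⟩
  set I := ∫⁻ y, φ y ^ p with hI
  calc (∫⁻ x, fracInt a φ x ^ s) ^ (1 / s)
      ≤ (∫⁻ x, (C₁ : ℝ≥0∞) ^ s * (I ^ (1 / p)) ^ (θ * s) * maxFun φ x ^ p) ^ (1 / s) := by
        gcongr with x
        refine (ENNReal.rpow_le_rpow (h₁ φ hφ x) hs0.le).trans (le_of_eq ?_)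
        rw [ENNReal.mul_rpow_of_nonneg _ _ hs0.le, ENNReal.mul_rpow_of_nonneg _ _ hs0.le,
          ← ENNReal.rpow_mul, ← ENNReal.rpow_mul _ θ, hsp]
        ring
    _ ≤ ((C₁ : ℝ≥0∞) ^ s * (I ^ (1 / p)) ^ (θ * s) * (C₂ * I)) ^ (1 / s) := by
        rw [lintegral_const_mul _ ((measurable_maxFun hφ).pow_const p)]
        gcongr
        exact h₂ φ hφ
    _ = C₁ * (C₂ : ℝ≥0∞) ^ (1 / s) * ((I ^ (1 / p)) ^ θ * I ^ (1 / s)) := by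
        have h1s : 0 ≤ 1 / s := by positivity
        rw [ENNReal.mul_rpow_of_nonneg _ _ h1s, ENNReal.mul_rpow_of_nonneg _ _ h1s,
          ENNReal.mul_rpow_of_nonneg _ _ h1s, ← ENNReal.rpow_mul, ← ENNReal.rpow_mul _ (θ * s),
          mul_one_div_cancel hs0.ne', ENNReal.rpow_one, mul_assoc θ, mul_one_div_cancel hs0.ne',
          mul_one]
        ring
    _ = _ := by
        rw [← ENNReal.rpow_mul, ← ENNReal.rpow_add_of_nonneg _ _ (by positivity) (by positivity)]
        congr 2
        rw [hs']; ring

/-- A product of two fractional integrals is bounded `L^p × L^q → L^r`. -/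
theorem exists_fracInt_mul_fracInt_le (hd : 1 ≤ d) {p q r : ℝ} (hp : 1 < p) (hq : 1 < q)
    (hr : 0 < r) (h : 1 / r < 1 / p + 1 / q) :
    ∃ a₁ a₂ : ℝ, 0 < a₁ ∧ 0 < a₂ ∧ a₁ < d / p ∧ a₂ < d / q ∧
      a₁ + a₂ = d * (1 / p + 1 / q - 1 / r) ∧
      ∃ C : ℝ≥0, ∀ φ ψ : Rd d → ℝ≥0∞, Measurable φ → Measurable ψ →
        (∫⁻ x, (fracInt a₁ φ x * fracInt a₂ ψ x) ^ r) ^ (1 / r) ≤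
          C * (∫⁻ y, φ y ^ p) ^ (1 / p) * (∫⁻ y, ψ y ^ q) ^ (1 / q) := by
  have hd' : (0 : ℝ) < d := by exact_mod_cast hd
  have hp0 : 0 < p := by linarith
  have hq0 : 0 < q := by linarith
  set σ := 1 / p + 1 / q with hσ
  have hσ0 : 0 < σ := by positivity
  -- With orders `θ d/p` and `θ d/q` the Sobolev exponents are `p/(1-θ)` and `q/(1-θ)`. Their
  -- reciprocals sum to `(1-θ)σ`, and `θ` is chosen to make this `1/r`; `0 < 1/r < σ` gives `0 < θ <
  -- 1`.
  set θ := (σ - 1 / r) / σ with hθ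
  have hθ0 : 0 < θ := div_pos (by linarith) hσ0
  have hr' : 0 < 1 / r := by positivity
  have hθ1 : θ < 1 := by rw [hθ, div_lt_one hσ0]; linarith
  have hθσ : (1 - θ) * σ = 1 / r := by rw [hθ]; field_simp; ring
  have hlt : ∀ {u : ℝ}, 0 < u → θ * (d / u) < d / u := fun {u} hu => by
    have : 0 < (d : ℝ) / u := by positivity
    nlinarith
  set s := p / (1 - θ) with hs
  set t := q / (1 - θ) with ht
  have h1θ : 0 < 1 - θ := by linarith
  have hs0 : 0 < s := by positivity
  have ht0 : 0 < t := by positivity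
  have hs1 : 1 / s = 1 / p - θ * (d / p) / d := by rw [hs]; field_simp
  have ht1 : 1 / t = 1 / q - θ * (d / q) / d := by rw [ht]; field_simp
  have hrst : 1 / r = 1 / s + 1 / t := by
    rw [← hθσ, hs1, ht1, hσ]; field_simp
  have hrs : r < s := by
    have : 1 / s < 1 / r := by rw [hrst]; have : 0 < 1 / t := by positivity
                               linarith
    exact (one_div_lt_one_div hs0 hr).1 this
  obtain ⟨C₁, h₁⟩ := exists_fracInt_rpow_le hd hp (a := θ * (d / p)) (by positivity) (hlt hp0) hs1
  obtain ⟨C₂, h₂⟩ := exists_fracInt_rpow_le hd hq (a := θ * (d / q)) (by positivity) (hlt hq0) ht1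
  refine ⟨θ * (d / p), θ * (d / q), by positivity, by positivity, hlt hp0, hlt hq0, ?_, C₁ * C₂,
    fun φ ψ hφ hψ => ?_⟩
  · have : θ * (d / p) + θ * (d / q) = d * (σ - (1 - θ) * σ) := by rw [hσ]; ring
    rw [this, hθσ]
  · have hH := ENNReal.lintegral_Lp_mul_le_Lq_mul_Lr hr hrs hrst volume
      (measurable_fracInt (θ * (d / p)) hφ).aemeasurable
      (measurable_fracInt (θ * (d / q)) hψ).aemeasurable
    refine hH.trans ((mul_le_mul' (h₁ φ hφ) (h₂ ψ hψ)).trans (le_of_eq ?_))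
    push_cast; ring

/-! ### Boundedness of the commutator integral -/

section bound

variable {K : Rd d → Rd d → Rd d → ℂ} {cK : ℝ≥0} {ω : ℝ → ℝ} {b f f' g g' : Rd d → ℂ}
  {p q r a₁ a₂ : ℝ} {H C : ℝ≥0} {s : Set (Rd d)}

/-- Factor out `u^(a₁-d)` and write the remaining numerator as `u^(a₂+d) ≤ (u+v)^(a₂+d)`. What is
left is `(u+v)^(a₂-d) ≤ v^(a₂-d)`, the exponent being negative. -/
lemma rpow_div_pow_le {a₁ a₂ u v : ℝ} (hu : 0 < u) (hv : 0 < v) (h0 : 0 < a₂) (h2 : a₂ < d) :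
    u ^ (a₁ + a₂) / (u + v) ^ (2 * d) ≤ u ^ (a₁ - d) * v ^ (a₂ - d) := by
  have huv : 0 < u + v := by positivity
  have e : u ^ (a₁ + a₂) / (u + v) ^ (2 * d) =
      u ^ (a₁ - d) * (u ^ (a₂ + d) * (u + v) ^ (-(2 * d : ℝ))) := by
    rw [← mul_assoc, ← Real.rpow_add hu, Real.rpow_neg huv.le, div_eq_mul_inv,
      show a₁ - d + (a₂ + d) = a₁ + a₂ by ring, ← Real.rpow_natCast]
    push_cast
    rfl
  rw [e]
  gcongr
  calc u ^ (a₂ + d) * (u + v) ^ (-(2 * d : ℝ))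
      ≤ (u + v) ^ (a₂ + d) * (u + v) ^ (-(2 * d : ℝ)) := by
        gcongr
        linarith
    _ = (u + v) ^ (a₂ - d) := by rw [← Real.rpow_add huv]; congr 1; ring
    _ ≤ v ^ (a₂ - d) := Real.rpow_le_rpow_of_nonpos hv (by linarith) (by linarith)

lemma ae_enorm_sub_mul_le (hd : 1 ≤ d) (hK : IsCZKernel K cK ω)
    (hs : ∀ᵐ x ∂(volume : Measure (Rd d)), x ∈ s) (h0 : 0 < a₂) (h2 : a₂ < d)
    (hb : ∀ x ∈ s, ∀ y ∈ s, ‖b x - b y‖ ≤ H * ‖x - y‖ ^ (a₁ + a₂)) {x : Rd d} (hx : x ∈ s) :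
    ∀ᵐ w : Rd d × Rd d, ‖(b x - b w.1) * K x w.1 w.2‖ₑ ≤ H * cK *
      (ENNReal.ofReal (‖x - w.1‖ ^ (a₁ - d)) * ENNReal.ofReal (‖x - w.2‖ ^ (a₂ - d))) := by
  -- Positive dimension makes points null, so `y = x` and `z = x` may be excluded.
  have : Nonempty (Fin d) := ⟨⟨0, hd⟩⟩
  have hne : ∀ᵐ y ∂(volume : Measure (Rd d)), y ≠ x := by
    simp [ae_iff]
  rw [Measure.volume_eq_prod]
  filter_upwards [Measure.quasiMeasurePreserving_fst.ae hs, Measure.quasiMeasurePreserving_fst.ae hne,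
    Measure.quasiMeasurePreserving_snd.ae hne] with w h1 h3 h4
  have hu : 0 < ‖x - w.1‖ := norm_sub_pos_iff.2 (Ne.symm h3)
  have hv : 0 < ‖x - w.2‖ := norm_sub_pos_iff.2 (Ne.symm h4)
  have hk := hK.size x w.1 w.2 fun h => h3 h.1.symm
  have : ‖(b x - b w.1) * K x w.1 w.2‖ ≤ (H * cK) *
      (‖x - w.1‖ ^ (a₁ - d) * ‖x - w.2‖ ^ (a₂ - d)) := by
    rw [norm_mul]
    calc _ ≤ (H * ‖x - w.1‖ ^ (a₁ + a₂)) * (cK / (‖x - w.1‖ + ‖x - w.2‖) ^ (2 * d)) :=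
          mul_le_mul (hb x hx _ h1) hk (norm_nonneg _) (by positivity)
      _ = H * cK * (‖x - w.1‖ ^ (a₁ + a₂) / (‖x - w.1‖ + ‖x - w.2‖) ^ (2 * d)) := by ring
      _ ≤ _ := by
        gcongr
        exact rpow_div_pow_le hu hv h0 h2
  rw [← ofReal_norm, ← ENNReal.ofReal_mul (by positivity), ← ENNReal.ofReal_coe_nnreal,
    ← ENNReal.ofReal_coe_nnreal (p := cK), ← ENNReal.ofReal_mul (by positivity),
    ← ENNReal.ofReal_mul (by positivity)]
  exact ENNReal.ofReal_le_ofReal this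

lemma lintegral_enorm_commutator_le (hd : 1 ≤ d) (hK : IsCZKernel K cK ω)
    (hs : ∀ᵐ x ∂(volume : Measure (Rd d)), x ∈ s) (h0 : 0 < a₂) (h2 : a₂ < d)
    (hb : ∀ x ∈ s, ∀ y ∈ s, ‖b x - b y‖ ≤ H * ‖x - y‖ ^ (a₁ + a₂))
    (hf : Measurable f) (hg : Measurable g) {x : Rd d} (hx : x ∈ s) :
    ∫⁻ w : Rd d × Rd d, ‖(b x - b w.1) * K x w.1 w.2 * (f w.1 * g w.2)‖ₑ ≤
      H * cK * (fracInt a₁ (fun y => ‖f y‖ₑ) x * fracInt a₂ (fun y => ‖g y‖ₑ) x) := by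
  have hm : ∀ (a : ℝ) {f : Rd d → ℂ}, Measurable f →
      AEMeasurable (fun y => ENNReal.ofReal (‖x - y‖ ^ (a - d)) * ‖f y‖ₑ) volume :=
    fun a f hf => ((by fun_prop : Measurable fun y : Rd d =>
      ENNReal.ofReal (‖x - y‖ ^ (a - d))).mul hf.enorm).aemeasurable
  calc _ ≤ ∫⁻ w : Rd d × Rd d, H * cK * ((ENNReal.ofReal (‖x - w.1‖ ^ (a₁ - d)) * ‖f w.1‖ₑ) *
          (ENNReal.ofReal (‖x - w.2‖ ^ (a₂ - d)) * ‖g w.2‖ₑ)) := by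
        refine lintegral_mono_ae ?_
        filter_upwards [ae_enorm_sub_mul_le hd hK hs h0 h2 hb hx] with w hw
        rw [enorm_mul, enorm_mul (f w.1)]
        refine (mul_le_mul_left hw _).trans (le_of_eq ?_)
        ring
    _ = _ := by
        rw [lintegral_const_mul' _ _ (ENNReal.mul_ne_top ENNReal.coe_ne_top ENNReal.coe_ne_top),
          Measure.volume_eq_prod, lintegral_prod_mul (hm a₁ hf) (hm a₂ hg)]
        rfl

/-- The values of `K` on the diagonal are arbitrary and need not be measurable there; they are
annihilated by `b x - b w.1`. -/
lemma sub_mul_kernel_eq_indicator (b : Rd d → ℂ) (x : Rd d) (w : Rd d × Rd d) :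
    (b x - b w.1) * K x w.1 w.2 = (b x - b w.1) *
      (offDiag d).indicator (fun z : Rd d × Rd d × Rd d => K z.1 z.2.1 z.2.2) (x, w) := by
  by_cases h : (x, w) ∈ offDiag d
  · rw [Set.indicator_of_mem h]
  · have : x = w.1 ∧ w.1 = w.2 := by simpa [offDiag] using h
    rw [← this.1, sub_self, zero_mul, zero_mul]

lemma aestronglyMeasurable_commutator_integrand (hK : IsCZKernel K cK ω)
    (hbm : AEStronglyMeasurable b volume) (hf : Measurable f) (hg : Measurable g) (x : Rd d) :
    AEStronglyMeasurable (fun w : Rd d × Rd d => (b x - b w.1) * K x w.1 w.2 * (f w.1 * g w.2))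
      volume := by
  simp only [sub_mul_kernel_eq_indicator b x]
  have hm := measurable_kernel_indicator hK
  refine AEStronglyMeasurable.mul (AEStronglyMeasurable.mul (aestronglyMeasurable_const.sub ?_)
    (hm.comp measurable_prodMk_left).aestronglyMeasurable) ?_
  · exact hbm.comp_fst
  · exact ((hf.comp measurable_fst).mul (hg.comp measurable_snd)).aestronglyMeasurable

lemma aestronglyMeasurable_commutatorIntegral_of_measurable (hK : IsCZKernel K cK ω)
    (hbm : AEStronglyMeasurable b volume) (hf : Measurable f) (hg : Measurable g) :
    AEStronglyMeasurable (commutatorIntegral K b f g) volume := by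
  have hm := measurable_kernel_indicator hK
  have h : AEStronglyMeasurable (fun z : Rd d × Rd d × Rd d => (b z.1 - b z.2.1) *
      (offDiag d).indicator (fun z : Rd d × Rd d × Rd d => K z.1 z.2.1 z.2.2) z *
      (f z.2.1 * g z.2.2)) (volume.prod volume) := by
    refine AEStronglyMeasurable.mul (AEStronglyMeasurable.mul (hbm.comp_fst.sub ?_)
      hm.aestronglyMeasurable) ?_
    · exact (hbm.comp_fst (ν := (volume : Measure (Rd d)))).comp_snd
    · exact ((hf.comp (measurable_fst.comp measurable_snd)).mul
        (hg.comp (measurable_snd.comp measurable_snd))).aestronglyMeasurable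
  refine h.integral_prod_right'.congr (Eventually.of_forall fun x => ?_)
  simp only [commutatorIntegral, sub_mul_kernel_eq_indicator b x]

lemma ae_prod_congr (hf : f =ᵐ[volume] f') (hg : g =ᵐ[volume] g') (x : Rd d) :
    (fun w : Rd d × Rd d => (b x - b w.1) * K x w.1 w.2 * (f w.1 * g w.2)) =ᵐ[volume]
      fun w => (b x - b w.1) * K x w.1 w.2 * (f' w.1 * g' w.2) := by
  rw [Measure.volume_eq_prod]
  filter_upwards [Measure.quasiMeasurePreserving_fst.ae hf,
    Measure.quasiMeasurePreserving_snd.ae hg] with w h1 h2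
  rw [h1, h2]

lemma commutatorIntegral_congr (hf : f =ᵐ[volume] f') (hg : g =ᵐ[volume] g') :
    commutatorIntegral K b f g = commutatorIntegral K b f' g' := by
  funext x
  exact integral_congr_ae (ae_prod_congr hf hg x)

/-- A bound for products of fractional integrals yields one for the commutator. -/
lemma ae_integrable_and_eLpNorm_commutatorIntegral_le (hd : 1 ≤ d) (hK : IsCZKernel K cK ω)
    (hbm : AEStronglyMeasurable b volume) (hs : ∀ᵐ x ∂(volume : Measure (Rd d)), x ∈ s)
    (h0 : 0 < a₂) (h2 : a₂ < d)
    (hb : ∀ x ∈ s, ∀ y ∈ s, ‖b x - b y‖ ≤ H * ‖x - y‖ ^ (a₁ + a₂))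
    (hp : 0 < p) (hq : 0 < q) (hr : 0 < r)
    (hC : ∀ φ ψ : Rd d → ℝ≥0∞, Measurable φ → Measurable ψ →
        (∫⁻ x, (fracInt a₁ φ x * fracInt a₂ ψ x) ^ r) ^ (1 / r) ≤
          C * (∫⁻ y, φ y ^ p) ^ (1 / p) * (∫⁻ y, ψ y ^ q) ^ (1 / q))
    (hf : Measurable f) (hg : Measurable g) (hfp : MemLp f (ENNReal.ofReal p) volume)
    (hgq : MemLp g (ENNReal.ofReal q) volume) :
    (∀ᵐ x ∂(volume : Measure (Rd d)), Integrable (fun w : Rd d × Rd d =>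
      (b x - b w.1) * K x w.1 w.2 * (f w.1 * g w.2)) volume) ∧
    eLpNorm (commutatorIntegral K b f g) (ENNReal.ofReal r) volume ≤
      H * cK * C * eLpNorm f (ENNReal.ofReal p) volume * eLpNorm g (ENNReal.ofReal q) volume := by
  have hnorm : ∀ {u : ℝ} (_ : 0 < u) (h : Rd d → ℂ), eLpNorm h (ENNReal.ofReal u) volume =
      (∫⁻ x, ‖h x‖ₑ ^ u) ^ (1 / u) := fun {u} hu h => by
    rw [eLpNorm_eq_lintegral_rpow_enorm_toReal (by simpa using hu) ENNReal.ofReal_ne_top,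
      ENNReal.toReal_ofReal hu.le]
  have hCfg := hC _ _ hf.enorm hg.enorm
  rw [← hnorm hp, ← hnorm hq] at hCfg
  set F := fun x => fracInt a₁ (fun y => ‖f y‖ₑ) x * fracInt a₂ (fun y => ‖g y‖ₑ) x with hF
  have hFm : Measurable F := (measurable_fracInt a₁ hf.enorm).mul (measurable_fracInt a₂ hg.enorm)
  have hle : ∀ᵐ x ∂(volume : Measure (Rd d)), ∫⁻ w : Rd d × Rd d,
      ‖(b x - b w.1) * K x w.1 w.2 * (f w.1 * g w.2)‖ₑ ≤ H * cK * F x := by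
    filter_upwards [hs] with x hx
    exact lintegral_enorm_commutator_le hd hK hs h0 h2 hb hf hg hx
  -- The norm bound itself shows that the dominating product is finite almost everywhere, which
  -- yields absolute convergence without a separate argument.
  have hfin : ∀ᵐ x ∂(volume : Measure (Rd d)), F x < ⊤ := by
    have h1 : ∫⁻ x, F x ^ r ≠ ⊤ := fun h => by
      rw [h, ENNReal.top_rpow_of_pos (by positivity)] at hCfg
      exact ENNReal.mul_ne_top (ENNReal.mul_ne_top ENNReal.coe_ne_top hfp.2.ne) hgq.2.ne
        (top_le_iff.1 hCfg)
    filter_upwards [ae_lt_top (hFm.pow_const r) h1] with x hx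
    exact (ENNReal.rpow_lt_top_iff_of_pos hr).1 hx
  refine ⟨?_, ?_⟩
  · filter_upwards [hle, hfin] with x h1 h3
    exact ⟨aestronglyMeasurable_commutator_integrand hK hbm hf hg x, h1.trans_lt
      (ENNReal.mul_lt_top (ENNReal.mul_lt_top ENNReal.coe_lt_top ENNReal.coe_lt_top) h3)⟩
  · rw [hnorm hr]
    calc _ ≤ (∫⁻ x, ((H * cK : ℝ≥0∞)) ^ r * F x ^ r) ^ (1 / r) := by
          refine ENNReal.rpow_le_rpow (lintegral_mono_ae ?_) (by positivity)
          filter_upwards [hle] with x hx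
          rw [← ENNReal.mul_rpow_of_nonneg _ _ hr.le]
          exact ENNReal.rpow_le_rpow ((enorm_integral_le_lintegral_enorm _).trans hx) hr.le
      _ = H * cK * (∫⁻ x, F x ^ r) ^ (1 / r) := by
          rw [lintegral_const_mul _ (hFm.pow_const r), ENNReal.mul_rpow_of_nonneg _ _ (by positivity),
            ← ENNReal.rpow_mul, mul_one_div_cancel hr.ne', ENNReal.rpow_one]
      _ ≤ H * cK * (C * eLpNorm f (ENNReal.ofReal p) volume *
            eLpNorm g (ENNReal.ofReal q) volume) := by gcongr
      _ = _ := by ring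

lemma commutatorIntegral_add_left {x : Rd d}
    (h : Integrable (fun w : Rd d × Rd d => (b x - b w.1) * K x w.1 w.2 * (f w.1 * g w.2)) volume)
    (h' : Integrable (fun w : Rd d × Rd d => (b x - b w.1) * K x w.1 w.2 * (f' w.1 * g w.2))
      volume) :
    commutatorIntegral K b (f + f') g x =
      commutatorIntegral K b f g x + commutatorIntegral K b f' g x := by
  simp only [commutatorIntegral]
  rw [← integral_add h h']
  congr 1; funext w; simp only [Pi.add_apply]; ring

lemma commutatorIntegral_add_right {x : Rd d}
    (h : Integrable (fun w : Rd d × Rd d => (b x - b w.1) * K x w.1 w.2 * (f w.1 * g w.2)) volume)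
    (h' : Integrable (fun w : Rd d × Rd d => (b x - b w.1) * K x w.1 w.2 * (f w.1 * g' w.2))
      volume) :
    commutatorIntegral K b f (g + g') x =
      commutatorIntegral K b f g x + commutatorIntegral K b f g' x := by
  simp only [commutatorIntegral]
  rw [← integral_add h h']
  congr 1; funext w; simp only [Pi.add_apply]; ring

lemma commutatorIntegral_smul_left (c : ℂ) :
    commutatorIntegral K b (c • f) g = c • commutatorIntegral K b f g := by
  funext x
  simp only [commutatorIntegral, Pi.smul_apply, smul_eq_mul]
  rw [← integral_const_mul]
  congr 1; funext w; ring

lemma commutatorIntegral_smul_right (c : ℂ) :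
    commutatorIntegral K b f (c • g) = c • commutatorIntegral K b f g := by
  funext x
  simp only [commutatorIntegral, Pi.smul_apply, smul_eq_mul]
  rw [← integral_const_mul]
  congr 1; funext w; ring

end bound

/-! ### From the kernel bound to the bilinear operator. -/

section operator

variable {K : Rd d → Rd d → Rd d → ℂ} {cK : ℝ≥0} {ω : ℝ → ℝ} {b : Rd d → ℂ} {T : BilinOp d}
  {p q r : ℝ} {A : ℝ≥0}

/-- If the commutator integral converges absolutely and is bounded, it defines the extension of the
commutator. -/
lemma exists_bilinear_of_commutatorIntegral (hK : IsCZKernel K cK ω)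
    (hbm : AEStronglyMeasurable b volume)
    (h : ∀ f g : Rd d → ℂ, Measurable f → Measurable g → MemLp f (ENNReal.ofReal p) volume →
      MemLp g (ENNReal.ofReal q) volume →
      (∀ᵐ x ∂(volume : Measure (Rd d)), Integrable (fun w : Rd d × Rd d =>
        (b x - b w.1) * K x w.1 w.2 * (f w.1 * g w.2)) volume) ∧
      eLpNorm (commutatorIntegral K b f g) (ENNReal.ofReal r) volume ≤
        A * eLpNorm f (ENNReal.ofReal p) volume * eLpNorm g (ENNReal.ofReal q) volume) :
    ∃ S : Lp ℂ (ENNReal.ofReal p) (volume : Measure (Rd d)) →ₗ[ℂ]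
      Lp ℂ (ENNReal.ofReal q) (volume : Measure (Rd d)) →ₗ[ℂ]
        Lp ℂ (ENNReal.ofReal r) (volume : Measure (Rd d)),
      (∀ f g, ‖S f g‖ ≤ A * ‖f‖ * ‖g‖) ∧
      ∀ f g, (S f g : Rd d → ℂ) =ᵐ[volume] commutatorIntegral K b f g := by
  have hm : ∀ {u : ℝ≥0∞} (f : Lp ℂ u (volume : Measure (Rd d))), Measurable (f : Rd d → ℂ) :=
    fun f => (Lp.stronglyMeasurable f).measurable
  have H := fun (f : Lp ℂ (ENNReal.ofReal p) (volume : Measure (Rd d)))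
    (g : Lp ℂ (ENNReal.ofReal q) (volume : Measure (Rd d))) =>
      h f g (hm f) (hm g) (Lp.memLp f) (Lp.memLp g)
  have hmem : ∀ (f : Lp ℂ (ENNReal.ofReal p) (volume : Measure (Rd d)))
      (g : Lp ℂ (ENNReal.ofReal q) (volume : Measure (Rd d))),
      MemLp (commutatorIntegral K b f g) (ENNReal.ofReal r) volume := fun f g =>
    ⟨aestronglyMeasurable_commutatorIntegral_of_measurable hK hbm (hm f) (hm g),
      (H f g).2.trans_lt (ENNReal.mul_lt_top (ENNReal.mul_lt_top ENNReal.coe_lt_top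
        (Lp.memLp f).2) (Lp.memLp g).2)⟩
  refine ⟨LinearMap.mk₂ ℂ (fun f g => (hmem f g).toLp _) ?_ ?_ ?_ ?_, ?_, ?_⟩
  · intro f f' g
    rw [← MemLp.toLp_add]
    refine MemLp.toLp_congr _ _ ?_
    rw [commutatorIntegral_congr (Lp.coeFn_add f f') (EventuallyEq.refl _ _)]
    filter_upwards [(H f g).1, (H f' g).1] with x h1 h2
    exact commutatorIntegral_add_left h1 h2
  · intro c f g
    rw [← MemLp.toLp_const_smul]
    refine MemLp.toLp_congr _ _ ?_
    rw [commutatorIntegral_congr (Lp.coeFn_smul c f) (EventuallyEq.refl _ _),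
      commutatorIntegral_smul_left]
  · intro f g g'
    rw [← MemLp.toLp_add]
    refine MemLp.toLp_congr _ _ ?_
    rw [commutatorIntegral_congr (EventuallyEq.refl _ _) (Lp.coeFn_add g g')]
    filter_upwards [(H f g).1, (H f g').1] with x h1 h2
    exact commutatorIntegral_add_right h1 h2
  · intro c f g
    rw [← MemLp.toLp_const_smul]
    refine MemLp.toLp_congr _ _ ?_
    rw [commutatorIntegral_congr (EventuallyEq.refl _ _) (Lp.coeFn_smul c g),
      commutatorIntegral_smul_right]
  · intro f g
    rw [LinearMap.mk₂_apply, Lp.norm_toLp, Lp.norm_def, Lp.norm_def]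
    refine (ENNReal.toReal_mono ?_ (H f g).2).trans (le_of_eq ?_)
    · exact ENNReal.mul_ne_top (ENNReal.mul_ne_top ENNReal.coe_ne_top (Lp.memLp f).2.ne)
        (Lp.memLp g).2.ne
    · rw [ENNReal.toReal_mul, ENNReal.toReal_mul, ENNReal.coe_toReal]
  · intro f g
    rw [LinearMap.mk₂_apply]
    exact MemLp.coeFn_toLp _

/-- A kernel bound for the commutator of a Hölder function yields the operator bound. -/
theorem HasKernel.commutatorBoundedBy (hd : 1 ≤ d) {p₀ q₀ : ℝ} {B : ℝ≥0} (hK : IsCZKernel K cK ω)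
    (hT : HasKernel T K) (hB : TruncationsBoundedBy K p₀ q₀ B) (hp : 1 < p₀) (hq : 1 < q₀)
    (hσ : 1 ≤ sigma p₀ q₀) (hbm : AEStronglyMeasurable b volume)
    (hb : ∀ R : ℝ, ∃ M : ℝ≥0, ∀ᵐ x ∂(volume : Measure (Rd d)), ‖x‖ ≤ R → ‖b x‖ ≤ M)
    (h : ∀ f g : Rd d → ℂ, Measurable f → Measurable g → MemLp f (ENNReal.ofReal p) volume →
      MemLp g (ENNReal.ofReal q) volume →
      (∀ᵐ x ∂(volume : Measure (Rd d)), Integrable (fun w : Rd d × Rd d =>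
        (b x - b w.1) * K x w.1 w.2 * (f w.1 * g w.2)) volume) ∧
      eLpNorm (commutatorIntegral K b f g) (ENNReal.ofReal r) volume ≤
        A * eLpNorm f (ENNReal.ofReal p) volume * eLpNorm g (ENNReal.ofReal q) volume) :
    CommutatorBoundedBy b T p q r A := by
  obtain ⟨S, hS, hSe⟩ := exists_bilinear_of_commutatorIntegral hK hbm h
  refine ⟨S, hS, fun f g hf hg hf' hg' => ?_⟩
  have hbf := hf'.mul_of_bound hbm hb
  obtain ⟨u, hu⟩ := hT.exists_isExtValue hd hK hB hp hq hσ hf' hg'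
  obtain ⟨v, hv⟩ := hT.exists_isExtValue hd hK hB hp hq hσ hbf hg'
  refine ⟨u, v, hu, hv, ?_⟩
  have hint := (h _ _ (Lp.stronglyMeasurable (hf.toLp f)).measurable
    (Lp.stronglyMeasurable (hg.toLp g)).measurable (Lp.memLp _) (Lp.memLp _)).1
  have hint' : ∀ᵐ x ∂(volume : Measure (Rd d)), Integrable (fun w : Rd d × Rd d =>
      (b x - b w.1) * K x w.1 w.2 * (f w.1 * g w.2)) volume := by
    filter_upwards [hint] with x hx
    exact hx.congr (ae_prod_congr hf.coeFn_toLp hg.coeFn_toLp x)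
  filter_upwards [hSe (hf.toLp f) (hg.toLp g),
    hT.commutator_ae_eq hd hK hB hp hq hσ hbm hb hint' hu hv] with x h1 h2
  rw [h1, h2, commutatorIntegral_congr hf.coeFn_toLp hg.coeFn_toLp]

end operator

end BilinearSIO

/-! ### The main theorem. -/

theorem theorem4p3 (d : ℕ) (hd : 1 ≤ d)
    (p q r : ℝ) (hp : 1 < p) (hq : 1 < q) (hr : 1 / 2 < r) (hpqr : 1 / r < 1 / p + 1 / q)
    (p₀ q₀ : ℝ) (hp₀ : 1 < p₀) (hq₀ : 1 < q₀) (hσ₀ : 1 ≤ sigma p₀ q₀)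
    (cK D B : ℝ≥0) :
    ∃ C : ℝ≥0, ∀ (T : BilinOp d) (K : Rd d → Rd d → Rd d → ℂ) (ω : ℝ → ℝ),
      IsCZKernel K cK ω → diniNorm ω ≤ D → HasKernel T K → TruncationsBoundedBy K p₀ q₀ B →
      ∀ b : Rd d → ℂ, LocallyIntegrable b volume →
        commutatorNorm b T p q r ≤ C * oscNorm b (d * (1 / p + 1 / q - 1 / r)) := by
  have hd' : (0 : ℝ) < d := by exact_mod_cast hd
  obtain ⟨a₁, a₂, h1, h2, h1p, h2q, hsum, C₁, hC₁⟩ :=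
    exists_fracInt_mul_fracInt_le hd hp hq (by linarith) hpqr
  have h2d : a₂ < d := h2q.trans_le (div_le_self hd'.le hq.le)
  rw [← hsum]
  obtain ⟨C₂, hC₂⟩ := exists_holder_of_oscNorm_le d (add_pos h1 h2)
  -- The Hölder constant, the size of the kernel and the norm of the product of fractional
  -- integrals. The added `1` keeps the constant nonzero, so that the right side is `⊤` when the
  -- oscillation is infinite.
  refine ⟨C₂ * cK * C₁ + 1, fun T K ω hK _ hT hB b hb => ?_⟩
  rcases eq_or_ne (oscNorm b (a₁ + a₂)) ⊤ with htop | htop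
  · rw [htop, ENNReal.mul_top (by simp)]
    exact le_top
  obtain ⟨A, hA⟩ : ∃ A : ℝ≥0, (A : ℝ≥0∞) = oscNorm b (a₁ + a₂) := ⟨_, ENNReal.coe_toNNReal htop⟩
  rw [← hA]
  obtain ⟨s, hs, hHol⟩ := hC₂ b A hb hA.symm.le
  have hHol' : ∀ x ∈ s, ∀ y ∈ s, ‖b x - b y‖ ≤ (C₂ * A : ℝ≥0) * ‖x - y‖ ^ (a₁ + a₂) := by
    simpa using hHol
  have hbd := hT.commutatorBoundedBy (p := p) (q := q) (r := r) (A := C₂ * A * cK * C₁) hd hK hB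
    hp₀ hq₀ hσ₀ hb.aestronglyMeasurable
    (exists_bound_of_holder hs (add_pos h1 h2) (NNReal.coe_nonneg _) hHol')
    fun f g hf hg hfp hgq => by
      simpa using ae_integrable_and_eLpNorm_commutatorIntegral_le hd hK hb.aestronglyMeasurable hs
        h2 h2d hHol' (by linarith) (by linarith) (by linarith) hC₁ hf hg hfp hgq
  refine (iInf₂_le _ hbd).trans ?_
  norm_cast
  calc C₂ * A * cK * C₁ = (C₂ * cK * C₁) * A := by ring
    _ ≤ _ := by gcongr; exact le_self_add
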